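/- Let $\mathfrak N_3=\mathbb C\times\mathbb R$ be the Heisenberg group with product $(\xi_1,t_1)(\xi_2,t_2)=(\xi_1+\xi_2,\;t_1+t_2+2\,\mathrm{Im}(\xi_1\overline{\xi_2}))$. Let $U(1)$ act on it by $u(z,t)=(uz,t)$, and let $\iota(z,t)=(\bar z,-t)$. The group $G=\mathfrak N_3\rtimes\langle U(1),\iota\rangle$ acts on $\mathfrak N_3$ by $(n,A)\cdot x=n\,A(x)$; write $(z,t,A)$ for its elements, $A\in\langle U(1),\iota\rangle$. A closed nil 3-manifold is a compact space of the form $\mathfrak N_3/\Gamma$, where $\Gamma$ is a discrete subgroup of $G$ acting freely on $\mathfrak N_3$. For a subring $R\subset\mathbb C$ let $\mathfrak N_3(R)=\{(z,t): z\in R,\ it\in R\}$ and $U(1;R)=U(1)\cap R$, and let $\langle \mathfrak N_3(R)\rtimes U(1;R),\iota\rangle$ be the subgroup of $G$ generated by the elements $(z,t,u)$ with $(z,t)\in\mathfrak N_3(R)$, $u\in U(1;R)$, and by $\iota$. Put $\zeta_3=-\tfrac12+\tfrac{\sqrt{-3}}2$ and $\zeta_6=e^{\pi i/3}$; $\mathcal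 O_k$ denotes the ring of integers of $k$, and $[x,y]=xyx^{-1}y^{-1}$. **Theorem.** (A) For every closed nil 3-manifold $M$ there is an injective homomorphism $\pi_1(M)\to\langle\mathfrak N_3(\mathcal O_k)\rtimes U(1;\mathcal O_k),\iota\rangle$ with $k=\mathbb Q(i)$ or $k=\mathbb Q(\zeta_3)$. (B) For each of the following seven families of nil 3-manifold groups ($k\ge1$ an integer), the indicated assignment of the generators extends to an injective homomorphism into $\langle\mathfrak N_3(\mathcal O)\rtimes U(1;\mathcal O),\iota\rangle$, where $\mathcal O=\mathbb Z[i]$ is the ring of integers of $\mathbb Q(i)$ in (1)-(5) and $\mathcal O=\mathbb Z[\zeta_3]$ that of $\mathbb Q(\zeta_3)$ in (6), (7). In all families $[c,a]=[c,b]=1$. 1. $\langle a,b,c: [b,a]=c^k\rangle$: $a\mapsto(2k,0,1)$, $b\mapsto(2ki,0,1)$, $c\mapsto(0,16k,1)$. 2. $\langle a,b,c,\alpha:[b,a]=c^k,\ [\alpha,c]=1,\ \alpha a=a^{-1}\alpha,\ \alpha b=b^{-1}\alpha,\ \alpha^2=c\rangle$, $k$ even: $a,b,c$ as in 1, $\alpha\mapsto(0,8k,-1)$.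 3. $\langle a,b,c,\alpha:[b,a]=c^{2k},\ [a,\alpha]=1,\ \alpha c=c^{-1}\alpha,\ \alpha b=b^{-1}\alpha c^{-k},\ \alpha^2=a\rangle$: $a\mapsto(4k,0,1)$, $b\mapsto(4ki,0,1)$, $c\mapsto(0,32k,1)$, $\alpha\mapsto(2k,0,\iota)$. 4. $\langle a,b,c,\alpha,\beta:[b,a]=c^{2k},\ [c,\alpha]=[a,\beta]=1,\ \beta c=c^{-1}\beta,\ \alpha a=a^{-1}\alpha c^k,\ \alpha b=b^{-1}\alpha c^{-k},\ \alpha^2=c,\ \beta^2=a,\ \beta b=b^{-1}\beta c^{-k},\ \alpha\beta=a^{-1}b^{-1}\beta\alpha c^{-k-1}\rangle$, $k$ even: $a,b,c$ as in 3, $\alpha\mapsto(-2k-2ki,16k,-1)$, $\beta\mapsto(2k,0,\iota)$. 5. $\langle a,b,c,\alpha:[b,a]=c^k,\ [c,\alpha]=1,\ \alpha a=b\alpha,\ \alpha b=a^{-1}\alpha,\ \alpha^4=c^p\rangle$, where $2\mid k$ and $p=1$, or $4\mid k$ and $p=3$: $a,b,c$ as in 1, $\alpha\mapsto(0,4pk,i)$.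 6. $\langle a,b,c,\alpha:[b,a]=c^k,\ [c,\alpha]=1,\ \alpha a=b\alpha c^{k_1},\ \alpha b=a^{-1}b^{-1}\alpha,\ \alpha^3=c^{k_2}\rangle$, where $3\mid k$, $k_1=0$, $k_2\in\{1,2\}$, or $3\nmid k$, $k_1=k_2=1$: $a\mapsto(24k,0,1)$, $b\mapsto(24k\zeta_3,0,1)$, $c\mapsto(0,1152k\sqrt3,1)$, $\alpha\mapsto\big(-6(k+2k_1)+6\sqrt3\,(k-2k_1)i,\ 48\sqrt3\,(k^2-2kk_1+4k_1^2+8kk_2),\ \zeta_3\big)$. 7. $\langle a,b,c,\alpha:[b,a]=c^k,\ [c,\alpha]=1,\ \alpha a=ab\alpha,\ \alpha b=a^{-1}\alpha,\ \alpha^6=c^{k_1}\rangle$, where $k\equiv0,4\pmod 6$ and $k_1=1$, or $k\equiv0,2\pmod 6$ and $k_1=5$: $a\mapsto(12k,0,1)$, $b\mapsto(12k\zeta_3,0,1)$, $c\mapsto(0,288k\sqrt3,1)$, $\alpha\mapsto\big(6k,\ 12k(4k_1+3k)\sqrt3,\ \zeta_6\big)$. -/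

import Mathlib

open scoped NumberField ComplexConjugate commutatorElement

noncomputable section

/-- The three-dimensional Heisenberg group `𝔑₃`, with underlying space `ℂ × ℝ`. -/
@[ext] structure Heis where
  z : ℂ
  t : ℝ

namespace Heis

/-- `(ξ₁, t₁) (ξ₂, t₂) = (ξ₁ + ξ₂, t₁ + t₂ + 2 Im ⟨ξ₁, ξ₂⟩)`, where `⟨ξ₁, ξ₂⟩ = ξ₁ * conj ξ₂`. -/
instance : Mul Heis :=
  ⟨fun x y => ⟨x.z + y.z, x.t + y.t + 2 * (x.z * conj y.z).im⟩⟩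

instance : One Heis := ⟨⟨0, 0⟩⟩

instance : Inv Heis := ⟨fun x => ⟨-x.z, -x.t⟩⟩

@[simp] theorem mul_z (x y : Heis) : (x * y).z = x.z + y.z := rfl

@[simp] theorem mul_t (x y : Heis) :
    (x * y).t = x.t + y.t + 2 * (x.z * conj y.z).im := rfl

@[simp] theorem one_z : (1 : Heis).z = 0 := rfl

@[simp] theorem one_t : (1 : Heis).t = 0 := rfl

@[simp] theorem inv_z (x : Heis) : (x⁻¹).z = -x.z := rfl

@[simp] theorem inv_t (x : Heis) : (x⁻¹).t = -x.t := rfl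

instance : Group Heis :=
  Group.ofLeftAxioms
    (by
      intro x y w
      ext1
      · simp [add_assoc]
      · simp
        ring)
    (by
      intro x
      ext1 <;> simp)
    (by
      intro x
      ext1
      · simp
      · simp
        ring)

/-- The topology of `ℂ × ℝ`. -/
instance : TopologicalSpace Heis :=
  TopologicalSpace.induced (fun x : Heis => (x.z, x.t)) inferInstance

end Heis

/-- The two-element group `{1, ι}`, written as `ℤˣ = {1, -1}`, acts on `U(1)` by complex conjugation,
that is, `ι u ι⁻¹ = conj u = u⁻¹`. -/
def circleConj : ℤˣ →* MulAut Circle where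
  toFun ε :=
    { toFun := fun u => u ^ (ε : ℤ)
      invFun := fun u => u ^ (ε : ℤ)
      left_inv := fun u => by
        rcases Int.units_eq_one_or ε with h | h <;> simp [h]
      right_inv := fun u => by
        rcases Int.units_eq_one_or ε with h | h <;> simp [h]
      map_mul' := fun u v => mul_zpow u v _ }
  map_one' := by
    ext u
    simp
  map_mul' ε δ := by
    refine MulEquiv.ext fun u => ?_
    change u ^ ((ε * δ : ℤˣ) : ℤ) = (u ^ (δ : ℤ)) ^ (ε : ℤ)
    rw [← zpow_mul, Units.val_mul, mul_comm]

/-- The group `⟨U(1), ι⟩ = U(1) ⋊ {1, ι}`; the element `⟨u, ε⟩` is `u` for `ε = 1` and `u ι` for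
`ε = -1`. -/
abbrev UnitaryIota : Type := Circle ⋊[circleConj] ℤˣ

instance : TopologicalSpace UnitaryIota :=
  TopologicalSpace.induced (fun κ : UnitaryIota => (κ.left, κ.right)) inferInstance

/-- Complex conjugation for `ε = -1`, the identity for `ε = 1`. -/
def conjIf (ε : ℤˣ) (z : ℂ) : ℂ := if ε = 1 then z else conj z

@[simp] theorem conjIf_one (z : ℂ) : conjIf 1 z = z := if_pos rfl

@[simp] theorem conjIf_neg_one (z : ℂ) : conjIf (-1) z = conj z := if_neg (by decide)

/-- The map `(z, t) ↦ (u ι^ε) (z, t)`, where `u (z, t) = (u z, t)` and `ι (z, t) = (conj z, -t)`. -/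
def heisMap (u : Circle) (ε : ℤˣ) (x : Heis) : Heis :=
  ⟨u * conjIf ε x.z, ((ε : ℤ) : ℝ) * x.t⟩

theorem heisMap_one (x : Heis) : heisMap 1 1 x = x := by
  ext1 <;> simp [heisMap]

theorem heisMap_comp (u v : Circle) (ε δ : ℤˣ) (x : Heis) :
    heisMap u ε (heisMap v δ x) = heisMap (u * v ^ (ε : ℤ)) (ε * δ) x := by
  have hv : conj (v : ℂ) = (v : ℂ)⁻¹ := by
    rw [← Circle.coe_inv_eq_conj, Circle.coe_inv]
  rcases Int.units_eq_one_or ε with rfl | rfl <;>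
    rcases Int.units_eq_one_or δ with rfl | rfl <;>
    ext1 <;> simp [heisMap, mul_assoc, hv]

theorem heisMap_mul (u : Circle) (ε : ℤˣ) (x y : Heis) :
    heisMap u ε (x * y) = heisMap u ε x * heisMap u ε y := by
  have hu : (u : ℂ) * conj (u : ℂ) = 1 := by
    rw [Complex.mul_conj, Circle.normSq_coe, Complex.ofReal_one]
  rcases Int.units_eq_one_or ε with rfl | rfl
  · ext1
    · simp [heisMap, mul_add]
    · have e : (u : ℂ) * x.z * conj ((u : ℂ) * y.z) = x.z * conj y.z := by
        rw [map_mul]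
        linear_combination x.z * conj y.z * hu
      simp only [heisMap, conjIf_one, Heis.mul_t, e]
      simp
  · ext1
    · simp [heisMap, mul_add]
    · have e : (u : ℂ) * conj x.z * conj ((u : ℂ) * conj y.z) = conj (x.z * conj y.z) := by
        rw [map_mul, map_mul]
        linear_combination conj x.z * conj (conj y.z) * hu
      simp only [heisMap, conjIf_neg_one, Heis.mul_t, e, Complex.conj_im]
      push_cast
      ring

/-- The action of `⟨U(1), ι⟩` on the Heisenberg group by automorphisms. -/
def heisAut : UnitaryIota →* MulAut Heis where
  toFun κ :=
    { toFun := heisMap κ.left κ.right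
      invFun := heisMap κ⁻¹.left κ⁻¹.right
      left_inv := fun x => by
        rw [heisMap_comp]
        change heisMap (κ⁻¹ * κ).left (κ⁻¹ * κ).right x = x
        rw [inv_mul_cancel]
        exact heisMap_one x
      right_inv := fun x => by
        rw [heisMap_comp]
        change heisMap (κ * κ⁻¹).left (κ * κ⁻¹).right x = x
        rw [mul_inv_cancel]
        exact heisMap_one x
      map_mul' := heisMap_mul κ.left κ.right }
  map_one' := MulEquiv.ext heisMap_one
  map_mul' κ μ := MulEquiv.ext fun x => (heisMap_comp κ.left μ.left κ.right μ.right x).symm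

/-- The group `𝔑₃ ⋊ ⟨U(1), ι⟩`. -/
abbrev HeisIsom : Type := Heis ⋊[heisAut] UnitaryIota

instance : TopologicalSpace HeisIsom :=
  TopologicalSpace.induced (fun g : HeisIsom => (g.left, g.right)) inferInstance

/-- The affine action of `𝔑₃ ⋊ ⟨U(1), ι⟩` on `𝔑₃`: `(n, A) • x = n * A x`. -/
instance : MulAction HeisIsom Heis where
  smul g x := g.left * heisAut g.right x
  one_smul x := by
    change (1 : HeisIsom).left * heisAut (1 : HeisIsom).right x = x
    simp
  mul_smul g h x := by
    change (g * h).left * heisAut (g * h).right x =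
      g.left * heisAut g.right (h.left * heisAut h.right x)
    simp [mul_assoc]

/-- A closed nil 3-manifold: a compact space of the form `𝔑₃ / Γ`, where `Γ` is a discrete
subgroup of `𝔑₃ ⋊ ⟨U(1), ι⟩` which acts freely on `𝔑₃`. -/
def IsClosedNilThreeManifold (M : Type*) [TopologicalSpace M] : Prop :=
  CompactSpace M ∧ ∃ Γ : Subgroup HeisIsom, DiscreteTopology Γ ∧
    (∀ γ ∈ Γ, ∀ x : Heis, γ • x = x → γ = 1) ∧
    Nonempty (M ≃ₜ MulAction.orbitRel.Quotient Γ Heis)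

/-- The ring of integers of a subfield of `ℂ`, as a subring of `ℂ`. -/
def integersIn (k : IntermediateField ℚ ℂ) : Subring ℂ := (algebraMap (𝓞 k) ℂ).range

/-- The set `𝔑₃(R) ⋊ U(1; R)`, where `𝔑₃(R) = R × Im R` and `Im R` consists of the real `t` such
that the purely imaginary number `t i` is in `R`. -/
def heisIntegral (R : Subring ℂ) : Set HeisIsom :=
  {g | g.left.z ∈ R ∧ (g.left.t : ℂ) * Complex.I ∈ R ∧
    (g.right.left : ℂ) ∈ R ∧ g.right.right = 1}

/-- The element `ι`. -/
def iota : HeisIsom := ⟨1, ⟨1, -1⟩⟩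

/-- The group `⟨𝔑₃(R) ⋊ U(1; R), ι⟩`. -/
def heisIntegralIota (R : Subring ℂ) : Subgroup HeisIsom :=
  Subgroup.closure (heisIntegral R ∪ {iota})

/-- `ζ₃ = -1/2 + √-3/2`. -/
def zeta3 : ℂ := -1 / 2 + (Real.sqrt 3 / 2 : ℝ) * Complex.I

/-- The field `ℚ(i)`. -/
def gaussField : IntermediateField ℚ ℂ := IntermediateField.adjoin ℚ {Complex.I}

/-- The field `ℚ(ζ₃)`. -/
def eisensteinField : IntermediateField ℚ ℂ := IntermediateField.adjoin ℚ {zeta3}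

/-! The seven families of nil 3-manifold groups. The generators `a, b, c, α, β` are numbered
`0, 1, 2, 3, 4`; a relation `u = v` is given by the word `u * v⁻¹`. -/

/-- `⟨a, b, c : [b,a] = c^k, [c,a] = [c,b] = 1⟩`. -/
def nilRels1 (k : ℕ) : Set (FreeGroup (Fin 3)) :=
  let a := FreeGroup.of 0
  let b := FreeGroup.of 1
  let c := FreeGroup.of 2
  {⁅b, a⁆ * (c ^ k)⁻¹, ⁅c, a⁆, ⁅c, b⁆}

/-- `[b,a] = c^k, [c,a] = [c,b] = [α,c] = 1, α a = a⁻¹ α, α b = b⁻¹ α, α² = c`. -/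
def nilRels2 (k : ℕ) : Set (FreeGroup (Fin 4)) :=
  let a := FreeGroup.of 0
  let b := FreeGroup.of 1
  let c := FreeGroup.of 2
  let α := FreeGroup.of 3
  {⁅b, a⁆ * (c ^ k)⁻¹, ⁅c, a⁆, ⁅c, b⁆, ⁅α, c⁆,
    (α * a) * (a⁻¹ * α)⁻¹, (α * b) * (b⁻¹ * α)⁻¹, α ^ 2 * c⁻¹}

/-- `[b,a] = c^(2k), [c,a] = [c,b] = [a,α] = 1, α c = c⁻¹ α, α b = b⁻¹ α c^(-k), α² = a`. -/
def nilRels3 (k : ℕ) : Set (FreeGroup (Fin 4)) :=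
  let a := FreeGroup.of 0
  let b := FreeGroup.of 1
  let c := FreeGroup.of 2
  let α := FreeGroup.of 3
  {⁅b, a⁆ * (c ^ (2 * k))⁻¹, ⁅c, a⁆, ⁅c, b⁆, ⁅a, α⁆,
    (α * c) * (c⁻¹ * α)⁻¹, (α * b) * (b⁻¹ * α * (c ^ k)⁻¹)⁻¹, α ^ 2 * a⁻¹}

/-- `[b,a] = c^(2k), [c,a] = [c,b] = [c,α] = [a,β] = 1, β c = c⁻¹ β, α a = a⁻¹ α c^k,
α b = b⁻¹ α c^(-k), α² = c, β² = a, β b = b⁻¹ β c^(-k), α β = a⁻¹ b⁻¹ β α c^(-k-1)`. -/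
def nilRels4 (k : ℕ) : Set (FreeGroup (Fin 5)) :=
  let a := FreeGroup.of 0
  let b := FreeGroup.of 1
  let c := FreeGroup.of 2
  let α := FreeGroup.of 3
  let β := FreeGroup.of 4
  {⁅b, a⁆ * (c ^ (2 * k))⁻¹, ⁅c, a⁆, ⁅c, b⁆, ⁅c, α⁆, ⁅a, β⁆,
    (β * c) * (c⁻¹ * β)⁻¹, (α * a) * (a⁻¹ * α * c ^ k)⁻¹,
    (α * b) * (b⁻¹ * α * (c ^ k)⁻¹)⁻¹, α ^ 2 * c⁻¹, β ^ 2 * a⁻¹,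
    (β * b) * (b⁻¹ * β * (c ^ k)⁻¹)⁻¹,
    (α * β) * (a⁻¹ * b⁻¹ * β * α * (c ^ (k + 1))⁻¹)⁻¹}

/-- `[b,a] = c^k, [c,a] = [c,b] = [c,α] = 1, α a = b α, α b = a⁻¹ α, α⁴ = c^p`. -/
def nilRels5 (k p : ℕ) : Set (FreeGroup (Fin 4)) :=
  let a := FreeGroup.of 0
  let b := FreeGroup.of 1
  let c := FreeGroup.of 2
  let α := FreeGroup.of 3
  {⁅b, a⁆ * (c ^ k)⁻¹, ⁅c, a⁆, ⁅c, b⁆, ⁅c, α⁆,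
    (α * a) * (b * α)⁻¹, (α * b) * (a⁻¹ * α)⁻¹, α ^ 4 * (c ^ p)⁻¹}

/-- `[b,a] = c^k, [c,a] = [c,b] = [c,α] = 1, α a = b α c^(k₁), α b = a⁻¹ b⁻¹ α, α³ = c^(k₂)`. -/
def nilRels6 (k k₁ k₂ : ℕ) : Set (FreeGroup (Fin 4)) :=
  let a := FreeGroup.of 0
  let b := FreeGroup.of 1
  let c := FreeGroup.of 2
  let α := FreeGroup.of 3
  {⁅b, a⁆ * (c ^ k)⁻¹, ⁅c, a⁆, ⁅c, b⁆, ⁅c, α⁆,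
    (α * a) * (b * α * c ^ k₁)⁻¹, (α * b) * (a⁻¹ * b⁻¹ * α)⁻¹, α ^ 3 * (c ^ k₂)⁻¹}

/-- `[b,a] = c^k, [c,a] = [c,b] = [c,α] = 1, α a = a b α, α b = a⁻¹ α, α⁶ = c^(k₁)`. -/
def nilRels7 (k k₁ : ℕ) : Set (FreeGroup (Fin 4)) :=
  let a := FreeGroup.of 0
  let b := FreeGroup.of 1
  let c := FreeGroup.of 2
  let α := FreeGroup.of 3
  {⁅b, a⁆ * (c ^ k)⁻¹, ⁅c, a⁆, ⁅c, b⁆, ⁅c, α⁆,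
    (α * a) * (a * b * α)⁻¹, (α * b) * (a⁻¹ * α)⁻¹, α ^ 6 * (c ^ k₁)⁻¹}

/-- The element `(z, t, u)` of `𝔑₃ ⋊ U(1)`. -/
def heisRot (z : ℂ) (t : ℝ) (u : Circle) : HeisIsom := ⟨⟨z, t⟩, ⟨u, 1⟩⟩

/-- The element `(z, t, u ι)` of `𝔑₃ ⋊ ⟨U(1), ι⟩`. -/
def heisRotIota (z : ℂ) (t : ℝ) (u : Circle) : HeisIsom := ⟨⟨z, t⟩, ⟨u, -1⟩⟩

/-- The assignment `i ↦ v i` of the generators extends to a faithful representation of the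
presented group in `⟨𝔑₃(𝒪_k) ⋊ U(1; 𝒪_k), ι⟩`. -/
def GivesFaithfulRep {n : ℕ} (rels : Set (FreeGroup (Fin n))) (k : IntermediateField ℚ ℂ)
    (v : Fin n → HeisIsom) : Prop :=
  ∃ φ : PresentedGroup rels →* heisIntegralIota (integersIn k),
    Function.Injective φ ∧ ∀ i, (φ (PresentedGroup.of i) : HeisIsom) = v i

end

/-!
Why the theorem holds.

**Fundamental groups.** Let `M = 𝔑₃ / Γ` be a closed nil 3-manifold. The stabilizers of the action
of `𝔑₃ ⋊ ⟨U(1), ι⟩` are compact, so the discrete group `Γ` acts properly discontinuously, and freely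
by assumption. As `𝔑₃` is simply connected, `π₁(M)` is isomorphic to `Γ`
(`exists_injective_hom_of_quotient`), and it remains to embed `Γ` in an integral group. This does
not need the classification of these groups.

* Compactness makes the orbits of `Γ` in `ℂ` relatively dense. Because `U(1)` is commutative,
  commutators of orientation preserving elements are translations, and it follows that
  `Γ` contains translations in two independent directions (`exists_independent_translations`).
  Their commutator is central, and the centre is discrete, so the areas spanned by translation
  vectors lie in a cyclic group `ℤ τ`. Hence the translation vectors form a lattice, and
  the rotations of the holonomy have integral trace (`IsNilLattice.exists_trace`).
* A real linear change of coordinates, compatible with the holonomy, puts `1` and `ω` among the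
  translation vectors, where `ω = ζ₃` if there are rotations of order 3 or 6, and `ω = i` otherwise,
  and makes one of the reflections, if there are any, the one in the real axis
  (`IsNilLattice.exists_isNormalized`). Conjugation by an element of `𝔑₃` then makes the central
  coordinates of the two translations and the reflection zero (`IsNormalized.exists_isCentered`).
* Now all coordinates are rational with bounded denominators. For translation vectors this follows
  from the areas spanned with `1` and `ω`; for the vector of an arbitrary `g`, from the action of
  `g` on the two translations by conjugation; for the central coordinate of a rotation `g`, from
  the translation `g ^ 12` (`IsCentered.rotation_t`). A reflection is the product of a rotation and
  the given one. The rotation parts are algebraic integers, since they preserve a lattice. A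
  dilation by a common denominator carries `Γ` into the integral group (`IsCentered.exists_hom`).

**The seven families.** The relations are polynomial identities in the coordinates of
`HasCoords`. For faithfulness, each element of `⟨a, b, c⟩` is of the form `c ^ l * (a ^ i * b ^ j)`,
which can be read off from its image (`faithful_nilpotent`). The generators `α`, `β` normalize the
group generated by the previous ones and have a power in it, and the holonomy part of
the image detects these powers (`faithful_extension`).
-/

/-! ### Coordinates -/

namespace HeisIsom

theorem ext_coords {g h : HeisIsom} (hz : g.left.z = h.left.z) (ht : g.left.t = h.left.t)
    (hu : (g.right.left : ℂ) = h.right.left) (hε : g.right.right = h.right.right) : g = h := by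
  obtain ⟨⟨z, t⟩, ⟨u, ε⟩⟩ := g
  obtain ⟨⟨z', t'⟩, ⟨u', ε'⟩⟩ := h
  simp only at hz ht hu hε
  obtain rfl := Circle.ext hu
  subst hz ht hε
  rfl

theorem mul_z (g h : HeisIsom) :
    (g * h).left.z = g.left.z + g.right.left * conjIf g.right.right h.left.z := rfl

theorem mul_t (g h : HeisIsom) :
    (g * h).left.t = g.left.t + ((g.right.right : ℤ) : ℝ) * h.left.t +
      2 * (g.left.z * conj ((g.right.left : ℂ) * conjIf g.right.right h.left.z)).im := rfl

theorem mul_u (g h : HeisIsom) :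
    (g * h).right.left = g.right.left * h.right.left ^ (g.right.right : ℤ) := rfl

theorem mul_ε (g h : HeisIsom) :
    (g * h).right.right = g.right.right * h.right.right := rfl

theorem inv_ε (g : HeisIsom) : (g⁻¹).right.right = g.right.right := by
  change (g.right.right)⁻¹ = g.right.right
  rcases Int.units_eq_one_or g.right.right with h | h <;> simp [h]

theorem inv_u (g : HeisIsom) :
    (g⁻¹).right.left = (g.right.left⁻¹) ^ (g.right.right : ℤ) := by
  change ((g.right.left)⁻¹) ^ (((g.right.right)⁻¹ : ℤˣ) : ℤ) = _
  rcases Int.units_eq_one_or g.right.right with h | h <;> simp [h]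

end HeisIsom

/-! ### Topology -/

theorem conj_circle (u : Circle) : conj (u : ℂ) = (u : ℂ)⁻¹ := by
  rw [← Circle.coe_inv_eq_conj, Circle.coe_inv]

/-- The Heisenberg group is homeomorphic to `ℂ × ℝ`. -/
noncomputable def heisHomeomorph : Heis ≃ₜ ℂ × ℝ where
  toFun x := (x.z, x.t)
  invFun p := ⟨p.1, p.2⟩
  left_inv _ := rfl
  right_inv _ := rfl
  continuous_toFun := continuous_induced_dom
  continuous_invFun := continuous_induced_rng.2 continuous_id

/-- `𝔑₃ ⋊ ⟨U(1), ι⟩` is homeomorphic to the product of its factors. -/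
noncomputable def heisIsomHomeomorph : HeisIsom ≃ₜ Heis × (Circle × ℤˣ) where
  toFun g := (g.left, (g.right.left, g.right.right))
  invFun p := ⟨p.1, ⟨p.2.1, p.2.2⟩⟩
  left_inv _ := rfl
  right_inv _ := rfl
  continuous_toFun := by
    have h1 : Continuous fun g : HeisIsom => (g.left, g.right) := continuous_induced_dom
    have h2 : Continuous fun κ : UnitaryIota => (κ.left, κ.right) := continuous_induced_dom
    exact h1.fst.prodMk (h2.comp h1.snd)
  continuous_invFun := by
    refine continuous_induced_rng.2 (continuous_fst.prodMk ?_)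
    exact continuous_induced_rng.2 continuous_snd

instance : T2Space Heis := heisHomeomorph.symm.t2Space
instance : LocallyCompactSpace Heis := heisHomeomorph.isClosedEmbedding.locallyCompactSpace
instance : T2Space HeisIsom := heisIsomHomeomorph.symm.t2Space

instance : SimplyConnectedSpace Heis :=
  have : ContractibleSpace Heis := heisHomeomorph.contractibleSpace
  inferInstance

theorem Heis.continuous_z : Continuous Heis.z := heisHomeomorph.continuous.fst

theorem Heis.continuous_t : Continuous Heis.t := heisHomeomorph.continuous.snd

theorem Heis.continuous_iff {X : Type*} [TopologicalSpace X] {f : X → Heis} :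
    Continuous f ↔ Continuous (fun x => (f x).z) ∧ Continuous fun x => (f x).t := by
  rw [← heisHomeomorph.comp_continuous_iff]
  exact ⟨fun h => ⟨h.fst, h.snd⟩, fun h => h.1.prodMk h.2⟩

instance : IsTopologicalGroup Heis where
  continuous_mul := by
    have h1 := Heis.continuous_z
    have h2 := Heis.continuous_t
    refine Heis.continuous_iff.2 ⟨?_, ?_⟩ <;> simp only [Heis.mul_z, Heis.mul_t] <;> fun_prop
  continuous_inv := by
    have h1 := Heis.continuous_z
    have h2 := Heis.continuous_t
    refine Heis.continuous_iff.2 ⟨?_, ?_⟩ <;> simp only [Heis.inv_z, Heis.inv_t] <;> fun_prop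

/-- A map out of a product with `ℤˣ` is continuous if it is so for each sign. -/
theorem continuous_of_units {X Y : Type*} [TopologicalSpace X] [TopologicalSpace Y]
    {e : X → ℤˣ} (he : Continuous e) {f : X → ℤˣ → Y} (h : ∀ ε, Continuous fun x => f x ε) :
    Continuous fun x => f x (e x) := by
  refine continuous_iff_continuousAt.2 fun x => ?_
  have : ∀ᶠ y in nhds x, e y = e x := 
    he.continuousAt.preimage_mem_nhds ((isOpen_discrete {e x}).mem_nhds rfl)
  refine ((h (e x)).continuousAt (x := x)).congr ?_
  filter_upwards [this] with y hy
  rw [hy]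

theorem continuous_heisMap {X : Type*} [TopologicalSpace X] {u : X → Circle} {e : X → ℤˣ}
    {p : X → Heis} (hu : Continuous u) (he : Continuous e) (hp : Continuous p) :
    Continuous fun x => heisMap (u x) (e x) (p x) := by
  refine continuous_of_units he (f := fun x ε => heisMap (u x) ε (p x)) fun ε => ?_
  have h1 := Heis.continuous_z.comp hp
  have h2 := Heis.continuous_t.comp hp
  have h3 : Continuous fun x => (u x : ℂ) := by fun_prop
  simp only [Function.comp_def] at h1 h2
  rcases Int.units_eq_one_or ε with rfl | rfl <;>
    refine Heis.continuous_iff.2 ⟨?_, ?_⟩ <;> simp only [heisMap, conjIf_one, conjIf_neg_one] <;>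
    fun_prop

namespace HeisIsom

theorem continuous_left : Continuous fun g : HeisIsom => g.left :=
  heisIsomHomeomorph.continuous.fst

theorem continuous_u : Continuous fun g : HeisIsom => g.right.left :=
  heisIsomHomeomorph.continuous.snd.fst

theorem continuous_ε : Continuous fun g : HeisIsom => g.right.right :=
  heisIsomHomeomorph.continuous.snd.snd

theorem continuous_of_factors {X : Type*} [TopologicalSpace X] {f : X → HeisIsom}
    (h1 : Continuous fun x => (f x).left) (h2 : Continuous fun x => (f x).right.left)
    (h3 : Continuous fun x => (f x).right.right) : Continuous f := by
  rw [← heisIsomHomeomorph.comp_continuous_iff]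
  exact h1.prodMk (h2.prodMk h3)

end HeisIsom

instance : ContinuousMul HeisIsom where
  continuous_mul := by
    have hl := HeisIsom.continuous_left
    have hu := HeisIsom.continuous_u
    have hε := HeisIsom.continuous_ε
    refine HeisIsom.continuous_of_factors ?_ ?_ ?_
    · exact (hl.comp continuous_fst).mul (continuous_heisMap (hu.comp continuous_fst)
        (hε.comp continuous_fst) (hl.comp continuous_snd))
    · simp only [HeisIsom.mul_u]
      refine (hu.comp continuous_fst).mul (continuous_of_units (hε.comp continuous_fst)
        (f := fun p : HeisIsom × HeisIsom => fun ε => p.2.right.left ^ (ε : ℤ)) fun ε => ?_)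
      exact (hu.comp continuous_snd).zpow _
    · exact (hε.comp continuous_fst).mul (hε.comp continuous_snd)

instance : IsTopologicalGroup HeisIsom where
  continuous_inv := by
    have hl := HeisIsom.continuous_left
    have hu := HeisIsom.continuous_u
    have hε := HeisIsom.continuous_ε
    have hu' : Continuous fun g : HeisIsom => (g⁻¹).right.left := by
      simp only [HeisIsom.inv_u]
      exact continuous_of_units hε
        (f := fun g : HeisIsom => fun ε => (g.right.left⁻¹) ^ (ε : ℤ)) fun ε => hu.inv.zpow _
    have hε' : Continuous fun g : HeisIsom => (g⁻¹).right.right := by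
      simpa only [HeisIsom.inv_ε] using hε
    refine HeisIsom.continuous_of_factors ?_ hu' hε'
    exact continuous_heisMap hu' hε' hl.inv

theorem HeisIsom.smul_def (g : HeisIsom) (x : Heis) :
    g • x = g.left * heisMap g.right.left g.right.right x := rfl

instance : ContinuousSMul HeisIsom Heis where
  continuous_smul := by
    simp only [HeisIsom.smul_def]
    exact (HeisIsom.continuous_left.comp continuous_fst).mul
      (continuous_heisMap (HeisIsom.continuous_u.comp continuous_fst)
        (HeisIsom.continuous_ε.comp continuous_fst) continuous_snd)

/-- The stabilizers of the action are compact, so that only a compact set of motions carries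
a compact set to one that meets a given compact set. -/
theorem isCompact_transporter {K L : Set Heis} (hK : IsCompact K) (hL : IsCompact L) :
    ∃ C : Set HeisIsom, IsCompact C ∧ ∀ g : HeisIsom, ((g • ·) '' K ∩ L).Nonempty → g ∈ C := by
  have hc : IsCompact ((Set.univ : Set (Circle × ℤˣ)) ×ˢ (K ×ˢ L)) :=
    isCompact_univ.prod (hK.prod hL)
  have hf : Continuous fun q : (Circle × ℤˣ) × (Heis × Heis) =>
      heisIsomHomeomorph.symm (q.2.2 * (heisMap q.1.1 q.1.2 q.2.1)⁻¹, q.1) := by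
    have := continuous_heisMap (X := (Circle × ℤˣ) × (Heis × Heis)) (u := fun q => q.1.1)
      (e := fun q => q.1.2) (p := fun q => q.2.1) (by fun_prop) (by fun_prop) (by fun_prop)
    fun_prop
  refine ⟨_, hc.image hf, ?_⟩
  rintro g ⟨y, ⟨x, hx, rfl⟩, hy⟩
  refine ⟨((g.right.left, g.right.right), (x, g • x)), ⟨trivial, hx, hy⟩, ?_⟩
  rw [Homeomorph.symm_apply_eq]
  refine Prod.ext ?_ rfl
  simp [HeisIsom.smul_def, heisIsomHomeomorph]

theorem properlyDiscontinuousSMul_of_discrete (Γ : Subgroup HeisIsom) [DiscreteTopology Γ] :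
    ProperlyDiscontinuousSMul Γ Heis where
  finite_disjoint_inter_image {K L} hK hL := by
    obtain ⟨C, hC, hCg⟩ := isCompact_transporter hK hL
    have hcl : Topology.IsClosedEmbedding (Subtype.val : Γ → HeisIsom) :=
      Topology.IsClosedEmbedding.subtypeVal Γ.isClosed_of_discrete
    have : IsCompact (Subtype.val ⁻¹' C : Set Γ) := hcl.isCompact_preimage hC
    exact this.finite_of_discrete.subset fun g hg => hCg g hg

/-- The fundamental group of `𝔑₃ / Γ` is isomorphic to `Γ`. -/
theorem exists_injective_hom_of_quotient {M : Type*} [TopologicalSpace M] (Γ : Subgroup HeisIsom)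
    [DiscreteTopology Γ] (hfree : ∀ γ ∈ Γ, ∀ x : Heis, γ • x = x → γ = 1)
    (f : M ≃ₜ MulAction.orbitRel.Quotient Γ Heis) (x : M) :
    ∃ φ : FundamentalGroup M x →* Γ, Function.Injective φ := by
  have := properlyDiscontinuousSMul_of_discrete Γ
  have : IsCancelSMul Γ Heis := isCancelSMul_iff_eq_one_of_smul_eq.2 fun g y h =>
    Subtype.ext (hfree g g.2 y h)
  have hq := (isQuotientCoveringMap_quotientMk_of_properlyDiscontinuousSMul
    (G := Γ) (E := Heis)).homeomorph_comp f.symm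
  obtain ⟨e, he⟩ := hq.surjective x
  let ψ := (hq.fundamentalGroupEquiv (x := x) ⟨e, he⟩).trans (MulEquiv.inv' Γ).symm
  exact ⟨ψ.toMonoidHom, ψ.injective⟩

/-- If `𝔑₃ / Γ` is compact then the orbit of the origin has bounded distance to every point
of `ℂ`. -/
theorem exists_bound_of_compact_quotient (Γ : Subgroup HeisIsom)
    [CompactSpace (MulAction.orbitRel.Quotient Γ Heis)] :
    ∃ R : ℝ, ∀ w : ℂ, ∃ γ ∈ Γ, ‖w - γ.left.z‖ ≤ R := by
  let π : Heis → MulAction.orbitRel.Quotient Γ Heis := Quotient.mk _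
  have hπ : IsOpenMap π := isOpenMap_quotient_mk'_mul
  let U : ℕ → Set Heis := fun n => {x | ‖x.z‖ < n}
  have hU : ∀ n, IsOpen (U n) := fun n =>
    isOpen_lt (Heis.continuous_z.norm) continuous_const
  obtain ⟨n, hn⟩ := isCompact_univ.elim_directed_cover (fun n => π '' U n)
    (fun n => hπ _ (hU n)) (fun q _ => by
      obtain ⟨x, rfl⟩ := Quotient.exists_rep q
      obtain ⟨n, hn⟩ := exists_nat_gt ‖x.z‖
      exact Set.mem_iUnion.2 ⟨n, x, hn, rfl⟩)
    (directed_of_isDirected_le fun i j hij => Set.image_mono fun x (hx : ‖x.z‖ < i) =>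
      lt_of_lt_of_le hx (by exact_mod_cast hij))
  refine ⟨n, fun w => ?_⟩
  obtain ⟨x, hx, hxw⟩ := hn (Set.mem_univ (π ⟨w, 0⟩))
  obtain ⟨γ, hγ⟩ := MulAction.orbitRel_apply.1 (Quotient.exact hxw.symm)
  refine ⟨γ, γ.2, ?_⟩
  have h1 : (γ : HeisIsom).left.z + (γ : HeisIsom).right.left *
      conjIf (γ : HeisIsom).right.right x.z = w := congrArg Heis.z hγ
  rw [← h1, add_sub_cancel_left, norm_mul, Circle.norm_coe, one_mul]
  have hx' : ‖x.z‖ < n := hx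
  rcases Int.units_eq_one_or (γ : HeisIsom).right.right with h | h <;> rw [h] <;> simp [hx'.le]

/-- The central part of a discrete subgroup is infinite cyclic or trivial. -/
theorem exists_center_generator (Γ : Subgroup HeisIsom) [DiscreteTopology Γ] :
    ∃ τ : ℝ, ∀ t : ℝ, heisRot 0 t 1 ∈ Γ → ∃ n : ℤ, t = n * τ := by
  have hadd : ∀ s t, heisRot 0 (s + t) 1 = heisRot 0 s 1 * heisRot 0 t 1 := fun s t =>
    HeisIsom.ext_coords (by simp [heisRot]) (by simp [heisRot])
      (by simp [heisRot]) (by simp [heisRot])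
  let f : Multiplicative ℝ →* HeisIsom :=
    MonoidHom.mk' (fun t => heisRot 0 t.toAdd 1) fun s t => hadd _ _
  have hf : Continuous fun t : ℝ => heisRot 0 t 1 := by
    refine HeisIsom.continuous_of_factors ?_ continuous_const continuous_const
    exact Heis.continuous_iff.2 ⟨continuous_const, continuous_id⟩
  let S : AddSubgroup ℝ := (Γ.comap f).toAddSubgroup'
  have hS : ∀ t, t ∈ S ↔ heisRot 0 t 1 ∈ Γ := fun t => Iff.rfl
  obtain ⟨V, hV, hV1⟩ : ∃ V : Set HeisIsom, IsOpen V ∧ V ∩ Γ = {1} := by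
    obtain ⟨V, hV, h⟩ := discreteTopology_subtype_iff'.1
      (inferInstance : DiscreteTopology (Γ : Set HeisIsom)) 1 Γ.one_mem
    exact ⟨V, hV, h⟩
  have h1 : (1 : HeisIsom) ∈ V := (hV1.symm.subset rfl).1
  have h0 : heisRot 0 0 1 = 1 := rfl
  obtain ⟨r, hr, hrV⟩ := Metric.isOpen_iff.1 (hV.preimage hf) 0 (by simpa [h0] using h1)
  obtain ⟨τ, hτ⟩ := AddSubgroup.cyclic_of_isolated_zero (H := S) hr (by
    rw [Set.disjoint_left]
    rintro t ht ⟨h2, h3⟩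
    have : heisRot 0 t 1 = 1 := hV1.subset ⟨hrV (by simpa [abs_of_pos h2] using h3), ht⟩
    have : t = 0 := congrArg (fun g : HeisIsom => g.left.t) this
    exact h2.ne' this)
  refine ⟨τ, fun t ht => ?_⟩
  have : t ∈ AddSubgroup.closure {τ} := hτ ▸ (hS t).2 ht
  obtain ⟨n, hn⟩ := AddSubgroup.mem_closure_singleton.1 this
  exact ⟨n, by simpa using hn.symm⟩

/-! ### Translations in a discrete group -/

theorem conjIf_mul_conj (ε : ℤˣ) (z w : ℂ) :
    (conjIf ε z * conj (conjIf ε w)).im = ((ε : ℤ) : ℝ) * (z * conj w).im := by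
  rcases Int.units_eq_one_or ε with rfl | rfl <;> simp
  ring

theorem norm_conjIf (ε : ℤˣ) (z : ℂ) : ‖conjIf ε z‖ = ‖z‖ := by
  rcases Int.units_eq_one_or ε with rfl | rfl <;> simp

theorem im_mul_conj_comm (z w : ℂ) : (z * conj w).im = -(w * conj z).im := by
  simp only [Complex.mul_im, Complex.conj_re, Complex.conj_im]
  ring

theorem im_circle_mul (u : Circle) (z w : ℂ) :
    ((u : ℂ) * z * conj ((u : ℂ) * w)).im = (z * conj w).im := by
  have hu : (u : ℂ) * conj (u : ℂ) = 1 := by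
    rw [Complex.mul_conj, Circle.normSq_coe, Complex.ofReal_one]
  congr 1
  rw [map_mul]
  linear_combination z * conj w * hu

/-- Conjugation by `g` acts on translations by the linear part of `g`, with a correction of the
central coordinate. -/
theorem exists_conj_translation {Γ : Subgroup HeisIsom} {g l : HeisIsom} (hg : g ∈ Γ) (hl : l ∈ Γ)
    (hl1 : l.right = 1) : ∃ m ∈ Γ, m.right = 1 ∧
      m.left.z = g.right.left * conjIf g.right.right l.left.z ∧
      m.left.t = ((g.right.right : ℤ) : ℝ) * l.left.t + 4 * (g.left.z * conj m.left.z).im := by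
  refine ⟨g * l * g⁻¹, Γ.mul_mem (Γ.mul_mem hg hl) (Γ.inv_mem hg), by simp [hl1], ?_⟩
  set m := g * l * g⁻¹ with hm
  have hm1 : m.right = 1 := by simp [hm, hl1]
  have h : m * g = g * l := by simp [hm]
  have hz : m.left.z = g.right.left * conjIf g.right.right l.left.z := by
    have := congrArg (fun x : HeisIsom => x.left.z) h
    simp only [HeisIsom.mul_z, hm1] at this
    simp only [SemidirectProduct.one_left, SemidirectProduct.one_right, conjIf_one,
      Circle.coe_one, one_mul] at this
    linear_combination this
  refine ⟨hz, ?_⟩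
  have := congrArg (fun x : HeisIsom => x.left.t) h
  simp only [HeisIsom.mul_t, hm1, ← hz] at this
  simp only [SemidirectProduct.one_left, SemidirectProduct.one_right, conjIf_one,
      Circle.coe_one, one_mul, Units.val_one, Int.cast_one] at this
  rw [im_mul_conj_comm m.left.z] at this
  linear_combination this

/-- A group of motions whose orbits are at bounded distance to every point of `ℂ` contains
translations in two independent directions. If all translations were parallel, the holonomy would
preserve their direction, and the orbits would lie on finitely many lines; if there were
none, the projection to the motions of `ℂ` would be virtually a commutative group
of rotations about one point. -/
theorem exists_independent_translations {Γ : Subgroup HeisIsom} {R : ℝ}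
    (hR : ∀ w : ℂ, ∃ γ ∈ Γ, ‖w - γ.left.z‖ ≤ R) :
    ∃ l ∈ Γ, ∃ m ∈ Γ, l.right = 1 ∧ m.right = 1 ∧ (l.left.z * conj m.left.z).im ≠ 0 := by
  by_contra! hcon
  by_cases hA : ∃ l ∈ Γ, l.right = 1 ∧ l.left.z ≠ 0
  · obtain ⟨l, hl, hl1, hv⟩ := hA
    set v := l.left.z with hvdef
    have hvv : ∀ m ∈ Γ, m.right = 1 → (m.left.z * conj v).im = 0 := fun m hm hm1 =>
      hcon m hm l hl hm1 hl1
    have hnv : (0 : ℝ) < ‖v‖ := norm_pos_iff.2 hv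
    -- the holonomy acts on the common direction by a sign
    have hsign : ∀ g ∈ Γ, ∃ δ : ℤˣ, (g.right.left : ℂ) * conjIf g.right.right v
        = ((δ : ℤ) : ℂ) * v := by
      intro g hg
      obtain ⟨m, hm, hm1, hmz, -⟩ := exists_conj_translation hg hl hl1
      have him := hvv m hm hm1
      rw [← hvdef] at hmz
      have hnorm : ‖m.left.z‖ = ‖v‖ := by
        rw [hmz, norm_mul, Circle.norm_coe, one_mul, norm_conjIf]
      obtain ⟨r, hr⟩ : ∃ r : ℝ, m.left.z = r * v := by
        refine ⟨(m.left.z * conj v).re / ‖v‖ ^ 2, ?_⟩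
        have h1 : m.left.z * conj v = ((m.left.z * conj v).re : ℂ) :=
          Complex.ext (by simp) (by simpa using him)
        have h2 : v * conj v = ((‖v‖ ^ 2 : ℝ) : ℂ) := by
          rw [Complex.mul_conj, Complex.normSq_eq_norm_sq]
        have h3 : ((‖v‖ ^ 2 : ℝ) : ℂ) ≠ 0 := by exact_mod_cast (pow_pos hnv 2).ne'
        rw [Complex.ofReal_div, ← h1, div_mul_eq_mul_div, eq_div_iff h3, ← h2]
        ring
      have hr1 : |r| = 1 := by
        rw [hr, norm_mul, Complex.norm_real, Real.norm_eq_abs] at hnorm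
        exact mul_right_cancel₀ hnv.ne' (by rw [hnorm, one_mul])
      rw [← hmz, hr]
      rcases eq_or_eq_neg_of_abs_eq hr1 with h | h
      · exact ⟨1, by simp [h]⟩
      · exact ⟨-1, by simp [h]⟩
    have hconst : ∀ ε δ : ℤˣ, ∃ c : ℝ, ∀ g ∈ Γ, g.right.right = ε →
        (g.right.left : ℂ) * conjIf ε v = ((δ : ℤ) : ℂ) * v → (g.left.z * conj v).im = c := by
      intro ε δ
      by_cases h : ∃ g ∈ Γ, g.right.right = ε ∧
          (g.right.left : ℂ) * conjIf ε v = ((δ : ℤ) : ℂ) * v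
      · obtain ⟨h, hh, hhε, hhu⟩ := h
        refine ⟨(h.left.z * conj v).im, fun g hg hgε hgu => ?_⟩
        have hright : g.right = h.right := by
          refine SemidirectProduct.ext (Circle.ext ?_) (hgε.trans hhε.symm)
          have : conjIf ε v ≠ 0 := by rw [← norm_pos_iff, norm_conjIf]; exact hnv
          exact mul_right_cancel₀ this (hgu.trans hhu.symm)
        have hk := hvv (g * h⁻¹) (Γ.mul_mem hg (Γ.inv_mem hh)) (by simp [hright])
        have hz : g.left.z = (g * h⁻¹).left.z + h.left.z := by
          conv_lhs => rw [← inv_mul_cancel_right g h]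
          rw [HeisIsom.mul_z]
          simp [hright]
        rw [hz, add_mul, Complex.add_im, hk, zero_add]
      · push Not at h
        exact ⟨0, fun g hg hgε hgu => absurd hgu (h g hg hgε)⟩
    choose c hc using hconst
    obtain ⟨B, hB⟩ : ∃ B, ∀ p : ℤˣ × ℤˣ, c p.1 p.2 ≤ B := by
      obtain ⟨B, hB⟩ := (Set.finite_range fun p : ℤˣ × ℤˣ => c p.1 p.2).bddAbove
      exact ⟨B, fun p => hB ⟨p, rfl⟩⟩
    obtain ⟨γ, hγ, hγR⟩ := hR (((B + R * ‖v‖ + 1) / ‖v‖ ^ 2 : ℝ) * (Complex.I * v))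
    obtain ⟨δ, hδ⟩ := hsign γ hγ
    have h1 := hc _ δ γ hγ rfl hδ
    have h2 := hB (γ.right.right, δ)
    set w : ℂ := ((B + R * ‖v‖ + 1) / ‖v‖ ^ 2 : ℝ) * (Complex.I * v)
    have h3 : (w * conj v).im = B + R * ‖v‖ + 1 := by
      have : w * conj v = ((B + R * ‖v‖ + 1 : ℝ) : ℂ) * Complex.I := by
        have h3 : ((‖v‖ : ℝ) : ℂ) ≠ 0 := by exact_mod_cast hnv.ne'
        have h4 : v * conj v = ((‖v‖ ^ 2 : ℝ) : ℂ) := by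
          rw [Complex.mul_conj, Complex.normSq_eq_norm_sq]
        simp only [w]
        push_cast at h4 ⊢
        rw [show ∀ a i : ℂ, a * (i * v) * conj v = a * i * (v * conj v) by intros; ring, h4]
        field_simp
      rw [this]
      simp
    have h4 : ((w - γ.left.z) * conj v).im ≤ R * ‖v‖ := by
      refine ((le_abs_self _).trans (Complex.abs_im_le_norm _)).trans ?_
      rw [norm_mul, Complex.norm_conj]
      gcongr
    rw [sub_mul, Complex.sub_im, h3] at h4
    linarith
  · push Not at hA
    obtain ⟨B, hB⟩ : ∃ B, ∀ g ∈ Γ, g.right.right = 1 → ‖g.left.z‖ ≤ B := by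
      by_cases hB : ∃ g ∈ Γ, g.right.right = 1 ∧ g.right.left ≠ 1
      · obtain ⟨g, hg, hgε, hgu⟩ := hB
        have hgu' : (1 : ℂ) - g.right.left ≠ 0 := by
          rw [sub_ne_zero]
          exact fun h => hgu (Circle.ext h.symm)
        refine ⟨‖g.left.z / (1 - g.right.left)‖ * 2, fun h hh hhε => ?_⟩
        have hcomm : h.left.z * (1 - g.right.left) = g.left.z * (1 - h.right.left) := by
          have h1 : (g * h * (h * g)⁻¹).right = 1 := by
            have : (g * h).right = (h * g).right :=
              SemidirectProduct.ext (by
                simp only [HeisIsom.mul_u, hgε, hhε]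
                simp [mul_comm]) (by
                simp only [HeisIsom.mul_ε, hgε, hhε])
            rw [SemidirectProduct.mul_right, SemidirectProduct.inv_right, this, mul_inv_cancel]
          have h2 := hA _ (Γ.mul_mem (Γ.mul_mem hg hh) (Γ.inv_mem (Γ.mul_mem hh hg))) h1
          have h3 : (g * h).left.z = (h * g).left.z := by
            conv_lhs => rw [← inv_mul_cancel_right (g * h) (h * g)]
            rw [HeisIsom.mul_z, h1, h2]
            simp
          simp only [HeisIsom.mul_z, hgε, hhε, conjIf_one] at h3
          linear_combination -h3
        have : h.left.z = g.left.z / (1 - g.right.left) * (1 - h.right.left) := by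
          rw [div_mul_eq_mul_div, eq_div_iff hgu', hcomm]
        rw [this, norm_mul]
        gcongr
        refine (norm_sub_le _ _).trans ?_
        rw [Circle.norm_coe, norm_one]
        norm_num
      · push Not at hB
        refine ⟨0, fun g hg hgε => ?_⟩
        rw [hA g hg (SemidirectProduct.ext (hB g hg hgε) hgε), norm_zero]
    obtain ⟨C, hC⟩ : ∃ C, ∀ g ∈ Γ, g.right.right = -1 → ‖g.left.z‖ ≤ C := by
      by_cases h : ∃ h ∈ Γ, h.right.right = -1
      · obtain ⟨h, hh, hhε⟩ := h
        refine ⟨B + ‖h.left.z‖, fun g hg hgε => ?_⟩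
        have h1 : (g * h⁻¹).right.right = 1 := by
          rw [HeisIsom.mul_ε, HeisIsom.inv_ε, hgε, hhε]
          simp
        have h2 := hB _ (Γ.mul_mem hg (Γ.inv_mem hh)) h1
        conv_lhs => rw [← inv_mul_cancel_right g h]
        rw [HeisIsom.mul_z]
        refine (norm_add_le _ _).trans (add_le_add h2 ?_)
        rw [norm_mul, Circle.norm_coe, one_mul, norm_conjIf]
      · push Not at h
        exact ⟨0, fun g hg hgε => absurd hgε (h g hg)⟩
    obtain ⟨γ, hγ, hγR⟩ := hR ((|B| + |C| + |R| + 1 : ℝ) : ℂ)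
    have h1 : ‖γ.left.z‖ ≤ |B| + |C| := by
      rcases Int.units_eq_one_or γ.right.right with h | h
      · exact (hB γ hγ h).trans ((le_abs_self B).trans (by linarith [abs_nonneg C]))
      · exact (hC γ hγ h).trans ((le_abs_self C).trans (by linarith [abs_nonneg B]))
    have h2 := norm_sub_norm_le ((|B| + |C| + |R| + 1 : ℝ) : ℂ) γ.left.z
    rw [Complex.norm_real, Real.norm_eq_abs] at h2
    have h3 := le_abs_self (|B| + |C| + |R| + 1)
    have h4 := le_abs_self R
    linarith

theorem heisRot_mem_of_right_eq_one {Γ : Subgroup HeisIsom} {l : HeisIsom} (hl : l ∈ Γ)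
    (hl1 : l.right = 1) : heisRot l.left.z l.left.t 1 ∈ Γ := by
  have : heisRot l.left.z l.left.t 1 = l := SemidirectProduct.ext rfl hl1.symm
  rwa [this]

/-- The commutator of two translations is central. -/
theorem commutator_mem {Γ : Subgroup HeisIsom} {l m : HeisIsom} (hl : l ∈ Γ) (hm : m ∈ Γ)
    (hl1 : l.right = 1) (hm1 : m.right = 1) :
    heisRot 0 (4 * (l.left.z * conj m.left.z).im) 1 ∈ Γ := by
  obtain ⟨n, hn, hn1, hnz, hnt⟩ := exists_conj_translation hl hm hm1
  rw [hl1] at hnz hnt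
  simp only [SemidirectProduct.one_left, SemidirectProduct.one_right, conjIf_one,
      Circle.coe_one, one_mul, Units.val_one, Int.cast_one] at hnz hnt
  have h := Γ.mul_mem hn (Γ.inv_mem hm)
  have : n * m⁻¹ = heisRot 0 (4 * (l.left.z * conj m.left.z).im) 1 := by
    rw [mul_inv_eq_iff_eq_mul]
    refine SemidirectProduct.ext (Heis.ext ?_ ?_) ?_
    · rw [HeisIsom.mul_z]; simp [heisRot, hnz]
    · rw [HeisIsom.mul_t, hnt, hnz]
      simp [heisRot]
      ring
    · rw [hn1, SemidirectProduct.mul_right, hm1, mul_one]; rfl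
  rwa [this] at h

/-- The group of translation vectors of a group of motions. -/
noncomputable def translationLattice (Γ : Subgroup HeisIsom) : Submodule ℤ ℂ :=
  AddSubgroup.toIntSubmodule
    { carrier := {z | ∃ l ∈ Γ, l.right = 1 ∧ l.left.z = z}
      zero_mem' := ⟨1, Γ.one_mem, rfl, rfl⟩
      add_mem' := by
        rintro _ _ ⟨l, hl, hl1, rfl⟩ ⟨m, hm, hm1, rfl⟩
        refine ⟨l * m, Γ.mul_mem hl hm, by simp [hl1, hm1], ?_⟩
        rw [HeisIsom.mul_z]
        simp [hl1]
      neg_mem' := by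
        rintro _ ⟨l, hl, hl1, rfl⟩
        refine ⟨l⁻¹, Γ.inv_mem hl, by simp [hl1], ?_⟩
        have : (l * l⁻¹).left.z = 0 := by rw [mul_inv_cancel]; rfl
        rw [HeisIsom.mul_z] at this
        simp only [hl1, SemidirectProduct.one_left, SemidirectProduct.one_right, conjIf_one,
          Circle.coe_one, one_mul] at this
        linear_combination this }

theorem mem_translationLattice {Γ : Subgroup HeisIsom} {z : ℂ} :
    z ∈ translationLattice Γ ↔ ∃ l ∈ Γ, l.right = 1 ∧ l.left.z = z := Iff.rfl

theorem mul_mem_translationLattice {Γ : Subgroup HeisIsom} {g : HeisIsom} (hg : g ∈ Γ) {z : ℂ}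
    (hz : z ∈ translationLattice Γ) :
    (g.right.left : ℂ) * conjIf g.right.right z ∈ translationLattice Γ := by
  obtain ⟨l, hl, hl1, rfl⟩ := hz
  obtain ⟨m, hm, hm1, hmz, -⟩ := exists_conj_translation hg hl hl1
  exact ⟨m, hm, hm1, hmz⟩

/-- A group of motions whose central translations are integral multiples of `τ`, and which contains
independent translations. -/
structure IsNilLattice (Γ : Subgroup HeisIsom) (τ : ℝ) : Prop where
  center : ∀ t : ℝ, heisRot 0 t 1 ∈ Γ → ∃ n : ℤ, t = n * τ
  independent : ∃ z ∈ translationLattice Γ, ∃ w ∈ translationLattice Γ, (z * conj w).im ≠ 0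

namespace IsNilLattice

variable {Γ : Subgroup HeisIsom} {τ : ℝ}

/-- The commutator of two translations is central, so the area they span is quantized. -/
theorem area (hΓ : IsNilLattice Γ τ) {z w : ℂ} (hz : z ∈ translationLattice Γ)
    (hw : w ∈ translationLattice Γ) : ∃ n : ℤ, 4 * (z * conj w).im = n * τ := by
  obtain ⟨l, hl, hl1, rfl⟩ := hz
  obtain ⟨m, hm, hm1, rfl⟩ := hw
  exact hΓ.center _ (commutator_mem hl hm hl1 hm1)

/-- The areas spanned with two fixed translations embed the translation vectors in `(ℤ τ)²`. -/
theorem fg (hΓ : IsNilLattice Γ τ) : (translationLattice Γ).FG := by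
  obtain ⟨e, he, f, hf, hef⟩ := hΓ.independent
  let a (v : ℂ) : ℂ →ₗ[ℤ] ℝ := AddMonoidHom.toIntLinearMap
    (AddMonoidHom.mk' (fun z => 4 * (z * conj v).im) fun z w => by
      rw [add_mul, Complex.add_im, mul_add])
  let φ : ℂ →ₗ[ℤ] ℝ × ℝ := (a e).prod (a f)
  have hφ : Function.Injective φ := by
    rw [← LinearMap.ker_eq_bot, LinearMap.ker_eq_bot']
    intro z hz
    have h1 : 4 * (z * conj e).im = 0 := congrArg Prod.fst hz
    have h2 : 4 * (z * conj f).im = 0 := congrArg Prod.snd hz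
    simp only [Complex.mul_im, Complex.conj_re, Complex.conj_im] at h1 h2 hef
    refine Complex.ext (mul_right_cancel₀ hef ?_) (mul_right_cancel₀ hef ?_)
    · simp only [Complex.zero_re]
      linear_combination (e.re / 4) * h2 - (f.re / 4) * h1
    · simp only [Complex.zero_im]
      linear_combination (e.im / 4) * h2 - (f.im / 4) * h1
  refine Submodule.fg_of_fg_map_injective φ hφ ?_
  have hle : (translationLattice Γ).map φ ≤ Submodule.span ℤ {((τ, 0) : ℝ × ℝ), (0, τ)} := by
    rintro _ ⟨z, hz, rfl⟩
    obtain ⟨m, hm⟩ := hΓ.area hz he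
    obtain ⟨n, hn⟩ := hΓ.area hz hf
    refine Submodule.mem_span_pair.2 ⟨m, n, ?_⟩
    refine Prod.ext ?_ ?_
    · change (m : ℤ) • τ + n • (0 : ℝ) = 4 * (z * conj e).im
      rw [hm]
      simp
    · change (m : ℤ) • (0 : ℝ) + n • τ = 4 * (z * conj f).im
      rw [hn]
      simp
  have : IsNoetherian ℤ (Submodule.span ℤ {((τ, 0) : ℝ × ℝ), (0, τ)}) :=
    isNoetherian_span_of_finite ℤ (by simp)
  exact (Submodule.fg_top _).1 ((isNoetherian_of_le hle).noetherian ⊤)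

theorem exists_ne_zero (hΓ : IsNilLattice Γ τ) : ∃ e ∈ translationLattice Γ, e ≠ 0 := by
  obtain ⟨e, he, f, hf, hef⟩ := hΓ.independent
  refine ⟨e, he, ?_⟩
  rintro rfl
  simp at hef

/-- A rotation of the holonomy preserves the finitely generated group of translation vectors. -/
theorem isIntegral (hΓ : IsNilLattice Γ τ) {g : HeisIsom} (hg : g ∈ Γ)
    (hgε : g.right.right = 1) : IsIntegral ℤ (g.right.left : ℂ) := by
  obtain ⟨e, he, he0⟩ := hΓ.exists_ne_zero
  refine isIntegral_of_smul_mem_submodule (M := ℂ) (N := translationLattice Γ) ?_ hΓ.fg _ ?_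
  · intro h
    rw [h] at he
    exact he0 (by simpa using he)
  · intro z hz
    have := mul_mem_translationLattice hg hz
    rwa [hgε, conjIf_one] at this

/-- The crystallographic restriction: a rotation of the holonomy has integral trace. -/
theorem exists_trace (hΓ : IsNilLattice Γ τ) {g : HeisIsom} (hg : g ∈ Γ)
    (hgε : g.right.right = 1) :
    ∃ j : ℤ, (g.right.left : ℂ) + conj (g.right.left : ℂ) = j ∧ -2 ≤ j ∧ j ≤ 2 := by
  set u := g.right.left with hu
  have hnorm := Circle.norm_coe u
  suffices ∃ j : ℤ, (u : ℂ) + conj (u : ℂ) = j by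
    obtain ⟨j, hj⟩ := this
    have h1 : 2 * (u : ℂ).re = j := by
      have := congrArg Complex.re hj
      simp only [Complex.add_re, Complex.conj_re, Complex.intCast_re] at this
      linarith
    have h2 := Complex.abs_re_le_norm (u : ℂ)
    rw [hnorm, abs_le] at h2
    refine ⟨j, hj, ?_, ?_⟩
    · have : (-2 : ℝ) ≤ j := by linarith
      exact_mod_cast this
    · have : (j : ℝ) ≤ 2 := by linarith
      exact_mod_cast this
  have hint : IsIntegral ℤ ((u : ℂ) + conj (u : ℂ)) := by
    refine (hΓ.isIntegral hg hgε).add ?_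
    have h1 := hΓ.isIntegral (Γ.inv_mem hg) ((HeisIsom.inv_ε g).trans hgε)
    rw [HeisIsom.inv_u, hgε, Units.val_one, zpow_one, Circle.coe_inv_eq_conj] at h1
    exact h1
  suffices ∃ q : ℚ, (u : ℂ) + conj (u : ℂ) = q by
    obtain ⟨q, hq⟩ := this
    rw [hq] at hint
    have h2 : IsIntegral ℤ q :=
      (isIntegral_algebraMap_iff (algebraMap ℚ ℂ).injective).1 (by simpa using hint)
    obtain ⟨j, hj⟩ := IsIntegrallyClosed.isIntegral_iff.1 h2
    refine ⟨j, ?_⟩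
    rw [hq, ← hj]
    simp
  obtain ⟨e, he, he0⟩ := hΓ.exists_ne_zero
  have hue := mul_mem_translationLattice hg he
  have huue := mul_mem_translationLattice hg hue
  simp only [hgε, conjIf_one, ← hu] at hue huue
  obtain ⟨m, hm⟩ := hΓ.area hue he
  obtain ⟨n, hn⟩ := hΓ.area huue he
  have hE : e * conj e = ((Complex.normSq e : ℝ) : ℂ) := Complex.mul_conj e
  have hE0 : Complex.normSq e ≠ 0 := by simpa using he0
  rw [mul_assoc, hE, Complex.im_mul_ofReal] at hm
  rw [mul_assoc, mul_assoc, hE, ← mul_assoc, Complex.im_mul_ofReal, Complex.mul_im] at hn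
  by_cases him : (u : ℂ).im = 0
  · have hre : |(u : ℂ).re| = 1 := by
      rw [← hnorm, ← Complex.re_add_im (u : ℂ), him]
      simp [Complex.norm_real]
    rcases eq_or_eq_neg_of_abs_eq hre with h | h
    · exact ⟨2, Complex.ext (by simp [h]; norm_num) (by simp)⟩
    · exact ⟨-2, Complex.ext (by simp [h]; norm_num) (by simp)⟩
  · have hmτ : (m : ℝ) * τ ≠ 0 := by
      rw [← hm]
      positivity
    have hm0 : (m : ℝ) ≠ 0 := left_ne_zero_of_mul hmτ
    refine ⟨n / m, ?_⟩
    have h1 : 2 * (u : ℂ).re = n / m := by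
      rw [eq_div_iff hm0]
      refine mul_right_cancel₀ (right_ne_zero_of_mul hmτ) ?_
      linear_combination -2 * (u : ℂ).re * hm + hn
    refine Complex.ext ?_ (by simp)
    rw [show ((n / m : ℚ) : ℂ) = ((n / m : ℝ) : ℂ) by push_cast; rfl, Complex.ofReal_re, ← h1]
    simp
    ring

end IsNilLattice

/-! ### Changes of coordinates -/

/-- A real linear change of coordinates `A` of `ℂ`, with determinant `d ≠ 0`, which carries the
linear parts of the elements of `Γ` to isometries. Then `(z, t) ↦ (A z, d t)` induces an embedding
of `Γ` in `𝔑₃ ⋊ ⟨U(1), ι⟩`. -/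
structure IsLinearChange (Γ : Subgroup HeisIsom) (A : ℂ →+ ℂ) (d : ℝ) : Prop where
  ne_zero : d ≠ 0
  area : ∀ z w, (A z * conj (A w)).im = d * (z * conj w).im
  compat : ∀ g ∈ Γ, ∃ v : Circle, ∀ z,
    A (g.right.left * conjIf g.right.right z) = v * conjIf g.right.right (A z)

namespace IsLinearChange

variable {Γ : Subgroup HeisIsom} {A : ℂ →+ ℂ} {d : ℝ}

theorem injective (h : IsLinearChange Γ A d) : Function.Injective A := by
  refine (injective_iff_map_eq_zero A).2 fun z hz => ?_
  have h1 := h.area z 1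
  have h2 := h.area z Complex.I
  rw [hz] at h1 h2
  simp only [zero_mul, Complex.zero_im, zero_eq_mul, h.ne_zero, false_or] at h1 h2
  refine Complex.ext ?_ ?_
  · simpa using h2
  · simpa using h1

theorem exists_hom (h : IsLinearChange Γ A d) : ∃ f : Γ →* HeisIsom, Function.Injective f ∧
    ∀ g : Γ, (f g).left.z = A (g : HeisIsom).left.z ∧ (f g).left.t = d * (g : HeisIsom).left.t ∧
      (f g).right.right = (g : HeisIsom).right.right ∧
      (∀ z, A ((g : HeisIsom).right.left * conjIf (g : HeisIsom).right.right z) =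
        (f g).right.left * conjIf (g : HeisIsom).right.right (A z)) ∧
      ((f g).right = 1 ↔ (g : HeisIsom).right = 1) := by
  have hcompat := fun g : Γ => h.compat g g.2
  choose v hv using hcompat
  have hA1 : A 1 ≠ 0 := fun h0 => one_ne_zero (h.injective (h0.trans (map_zero A).symm))
  have hcj : ∀ (ε : ℤˣ) {z : ℂ}, z ≠ 0 → conjIf ε z ≠ 0 := fun ε z hz => by
    rw [← norm_pos_iff, norm_conjIf]
    exact norm_pos_iff.2 hz
  have hcomp : ∀ (u w : Circle) (ε δ : ℤˣ) (z : ℂ),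
      (u : ℂ) * conjIf ε (w * conjIf δ z) = (u * w ^ (ε : ℤ) : Circle) * conjIf (ε * δ) z :=
    fun u w ε δ z => congrArg Heis.z (heisMap_comp u w ε δ ⟨z, 0⟩)
  have hmulv : ∀ g k : Γ, v (g * k) = v g * v k ^ ((g : HeisIsom).right.right : ℤ) := by
    intro g k
    refine Circle.ext (mul_right_cancel₀
      (hcj ((g : HeisIsom).right.right * (k : HeisIsom).right.right) hA1) ?_)
    have h1 := hv (g * k) 1
    rw [Subgroup.coe_mul, HeisIsom.mul_ε, HeisIsom.mul_u, ← hcomp, hv g, hv k, hcomp] at h1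
    exact h1.symm
  let F : Γ → HeisIsom := fun g =>
    ⟨⟨A (g : HeisIsom).left.z, d * (g : HeisIsom).left.t⟩, ⟨v g, (g : HeisIsom).right.right⟩⟩
  let f : Γ →* HeisIsom := MonoidHom.mk' F fun g k => by
    refine HeisIsom.ext_coords ?_ ?_ ?_ ?_
    · rw [HeisIsom.mul_z]
      change A ((g * k : HeisIsom).left.z) = A _ + v g * conjIf _ (A _)
      rw [HeisIsom.mul_z, map_add, hv]
    · rw [HeisIsom.mul_t]
      change d * ((g * k : HeisIsom).left.t) = d * _ + _ * (d * _) +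
        2 * (A _ * conj (v g * conjIf _ (A _))).im
      rw [HeisIsom.mul_t, ← hv, h.area]
      ring
    · rw [HeisIsom.mul_u]
      exact congrArg _ (hmulv g k)
    · rfl
  have hright : ∀ g : Γ, (f g).right = 1 ↔ (g : HeisIsom).right = 1 := by
    intro g
    have hε : (f g).right.right = (g : HeisIsom).right.right := rfl
    have hvg := hv g
    refine ⟨fun hg => ?_, fun hg => ?_⟩
    · have h1 : (g : HeisIsom).right.right = 1 := hε.symm.trans (congrArg (·.right) hg)
      have h2 : v g = 1 := congrArg (·.left) hg
      refine SemidirectProduct.ext (Circle.ext ?_) h1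
      have h3 := hvg 1
      rw [h1, h2, conjIf_one, conjIf_one, Circle.coe_one, one_mul, mul_one] at h3
      exact h.injective h3
    · have h1 : (g : HeisIsom).right.right = 1 := congrArg (·.right) hg
      have h2 : (g : HeisIsom).right.left = 1 := congrArg (·.left) hg
      refine SemidirectProduct.ext (Circle.ext ?_) h1
      have h3 := hvg 1
      rw [h1, h2, conjIf_one, conjIf_one, Circle.coe_one, one_mul] at h3
      exact mul_right_cancel₀ hA1 ((h3.symm).trans (one_mul _).symm)
  refine ⟨f, (injective_iff_map_eq_one f).2 fun g hg => Subtype.ext ?_, fun g =>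
    ⟨rfl, rfl, rfl, hv g, hright g⟩⟩
  have h1 : A (g : HeisIsom).left.z = A 0 :=
    (congrArg (fun x : HeisIsom => x.left.z) hg).trans (map_zero A).symm
  have h2 : d * (g : HeisIsom).left.t = 0 := congrArg (fun x : HeisIsom => x.left.t) hg
  have h3 := (hright g).1 (by rw [hg]; rfl)
  refine SemidirectProduct.ext (Heis.ext (h.injective h1) ?_) h3
  exact (mul_eq_zero.1 h2).resolve_left h.ne_zero

end IsLinearChange

/-- A homothety of `ℂ` is a linear change of coordinates for every group. -/
theorem isLinearChange_mul (Γ : Subgroup HeisIsom) {e : ℂ} (he : e ≠ 0) :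
    IsLinearChange Γ (AddMonoidHom.mulLeft e) (Complex.normSq e) where
  ne_zero := by simpa using he
  area z w := by
    have : e * z * conj (e * w) = (Complex.normSq e : ℂ) * (z * conj w) := by
      rw [← Complex.mul_conj, map_mul]
      ring
    rw [AddMonoidHom.coe_mulLeft, this, Complex.im_ofReal_mul]
  compat g _ := by
    rcases Int.units_eq_one_or g.right.right with h | h
    · refine ⟨g.right.left, fun z => ?_⟩
      simp only [h, conjIf_one, AddMonoidHom.coe_mulLeft]
      ring
    · have hce : conj e ≠ 0 := by simpa using he
      obtain ⟨q, hq⟩ : ∃ q : Circle, (q : ℂ) = e / conj e := by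
        refine ⟨⟨e / conj e, mem_sphere_zero_iff_norm.2 ?_⟩, rfl⟩
        rw [norm_div, Complex.norm_conj, div_self (norm_ne_zero_iff.2 he)]
      refine ⟨g.right.left * q, fun z => ?_⟩
      simp only [h, conjIf_neg_one, AddMonoidHom.coe_mulLeft, Circle.coe_mul, map_mul, hq]
      field_simp

/-- The coordinates with respect to the basis `e`, `f` of `ℂ`, as a complex number. -/
noncomputable def basisCoord (e f : ℂ) : ℂ →+ ℂ :=
  AddMonoidHom.mk' (fun z => ((-(z * conj f).im / (f * conj e).im : ℝ) : ℂ) +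
    (((z * conj e).im / (f * conj e).im : ℝ) : ℂ) * Complex.I) fun z w => by
      simp only [add_mul, Complex.add_im]
      push_cast
      ring

theorem basisCoord_apply (e f z : ℂ) : basisCoord e f z =
    ((-(z * conj f).im / (f * conj e).im : ℝ) : ℂ) +
    (((z * conj e).im / (f * conj e).im : ℝ) : ℂ) * Complex.I := rfl

theorem basisCoord_left {e f : ℂ} (h : (f * conj e).im ≠ 0) : basisCoord e f e = 1 := by
  rw [basisCoord_apply, im_mul_conj_comm e f, neg_neg, div_self h]
  simp [Complex.mul_conj]

theorem basisCoord_right {e f : ℂ} (h : (f * conj e).im ≠ 0) : basisCoord e f f = Complex.I := by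
  rw [basisCoord_apply, div_self h]
  simp [Complex.mul_conj]

theorem basisCoord_area {e f : ℂ} (h : (f * conj e).im ≠ 0) (z w : ℂ) :
    (basisCoord e f z * conj (basisCoord e f w)).im = ((f * conj e).im)⁻¹ * (z * conj w).im := by
  have key : (z * conj f).im * (w * conj e).im - (z * conj e).im * (w * conj f).im =
      (f * conj e).im * (z * conj w).im := by
    simp only [Complex.mul_im, Complex.conj_re, Complex.conj_im]
    ring
  have h1 : (basisCoord e f z * conj (basisCoord e f w)).im =
      ((z * conj f).im * (w * conj e).im - (z * conj e).im * (w * conj f).im) /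
        (f * conj e).im ^ 2 := by
    rw [basisCoord_apply, basisCoord_apply]
    generalize (f * conj e).im = D at h
    generalize (z * conj f).im = a, (w * conj e).im = b, (z * conj e).im = c,
      (w * conj f).im = m
    simp
    ring
  rw [h1, key]
  field_simp

/-- An area-reversing map that fixes `e` and negates `f` is complex conjugation in the
coordinates with respect to `e`, `f`. -/
theorem basisCoord_reflection {e f : ℂ} {u : Circle} (he : (u : ℂ) * conj e = e)
    (hf : (u : ℂ) * conj f = -f) (z : ℂ) :
    basisCoord e f (u * conj z) = conj (basisCoord e f z) := by
  have h : ∀ z w : ℂ, ((u : ℂ) * conj z * conj ((u : ℂ) * conj w)).im = -(z * conj w).im := by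
    intro z w
    rw [im_circle_mul, ← map_mul, Complex.conj_im]
  have h1 := h z e
  have h2 := h z f
  rw [he] at h1
  rw [hf, map_neg, mul_neg, Complex.neg_im] at h2
  rw [basisCoord_apply, basisCoord_apply, h1, neg_injective h2]
  simp
  ring

/-- A group of motions that embeds in `⟨𝔑₃(𝒪) ⋊ U(1; 𝒪), ι⟩`, where `𝒪` is the ring of Gaussian
or of Eisenstein integers. -/
def EmbedsInIntegral (Γ : Subgroup HeisIsom) : Prop :=
  ∃ k : IntermediateField ℚ ℂ, (k = gaussField ∨ k = eisensteinField) ∧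
    ∃ φ : Γ →* heisIntegralIota (integersIn k), Function.Injective φ

theorem EmbedsInIntegral.of_range {Γ : Subgroup HeisIsom} {f : Γ →* HeisIsom}
    (hf : Function.Injective f) (h : EmbedsInIntegral f.range) : EmbedsInIntegral Γ := by
  obtain ⟨k, hk, φ, hφ⟩ := h
  exact ⟨k, hk, φ.comp f.rangeRestrict, hφ.comp (MonoidHom.rangeRestrict_injective_iff.2 hf)⟩

/-- A lattice that contains `1` and `ω` as translation vectors and whose
reflections, if any, include one in the real axis. -/
structure IsNormalized (Γ : Subgroup HeisIsom) (τ : ℝ) (ω : ℂ) : Prop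
    extends IsNilLattice Γ τ where
  one_mem : 1 ∈ translationLattice Γ
  omega_mem : ω ∈ translationLattice Γ
  reflection : (∀ g ∈ Γ, g.right.right = 1) ∨
    ∃ g ∈ Γ, g.right.right = -1 ∧ g.right.left = 1

theorem IsLinearChange.exists_isNormalized {Γ : Subgroup HeisIsom} {τ d : ℝ} {A : ℂ →+ ℂ}
    (h : IsLinearChange Γ A d) (hΓ : IsNilLattice Γ τ) {ω e f : ℂ}
    (he : e ∈ translationLattice Γ) (hf : f ∈ translationLattice Γ) (hAe : A e = 1) (hAf : A f = ω)
    (hrefl : (∀ g ∈ Γ, g.right.right = 1) ∨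
      ∃ g ∈ Γ, g.right.right = -1 ∧ ∀ z, A (g.right.left * conj z) = conj (A z)) :
    ∃ φ : Γ →* HeisIsom, Function.Injective φ ∧ IsNormalized φ.range (d * τ) ω := by
  obtain ⟨φ, hφ, hφc⟩ := h.exists_hom
  have hmem : ∀ z ∈ translationLattice Γ, A z ∈ translationLattice φ.range := by
    rintro _ ⟨l, hl, hl1, rfl⟩
    exact ⟨φ ⟨l, hl⟩, ⟨_, rfl⟩, (hφc ⟨l, hl⟩).2.2.2.2.2 hl1, (hφc ⟨l, hl⟩).1⟩
  refine ⟨φ, hφ, ⟨⟨?_, ?_⟩, hAe ▸ hmem e he, hAf ▸ hmem f hf, ?_⟩⟩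
  · rintro t ⟨g, hg⟩
    obtain ⟨hz, ht, -, -, hr⟩ := hφc g
    rw [hg] at hz ht hr
    have hg1 := hr.1 rfl
    have hz0 : (g : HeisIsom).left.z = 0 := h.injective (hz.symm.trans (map_zero A).symm)
    have hmem := heisRot_mem_of_right_eq_one g.2 hg1
    rw [hz0] at hmem
    obtain ⟨n, hn⟩ := hΓ.center _ hmem
    refine ⟨n, ht.trans ?_⟩
    rw [hn]
    ring
  · obtain ⟨z, hz, w, hw, hzw⟩ := hΓ.independent
    refine ⟨_, hmem z hz, _, hmem w hw, ?_⟩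
    rw [h.area]
    exact mul_ne_zero h.ne_zero hzw
  · rcases hrefl with hall | ⟨g, hg, hgε, hgA⟩
    · left
      rintro _ ⟨g, rfl⟩
      exact (hφc g).2.2.1.trans (hall g g.2)
    · right
      obtain ⟨-, -, hε, hA, -⟩ := hφc ⟨g, hg⟩
      refine ⟨φ ⟨g, hg⟩, ⟨_, rfl⟩, hε.trans hgε, Circle.ext ?_⟩
      have h1 := hA e
      simp only [hgε, conjIf_neg_one] at h1
      rw [hgA, hAe, map_one, mul_one] at h1
      rw [← h1, Circle.coe_one]

theorem circle_eq_one_or_neg_one {u : Circle} (h : (u : ℂ).im = 0) : (u : ℂ) = 1 ∨ (u : ℂ) = -1 := by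
  have hre : |(u : ℂ).re| = 1 := by
    rw [← Circle.norm_coe u, ← Complex.re_add_im (u : ℂ), h]
    simp [Complex.norm_real]
  rcases eq_or_eq_neg_of_abs_eq hre with h1 | h1
  · exact Or.inl (Complex.ext (by simp [h1]) (by simp [h]))
  · exact Or.inr (Complex.ext (by simp [h1]) (by simp [h]))

theorem circle_quadratic {u : Circle} {j : ℤ} (hj : (u : ℂ) + conj (u : ℂ) = j) :
    (u : ℂ) ^ 2 = j * u - 1 := by
  have hu : (u : ℂ) * conj (u : ℂ) = 1 := by
    rw [Complex.mul_conj, Circle.normSq_coe, Complex.ofReal_one]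
  linear_combination (u : ℂ) * hj - hu

theorem zeta3_sq : zeta3 ^ 2 = -1 * zeta3 - 1 := by
  have h3 : ((Real.sqrt 3 : ℝ) : ℂ) ^ 2 = 3 := by
    rw [← Complex.ofReal_pow, Real.sq_sqrt (by norm_num)]
    norm_num
  rw [zeta3]
  push_cast
  linear_combination (1 / 4 : ℂ) * ((Real.sqrt 3 : ℝ) : ℂ) ^ 2 * Complex.I_sq - (1 / 4) * h3

/-- Every lattice can be normalized, with `ω = ζ₃` if the holonomy has a rotation of
order 3 or 6 and `ω = i` otherwise. -/
theorem IsNilLattice.exists_isNormalized {Γ : Subgroup HeisIsom} {τ : ℝ} (hΓ : IsNilLattice Γ τ) :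
    ∃ ω : ℂ, (ω = Complex.I ∨ ω = zeta3) ∧ ∃ (φ : Γ →* HeisIsom) (τ' : ℝ),
      Function.Injective φ ∧ IsNormalized φ.range τ' ω := by
  -- a vector on the axis of a given reflection, and one perpendicular to it
  have haxis : ∀ g ∈ Γ, g.right.right = -1 → ∀ δ : ℤˣ, ∃ e ∈ translationLattice Γ, e ≠ 0 ∧
      (g.right.left : ℂ) * conj e = ((δ : ℤ) : ℂ) * e := by
    intro g hg hgε δ
    have hu : (g.right.left : ℂ) * conj (g.right.left : ℂ) = 1 := by
      rw [Complex.mul_conj, Circle.normSq_coe, Complex.ofReal_one]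
    have hδ : ((δ : ℤ) : ℂ) * (δ : ℤ) = 1 := by
      rcases Int.units_eq_one_or δ with rfl | rfl <;> simp
    have hmem : ∀ z ∈ translationLattice Γ,
        z + ((δ : ℤ) : ℂ) * (g.right.left * conj z) ∈ translationLattice Γ := by
      intro z hz
      have := mul_mem_translationLattice hg hz
      rw [hgε, conjIf_neg_one] at this
      refine add_mem hz ?_
      simpa using Submodule.smul_mem _ (δ : ℤ) this
    have hfix : ∀ z : ℂ, (g.right.left : ℂ) * conj (z + ((δ : ℤ) : ℂ) * (g.right.left * conj z)) =
        ((δ : ℤ) : ℂ) * (z + ((δ : ℤ) : ℂ) * (g.right.left * conj z)) := by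
      intro z
      simp only [map_add, map_mul, Complex.conj_conj, map_intCast]
      linear_combination ((δ : ℤ) : ℂ) * z * hu - (g.right.left : ℂ) * conj z * hδ
    obtain ⟨z, hz, w, hw, hzw⟩ := hΓ.independent
    by_contra! hcon
    have hz0 : z + ((δ : ℤ) : ℂ) * (g.right.left * conj z) = 0 := by
      by_contra h
      exact hcon _ (hmem z hz) h (hfix z)
    have hw0 : w + ((δ : ℤ) : ℂ) * (g.right.left * conj w) = 0 := by
      by_contra h
      exact hcon _ (hmem w hw) h (hfix w)
    refine hzw ?_
    -- both vectors lie on the line where the reflection acts by `-δ`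
    have h1 : z * conj w = conj (z * conj w) := by
      rw [map_mul, Complex.conj_conj]
      linear_combination conj w * hz0 - conj z * hw0
    have h2 := congrArg Complex.im h1
    rw [Complex.conj_im] at h2
    linarith
  by_cases hrot : ∃ g ∈ Γ, g.right.right = 1 ∧ (g.right.left : ℂ).im ≠ 0
  · obtain ⟨g, hg, hgε, hgu⟩ := hrot
    obtain ⟨e, he, he0, heA⟩ : ∃ e ∈ translationLattice Γ, e ≠ 0 ∧
        ((∀ g ∈ Γ, g.right.right = 1) ∨ ∃ g ∈ Γ, g.right.right = -1 ∧
          ∀ z, e⁻¹ * (g.right.left * conj z) = conj (e⁻¹ * z)) := by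
      by_cases hr : ∃ g ∈ Γ, g.right.right = -1
      · obtain ⟨r, hr, hrε⟩ := hr
        obtain ⟨e, he, he0, hre⟩ := haxis r hr hrε 1
        refine ⟨e, he, he0, Or.inr ⟨r, hr, hrε, fun z => ?_⟩⟩
        have hce : conj e ≠ 0 := by simpa using he0
        rw [map_mul, map_inv₀, eq_inv_mul_iff_mul_eq₀ hce, ← mul_assoc]
        rw [mul_comm (conj e), mul_assoc, inv_mul_eq_iff_eq_mul₀ he0]
        simp only [Units.val_one, Int.cast_one, one_mul] at hre
        linear_combination conj z * hre
      · obtain ⟨e, he, he0⟩ := hΓ.exists_ne_zero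
        refine ⟨e, he, he0, Or.inl fun g hg => ?_⟩
        exact (Int.units_eq_one_or _).resolve_right fun h => hr ⟨g, hg, h⟩
    have hue := mul_mem_translationLattice hg he
    rw [hgε, conjIf_one] at hue
    set u := g.right.left
    have hlin := isLinearChange_mul Γ (inv_ne_zero he0)
    suffices ∃ ω : ℂ, (ω = Complex.I ∨ ω = zeta3) ∧ ω * e ∈ translationLattice Γ by
      obtain ⟨ω, hω, hωe⟩ := this
      obtain ⟨φ, hφ, hφn⟩ := hlin.exists_isNormalized hΓ he hωe (inv_mul_cancel₀ he0)
        (by rw [AddMonoidHom.coe_mulLeft, mul_comm ω, inv_mul_cancel_left₀ he0]) heA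
      exact ⟨ω, hω, φ, _, hφ, hφn⟩
    obtain ⟨j, hj, hj1, hj2⟩ := hΓ.exists_trace hg hgε
    have hq := circle_quadratic hj
    have hneg : -((u : ℂ) * e) ∈ translationLattice Γ := neg_mem hue
    have hreal : (u : ℂ) = 1 ∨ (u : ℂ) = -1 → False := by
      rintro (h | h) <;> exact hgu (by simp [u, h])
    interval_cases j
    · refine (hreal (Or.inr ?_)).elim
      have : ((u : ℂ) + 1) ^ 2 = 0 := by
        push_cast at hq
        linear_combination hq
      linear_combination pow_eq_zero_iff (two_ne_zero) |>.1 this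
    · refine ⟨zeta3, Or.inr rfl, ?_⟩
      have : ((u : ℂ) - zeta3) * (u + 1 + zeta3) = 0 := by
        push_cast at hq
        linear_combination hq - zeta3_sq
      rcases mul_eq_zero.1 this with h | h
      · convert hue using 1
        linear_combination -e * h
      · convert sub_mem hneg he using 1
        linear_combination e * h
    · refine ⟨Complex.I, Or.inl rfl, ?_⟩
      have : ((u : ℂ) - Complex.I) * (u + Complex.I) = 0 := by
        push_cast at hq
        linear_combination hq - Complex.I_sq
      rcases mul_eq_zero.1 this with h | h
      · convert hue using 1
        linear_combination -e * h
      · convert hneg using 1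
        linear_combination e * h
    · refine ⟨zeta3, Or.inr rfl, ?_⟩
      have : ((u : ℂ) + zeta3) * (u - 1 - zeta3) = 0 := by
        push_cast at hq
        linear_combination hq - zeta3_sq
      rcases mul_eq_zero.1 this with h | h
      · convert hneg using 1
        linear_combination e * h
      · convert sub_mem hue he using 1
        linear_combination -e * h
    · refine (hreal (Or.inl ?_)).elim
      have : ((u : ℂ) - 1) ^ 2 = 0 := by
        push_cast at hq
        linear_combination hq
      linear_combination pow_eq_zero_iff (two_ne_zero) |>.1 this
  · push Not at hrot
    have hpm : ∀ g ∈ Γ, g.right.right = 1 → (g.right.left : ℂ) = 1 ∨ (g.right.left : ℂ) = -1 :=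
      fun g hg hgε => circle_eq_one_or_neg_one (hrot g hg hgε)
    have hrotcompat : ∀ (e f : ℂ) (g : HeisIsom), g ∈ Γ → g.right.right = 1 →
        ∃ v : Circle, ∀ z, basisCoord e f (g.right.left * conjIf g.right.right z) =
          v * conjIf g.right.right (basisCoord e f z) := by
      intro e f g hg hgε
      refine ⟨g.right.left, fun z => ?_⟩
      rw [hgε, conjIf_one, conjIf_one]
      rcases hpm g hg hgε with h | h <;> rw [h]
      · rw [one_mul, one_mul]
      · rw [neg_one_mul, neg_one_mul, map_neg]
    suffices ∃ e ∈ translationLattice Γ, ∃ f ∈ translationLattice Γ, (f * conj e).im ≠ 0 ∧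
        ((∀ g ∈ Γ, g.right.right = 1) ∨ ∃ g ∈ Γ, g.right.right = -1 ∧
          (g.right.left : ℂ) * conj e = e ∧ (g.right.left : ℂ) * conj f = -f) by
      obtain ⟨e, he, f, hf, hef, hr⟩ := this
      refine ⟨Complex.I, Or.inl rfl, ?_⟩
      have hlin : IsLinearChange Γ (basisCoord e f) ((f * conj e).im)⁻¹ := by
        refine ⟨inv_ne_zero hef, basisCoord_area hef, fun g hg => ?_⟩
        rcases hr with hall | ⟨r, hr, hrε, hre, hrf⟩
        · exact hrotcompat e f g hg (hall g hg)
        · rcases Int.units_eq_one_or g.right.right with hgε | hgε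
          · exact hrotcompat e f g hg hgε
          · -- two reflections differ by a rotation of the holonomy, which is a sign
            have h1 : (g * r).right.right = 1 := by
              rw [HeisIsom.mul_ε, hgε, hrε]
              simp
            have h2 := hpm _ (Γ.mul_mem hg hr) h1
            rw [HeisIsom.mul_u, hgε, Units.val_neg, Units.val_one, zpow_neg_one, Circle.coe_mul,
              Circle.coe_inv, ← div_eq_mul_inv, div_eq_iff (Circle.coe_ne_zero _),
              div_eq_iff (Circle.coe_ne_zero _)] at h2
            rw [hgε]
            simp only [conjIf_neg_one]
            rcases h2 with h2 | h2
            · refine ⟨1, fun z => ?_⟩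
              rw [h2, one_mul, basisCoord_reflection hre hrf, Circle.coe_one, one_mul]
            · refine ⟨-1, fun z => ?_⟩
              rw [h2, neg_one_mul, neg_mul, map_neg, basisCoord_reflection hre hrf]
              simp
      obtain ⟨φ, hφ, hφn⟩ := hlin.exists_isNormalized hΓ he hf (basisCoord_left hef)
        (basisCoord_right hef) (hr.imp_right fun ⟨g, hg, hgε, hge, hgf⟩ =>
          ⟨g, hg, hgε, basisCoord_reflection hge hgf⟩)
      exact ⟨φ, _, hφ, hφn⟩
    by_cases hr : ∃ g ∈ Γ, g.right.right = -1
    · obtain ⟨r, hr, hrε⟩ := hr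
      obtain ⟨e, he, he0, hre⟩ := haxis r hr hrε 1
      obtain ⟨f, hf, hf0, hrf⟩ := haxis r hr hrε (-1)
      simp only [Units.val_one, Int.cast_one, one_mul, Units.val_neg, Int.cast_neg,
        neg_mul] at hre hrf
      refine ⟨e, he, f, hf, fun h0 => ?_, Or.inr ⟨r, hr, hrε, hre, hrf⟩⟩
      -- `f` and `e` are perpendicular
      have h1 : f * conj e = -conj (f * conj e) := by
        have hu := Circle.coe_ne_zero r.right.left
        refine mul_left_cancel₀ hu ?_
        rw [map_mul, Complex.conj_conj]
        linear_combination f * hre + e * hrf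
      have h2 := congrArg Complex.re h1
      rw [Complex.neg_re, Complex.conj_re] at h2
      have h3 : f * conj e = 0 := Complex.ext (by rw [Complex.zero_re]; linarith) h0
      rcases mul_eq_zero.1 h3 with h | h
      · exact hf0 h
      · exact he0 (by simpa using h)
    · obtain ⟨z, hz, w, hw, hzw⟩ := hΓ.independent
      refine ⟨w, hw, z, hz, hzw, Or.inl fun g hg => ?_⟩
      exact (Int.units_eq_one_or _).resolve_right fun h => hr ⟨g, hg, h⟩

/-! ### Conjugation by the Heisenberg group -/

theorem heisRot_mul_translation (n : ℂ) {l : HeisIsom} (hl1 : l.right = 1) :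
    heisRot n 0 1 * l * (heisRot n 0 1)⁻¹ =
      heisRot l.left.z (l.left.t + 4 * (n * conj l.left.z).im) 1 := by
  rw [mul_inv_eq_iff_eq_mul]
  refine SemidirectProduct.ext (Heis.ext ?_ ?_) ?_
  · rw [HeisIsom.mul_z, HeisIsom.mul_z]
    simp [heisRot]
    ring
  · rw [HeisIsom.mul_t, HeisIsom.mul_t]
    simp [heisRot]
    ring
  · rw [SemidirectProduct.mul_right, SemidirectProduct.mul_right, hl1]
    rfl

theorem heisRot_right (z : ℂ) (t : ℝ) : (heisRot z t 1).right = 1 := rfl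

/-- The central coordinate of a reflection can be removed by conjugation with a central element. -/
theorem heisRot_mul_reflection {g : HeisIsom} (hg : g.right = ⟨1, -1⟩) :
    heisRot 0 (-g.left.t / 2) 1 * g * (heisRot 0 (-g.left.t / 2) 1)⁻¹ =
      heisRotIota g.left.z 0 1 := by
  rw [mul_inv_eq_iff_eq_mul]
  refine SemidirectProduct.ext (Heis.ext ?_ ?_) ?_
  · rw [HeisIsom.mul_z, HeisIsom.mul_z]
    simp only [heisRot, heisRotIota, conjIf_one, conjIf_neg_one, map_zero, mul_zero, Circle.coe_one]
    ring
  · rw [HeisIsom.mul_t, HeisIsom.mul_t]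
    simp only [heisRot, heisRotIota, conjIf_one, conjIf_neg_one, map_zero, mul_zero, zero_mul,
      Complex.zero_im, Units.val_one, Units.val_neg, Int.cast_one, Int.cast_neg]
    ring
  · rw [SemidirectProduct.mul_right, SemidirectProduct.mul_right, hg]
    exact (one_mul _).trans (mul_one _).symm

theorem IsNormalized.conj {Γ : Subgroup HeisIsom} {τ : ℝ} {ω : ℂ} (hΓ : IsNormalized Γ τ ω)
    (c : HeisIsom) (hc : c.right = 1) :
    IsNormalized ((MulAut.conj c).toMonoidHom.comp Γ.subtype).range τ ω := by
  have hmem : ∀ z ∈ translationLattice Γ,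
      z ∈ translationLattice ((MulAut.conj c).toMonoidHom.comp Γ.subtype).range := by
    rintro _ ⟨l, hl, hl1, rfl⟩
    refine ⟨c * l * c⁻¹, ⟨⟨l, hl⟩, rfl⟩, by simp [hl1], ?_⟩
    have h1 : (c * l * c⁻¹).right = 1 := by simp [hl1]
    have h := congrArg (fun x : HeisIsom => x.left.z) (inv_mul_cancel_right (c * l) c)
    simp only [HeisIsom.mul_z (c * l * c⁻¹), HeisIsom.mul_z c l, h1, hc] at h
    simp only [SemidirectProduct.one_left, SemidirectProduct.one_right, conjIf_one,
      Circle.coe_one, one_mul] at h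
    linear_combination h
  refine ⟨⟨?_, ?_⟩, hmem _ hΓ.one_mem, hmem _ hΓ.omega_mem, ?_⟩
  · rintro t ⟨g, hg⟩
    refine hΓ.center t ?_
    have h0 : c * heisRot 0 t 1 = heisRot 0 t 1 * c := by
      refine SemidirectProduct.ext (Heis.ext ?_ ?_) ?_
      · rw [HeisIsom.mul_z, HeisIsom.mul_z, hc]
        simp [heisRot]
      · rw [HeisIsom.mul_t, HeisIsom.mul_t, hc]
        simp [heisRot]
        ring
      · rw [SemidirectProduct.mul_right, SemidirectProduct.mul_right, hc]
        exact (one_mul _).trans (mul_one _).symm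
    have h2 : c * g = heisRot 0 t 1 * c := mul_inv_eq_iff_eq_mul.1 hg
    rw [← h0] at h2
    rw [← mul_left_cancel h2]
    exact g.2
  · obtain ⟨z, hz, w, hw, hzw⟩ := hΓ.independent
    exact ⟨z, hmem z hz, w, hmem w hw, hzw⟩
  · have hright : ∀ g : HeisIsom, (c * g * c⁻¹).right = g.right := by
      intro g
      simp [hc]
    rcases hΓ.reflection with hall | ⟨g, hg, hgε, hgu⟩
    · left
      rintro _ ⟨g, rfl⟩
      exact (congrArg (·.right) (hright g)).trans (hall g g.2)
    · right
      refine ⟨_, ⟨⟨g, hg⟩, rfl⟩, ?_, ?_⟩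
      · exact (congrArg (·.right) (hright g)).trans hgε
      · exact (congrArg (·.left) (hright g)).trans hgu

theorem heisRot_zpow (z : ℂ) (t : ℝ) (n : ℤ) : heisRot z t 1 ^ n = heisRot (n * z) (n * t) 1 := by
  have hadd : ∀ m n : ℝ, heisRot ((m + n : ℝ) * z) ((m + n) * t) 1 =
      heisRot (m * z) (m * t) 1 * heisRot (n * z) (n * t) 1 := by
    intro m n
    refine SemidirectProduct.ext (Heis.ext ?_ ?_) (by
      simp only [SemidirectProduct.mul_right, heisRot_right, mul_one])
    · rw [HeisIsom.mul_z]
      simp [heisRot]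
      ring
    · rw [HeisIsom.mul_t]
      simp [heisRot]
      ring
  let f : Multiplicative ℝ →* HeisIsom :=
    MonoidHom.mk' (fun r => heisRot ((r.toAdd : ℝ) * z) (r.toAdd * t) 1) fun m n => hadd _ _
  have h := map_zpow f (Multiplicative.ofAdd 1) n
  rw [← ofAdd_zsmul] at h
  simpa [f] using h.symm

/-- A normalized lattice in which the central coordinates of the translations by `1` and `ω` and
of a reflection vanish. -/
structure IsCentered (Γ : Subgroup HeisIsom) (τ : ℝ) (ω : ℂ) : Prop
    extends IsNilLattice Γ τ where
  one_mem : heisRot 1 0 1 ∈ Γ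
  omega_mem : heisRot ω 0 1 ∈ Γ
  reflection : (∀ g ∈ Γ, g.right.right = 1) ∨
    ∃ w : ℂ, heisRotIota w 0 1 ∈ Γ

/-- The central coordinates are made to vanish by conjugation with an element of `𝔑₃`: its
horizontal part takes care of the translations, its central part of the reflection. -/
theorem IsNormalized.exists_isCentered {Γ : Subgroup HeisIsom} {τ : ℝ} {ω : ℂ}
    (hΓ : IsNormalized Γ τ ω) (hω : ω.im ≠ 0) :
    ∃ φ : Γ →* HeisIsom, Function.Injective φ ∧ IsCentered φ.range τ ω := by
  obtain ⟨l, hl, hl1, hlz⟩ := hΓ.one_mem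
  obtain ⟨m, hm, hm1, hmz⟩ := hΓ.omega_mem
  obtain ⟨n, hn1, hn2⟩ : ∃ n : ℂ, l.left.t + 4 * (n * conj (1 : ℂ)).im = 0 ∧
      m.left.t + 4 * (n * conj ω).im = 0 := by
    refine ⟨⟨(m.left.t / 4 - l.left.t / 4 * ω.re) / ω.im, -l.left.t / 4⟩, ?_, ?_⟩
    · simp
      ring
    · simp only [Complex.mul_im, Complex.conj_re, Complex.conj_im]
      field_simp
      ring
  obtain ⟨r, hr⟩ : ∃ r : ℝ, (∀ g ∈ Γ, g.right.right = 1) ∨ ∃ g ∈ Γ, ∃ w : ℂ,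
      heisRot 0 r 1 * (heisRot n 0 1 * g * (heisRot n 0 1)⁻¹) * (heisRot 0 r 1)⁻¹ =
        heisRotIota w 0 1 := by
    rcases hΓ.reflection with hall | ⟨g, hg, hgε, hgu⟩
    · exact ⟨0, Or.inl hall⟩
    · set g' := heisRot n 0 1 * g * (heisRot n 0 1)⁻¹ with hg'
      have hg'r : g'.right = ⟨1, -1⟩ := by
        have h1 : g.right = ⟨1, -1⟩ := SemidirectProduct.ext hgu hgε
        have h2 : (heisRot n 0 1).right = 1 := rfl
        simp [hg', h1, h2]
      exact ⟨-g'.left.t / 2, Or.inr ⟨g, hg, g'.left.z, heisRot_mul_reflection hg'r⟩⟩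
  set c := heisRot 0 r 1 * heisRot n 0 1 with hc
  have hcr : c.right = 1 := by
    rw [hc, SemidirectProduct.mul_right]
    exact one_mul _
  have hconj : ∀ g, c * g * c⁻¹ =
      heisRot 0 r 1 * (heisRot n 0 1 * g * (heisRot n 0 1)⁻¹) * (heisRot 0 r 1)⁻¹ := by
    intro g
    rw [hc]
    group
  have htrans : ∀ k : HeisIsom, k.right = 1 → k.left.t + 4 * (n * conj k.left.z).im = 0 →
      c * k * c⁻¹ = heisRot k.left.z 0 1 := by
    intro k hk1 hk
    rw [hconj, heisRot_mul_translation n hk1, hk, mul_inv_eq_iff_eq_mul]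
    refine SemidirectProduct.ext (Heis.ext ?_ ?_) (by
      simp only [SemidirectProduct.mul_right, heisRot_right, mul_one])
    · rw [HeisIsom.mul_z, HeisIsom.mul_z]
      simp [heisRot]
    · rw [HeisIsom.mul_t, HeisIsom.mul_t]
      simp [heisRot]
  refine ⟨(MulAut.conj c).toMonoidHom.comp Γ.subtype,
    (MulAut.conj c).injective.comp Subtype.val_injective,
    (hΓ.conj c hcr).toIsNilLattice, ?_, ?_, ?_⟩
  · exact ⟨⟨l, hl⟩, (htrans l hl1 (by rw [hlz]; exact hn1)).trans (by rw [hlz])⟩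
  · exact ⟨⟨m, hm⟩, (htrans m hm1 (by rw [hmz]; exact hn2)).trans (by rw [hmz])⟩
  · rcases hr with hall | ⟨g, hg, w, hw⟩
    · left
      have hright : ∀ g : HeisIsom, (c * g * c⁻¹).right = g.right := by
        intro g
        simp [hcr]
      rintro _ ⟨g, rfl⟩
      exact (congrArg (·.right) (hright g)).trans (hall g g.2)
    · exact Or.inr ⟨w, ⟨g, hg⟩, (hconj g).trans hw⟩

/-! ### Bounded denominators -/

/-- The lattice `ℤ + ℤ ω`. -/
def intLattice (ω : ℂ) : Set ℂ := {z | ∃ a b : ℤ, z = a + b * ω}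

theorem natCast_mul_im (n : ℕ) (z : ℂ) : ((n : ℂ) * z).im = n * z.im := by simp

theorem exists_area_intLattice {ω z w : ℂ} (hz : z ∈ intLattice ω) (hw : w ∈ intLattice ω) :
    ∃ j : ℤ, (z * conj w).im = j * ω.im := by
  obtain ⟨a, b, rfl⟩ := hz
  obtain ⟨c, d, rfl⟩ := hw
  refine ⟨b * c - a * d, ?_⟩
  simp
  ring

theorem mem_intLattice_of_areas {ω z : ℂ} (hω : ω.im ≠ 0) {m n : ℤ} (h1 : z.im = n * ω.im)
    (h2 : (z * conj ω).im = m * ω.im) : z ∈ intLattice ω := by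
  refine ⟨-m, n, Complex.ext (mul_right_cancel₀ hω ?_) ?_⟩
  · simp only [Complex.mul_im, Complex.conj_re, Complex.conj_im] at h2
    simp only [Complex.add_re, Complex.intCast_re, Complex.mul_re, Complex.intCast_im, zero_mul,
      sub_zero, Int.cast_neg, Complex.neg_re]
    linear_combination ω.re * h1 - h2
  · simpa using h1

theorem mul_mem_intLattice {ω : ℂ} {p : ℤ} (hp : ω ^ 2 = p * ω - 1) {z w : ℂ}
    (hz : z ∈ intLattice ω) (hw : w ∈ intLattice ω) : z * w ∈ intLattice ω := by
  obtain ⟨a, b, rfl⟩ := hz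
  obtain ⟨c, d, rfl⟩ := hw
  refine ⟨a * c - b * d, a * d + b * c + p * b * d, ?_⟩
  push_cast
  linear_combination (b * d : ℂ) * hp

theorem natCast_mul_mem_intLattice {ω z : ℂ} (hz : z ∈ intLattice ω) (n : ℕ) :
    n * z ∈ intLattice ω := by
  obtain ⟨a, b, rfl⟩ := hz
  refine ⟨n * a, n * b, ?_⟩
  push_cast
  ring

namespace IsCentered

variable {Γ : Subgroup HeisIsom} {τ : ℝ} {ω : ℂ}

/-- The commutator of the translations by `1` and `ω` has central coordinate `4 Im ω = ± κ τ`,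
so that `κ` is a common denominator for the centre. -/
theorem exists_center_denominator (hΓ : IsCentered Γ τ ω) (hω : ω.im ≠ 0) :
    ∃ κ : ℕ, 0 < κ ∧ ∀ t : ℝ, heisRot 0 t 1 ∈ Γ → ∃ n : ℤ, κ * t = n * (4 * ω.im) := by
  have h1 := commutator_mem hΓ.omega_mem hΓ.one_mem rfl rfl
  have h2 : (heisRot ω 0 1).left.z * conj (heisRot 1 0 1).left.z = ω := by
    simp [heisRot]
  rw [h2] at h1
  obtain ⟨k, hk⟩ := hΓ.center _ h1
  have hk0 : k ≠ 0 := by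
    rintro rfl
    simp [hω] at hk
  refine ⟨k.natAbs, Int.natAbs_pos.2 hk0, fun t ht => ?_⟩
  obtain ⟨n, hn⟩ := hΓ.center t ht
  rcases Int.natAbs_eq k with h | h
  · refine ⟨n, ?_⟩
    have h3 : ((k.natAbs : ℕ) : ℝ) = k := by
      conv_rhs => rw [h]
      simp
    rw [h3, hn, hk]
    ring
  · refine ⟨-n, ?_⟩
    have h3 : ((k.natAbs : ℕ) : ℝ) = -k := by
      conv_rhs => rw [h]
      simp
    rw [h3, hn, hk]
    push_cast
    ring

variable {κ : ℕ}

theorem translation_mem (hΓ : IsCentered Γ τ ω) (hω : ω.im ≠ 0)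
    (hκ : ∀ t : ℝ, heisRot 0 t 1 ∈ Γ → ∃ n : ℤ, κ * t = n * (4 * ω.im)) {l : HeisIsom}
    (hl : l ∈ Γ) (hl1 : l.right = 1) : (κ : ℂ) * l.left.z ∈ intLattice ω := by
  obtain ⟨n, hn⟩ := hκ _ (commutator_mem hl hΓ.one_mem hl1 rfl)
  obtain ⟨m, hm⟩ := hκ _ (commutator_mem hl hΓ.omega_mem hl1 rfl)
  refine mem_intLattice_of_areas (n := n) (m := m) hω ?_ ?_
  · rw [natCast_mul_im]
    simp only [heisRot, map_one, mul_one] at hn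
    linarith
  · rw [mul_assoc, natCast_mul_im]
    simp only [heisRot] at hm
    linarith

/-- The central coordinates of the translations, in multiples of `2 Im ω`. -/
theorem translation_t (hΓ : IsCentered Γ τ ω) (hω : ω.im ≠ 0)
    (hκ : ∀ t : ℝ, heisRot 0 t 1 ∈ Γ → ∃ n : ℤ, κ * t = n * (4 * ω.im)) {l : HeisIsom}
    (hl : l ∈ Γ) (hl1 : l.right = 1) : ∃ n : ℤ, (κ : ℝ) ^ 2 * l.left.t = n * (2 * ω.im) := by
  obtain ⟨a, b, hab⟩ := hΓ.translation_mem hω hκ hl hl1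
  -- `l ^ κ` and a product of powers of the two given translations differ by a central element
  have h1 := Γ.mul_mem (Γ.zpow_mem (heisRot_mem_of_right_eq_one hl hl1) κ)
    (Γ.inv_mem (Γ.mul_mem (Γ.zpow_mem hΓ.one_mem a) (Γ.zpow_mem hΓ.omega_mem b)))
  rw [heisRot_zpow, heisRot_zpow, heisRot_zpow, Int.cast_natCast, hab] at h1
  have h2 : heisRot (a + b * ω) ((κ : ℤ) * l.left.t) 1 *
      (heisRot (a * 1) (a * 0) 1 * heisRot (b * ω) (b * 0) 1)⁻¹ =
      heisRot 0 (κ * l.left.t + a * b * (2 * ω.im)) 1 := by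
    rw [mul_inv_eq_iff_eq_mul]
    refine SemidirectProduct.ext (Heis.ext ?_ ?_) (by
      simp only [SemidirectProduct.mul_right, heisRot_right, mul_one])
    · rw [HeisIsom.mul_z, HeisIsom.mul_z]
      simp [heisRot]
    · rw [HeisIsom.mul_t, HeisIsom.mul_t]
      simp [heisRot]
      ring
  rw [h2] at h1
  obtain ⟨n, hn⟩ := hκ _ h1
  refine ⟨2 * n - κ * a * b, ?_⟩
  push_cast
  linear_combination hn

/-- Conjugation of the translations by `1` and `ω` with `g⁻¹` gives translations whose central
coordinates are the areas that the vector of `g` spans with `1` and `ω`. -/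
theorem z_mem (hΓ : IsCentered Γ τ ω) (hω : ω.im ≠ 0)
    (hκ : ∀ t : ℝ, heisRot 0 t 1 ∈ Γ → ∃ n : ℤ, κ * t = n * (4 * ω.im)) {g : HeisIsom}
    (hg : g ∈ Γ) : ((2 * κ ^ 2 : ℕ) : ℂ) * g.left.z ∈ intLattice ω := by
  have key : ∀ v : ℂ, heisRot v 0 1 ∈ Γ →
      ∃ n : ℤ, ((2 * κ ^ 2 : ℕ) : ℝ) * (g.left.z * conj v).im = n * ω.im := by
    intro v hv
    obtain ⟨m, hm, hm1, hmz, hmt⟩ := exists_conj_translation (Γ.inv_mem hg) hv rfl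
    obtain ⟨n, hn⟩ := hΓ.translation_t hω hκ hm hm1
    have h1 : g⁻¹.left.z = -(g⁻¹.right.left * conjIf g⁻¹.right.right g.left.z) := by
      have h := congrArg (fun x : HeisIsom => x.left.z) (inv_mul_cancel g)
      simp only [HeisIsom.mul_z, SemidirectProduct.one_left, Heis.one_z] at h
      linear_combination h
    have h2 : m.left.t = -((g.right.right : ℤ) : ℝ) * (4 * (g.left.z * conj v).im) := by
      rw [hmt, hmz, h1, neg_mul, Complex.neg_im, im_circle_mul, conjIf_mul_conj, HeisIsom.inv_ε]
      simp only [heisRot]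
      ring
    rw [h2] at hn
    rcases Int.units_eq_one_or g.right.right with h | h
    · refine ⟨-n, ?_⟩
      simp only [h, Units.val_one, Int.cast_one] at hn
      push_cast
      linarith
    · refine ⟨n, ?_⟩
      simp only [h, Units.val_one, Units.val_neg, Int.cast_neg, Int.cast_one, neg_neg] at hn
      push_cast
      linarith
  obtain ⟨n, hn⟩ := key 1 hΓ.one_mem
  obtain ⟨m, hm⟩ := key ω hΓ.omega_mem
  refine mem_intLattice_of_areas (n := n) (m := m) hω ?_ ?_
  · rw [natCast_mul_im]
    simpa using hn
  · rw [mul_assoc, natCast_mul_im]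
    exact hm

/-- The rotation part of `g` is a translation vector, as the image of `1`. -/
theorem u_mem (hΓ : IsCentered Γ τ ω) (hω : ω.im ≠ 0)
    (hκ : ∀ t : ℝ, heisRot 0 t 1 ∈ Γ → ∃ n : ℤ, κ * t = n * (4 * ω.im)) {g : HeisIsom}
    (hg : g ∈ Γ) : (κ : ℂ) * g.right.left ∈ intLattice ω := by
  obtain ⟨l, hl, hl1, hlz⟩ := mul_mem_translationLattice hg
    (mem_translationLattice.2 ⟨_, hΓ.one_mem, rfl, rfl⟩)
  have := hΓ.translation_mem hω hκ hl hl1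
  rw [hlz] at this
  rcases Int.units_eq_one_or g.right.right with h | h <;> simpa [h, heisRot] using this

theorem rotation_pow_twelve (hΓ : IsCentered Γ τ ω) {g : HeisIsom} (hg : g ∈ Γ)
    (hgε : g.right.right = 1) : (g.right.left : ℂ) ^ 12 = 1 := by
  obtain ⟨j, hj, hj1, hj2⟩ := hΓ.exists_trace hg hgε
  have hq := circle_quadratic hj
  generalize (g.right.left : ℂ) = u at hq
  interval_cases j
  · have : (u + 1) ^ 2 = 0 := by
      push_cast at hq
      linear_combination hq
    have : u = -1 := by linear_combination pow_eq_zero_iff (two_ne_zero) |>.1 this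
    rw [this]
    norm_num
  · have : u ^ 3 = 1 := by
      push_cast at hq
      linear_combination (u - 1) * hq
    rw [show u ^ 12 = (u ^ 3) ^ 4 by ring, this, one_pow]
  · have : u ^ 2 = -1 := by
      push_cast at hq
      linear_combination hq
    rw [show u ^ 12 = (u ^ 2) ^ 6 by ring, this]
    norm_num
  · have : u ^ 3 = -1 := by
      push_cast at hq
      linear_combination (u + 1) * hq
    rw [show u ^ 12 = (u ^ 3) ^ 4 by ring, this]
    norm_num
  · have : (u - 1) ^ 2 = 0 := by
      push_cast at hq
      linear_combination hq
    have : u = 1 := by linear_combination pow_eq_zero_iff (two_ne_zero) |>.1 this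
    rw [this]
    norm_num

/-- The central coordinate of a rotation has bounded denominator: modulo such denominators it is
additive, and the twelfth power of a rotation is a translation. -/
theorem rotation_t (hΓ : IsCentered Γ τ ω) (hω : ω.im ≠ 0) {p : ℤ} (hp : ω ^ 2 = p * ω - 1)
    (hκ0 : 0 < κ) (hκ : ∀ t : ℝ, heisRot 0 t 1 ∈ Γ → ∃ n : ℤ, κ * t = n * (4 * ω.im))
    {g : HeisIsom} (hg : g ∈ Γ) (hgε : g.right.right = 1) :
    ∃ n : ℤ, ((48 * κ ^ 7 : ℕ) : ℝ) * g.left.t = n * (2 * ω.im) := by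
  set N := 2 * κ ^ 2 with hN
  have hpow : ∀ n : ℕ, (g ^ n).right.right = 1 ∧
      (g ^ n).right.left = g.right.left ^ n ∧
      ∃ j : ℤ, ((κ * N ^ 2 : ℕ) : ℝ) * ((g ^ n).left.t - n * g.left.t) = j * (2 * ω.im) := by
    intro n
    induction n with
    | zero => exact ⟨rfl, rfl, 0, by simp⟩
    | succ n ih =>
      obtain ⟨h1, h2, j, hj⟩ := ih
      refine ⟨?_, ?_, ?_⟩
      · rw [pow_succ, HeisIsom.mul_ε, h1, hgε, one_mul]
      · rw [pow_succ, HeisIsom.mul_u, h1, h2, Units.val_one, zpow_one, pow_succ]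
      · have hgn := Γ.pow_mem hg n
        obtain ⟨i, hi⟩ := exists_area_intLattice (hΓ.z_mem hω hκ hgn)
          (mul_mem_intLattice hp (hΓ.u_mem hω hκ hgn) (hΓ.z_mem hω hκ hg))
        refine ⟨j + i, ?_⟩
        rw [pow_succ g, HeisIsom.mul_t, h1, conjIf_one]
        have h3 : ((2 * κ ^ 2 : ℕ) : ℂ) * (g ^ n).left.z * conj ((κ : ℂ) * (g ^ n).right.left *
            (((2 * κ ^ 2 : ℕ) : ℂ) * g.left.z)) = ((κ * N ^ 2 : ℕ) : ℂ) *
            ((g ^ n).left.z * conj ((g ^ n).right.left * g.left.z)) := by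
          simp only [map_mul, Complex.conj_natCast, hN]
          push_cast
          ring
        rw [h3, natCast_mul_im] at hi
        push_cast at hj hi ⊢
        linear_combination hj + 2 * hi
  obtain ⟨h1, h2, j, hj⟩ := hpow 12
  have h12 : (g ^ 12).right = 1 :=
    SemidirectProduct.ext (Circle.ext (by
      rw [h2, Circle.coe_pow]
      exact hΓ.rotation_pow_twelve hg hgε)) h1
  obtain ⟨n, hn⟩ := hΓ.translation_t hω hκ (Γ.pow_mem hg 12) h12
  refine ⟨4 * κ ^ 5 * n - κ ^ 2 * j, ?_⟩
  have hκ' : (κ : ℝ) ≠ 0 := by exact_mod_cast hκ0.ne'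
  rw [hN] at hj
  push_cast at hj ⊢
  linear_combination 4 * (κ : ℝ) ^ 5 * hn - (κ : ℝ) ^ 2 * hj

end IsCentered

/-! ### Rings of integers -/

theorem mem_integersIn {k : IntermediateField ℚ ℂ} {z : ℂ} (hz : z ∈ k) (hi : IsIntegral ℤ z) :
    z ∈ integersIn k := by
  have h1 : IsIntegral ℤ (⟨z, hz⟩ : k) :=
    (isIntegral_algebraMap_iff (B := ℂ) (algebraMap k ℂ).injective).1 hi
  exact ⟨⟨⟨z, hz⟩, h1⟩, rfl⟩

theorem isIntegral_of_sq {ω : ℂ} {p : ℤ} (hp : ω ^ 2 = p * ω - 1) : IsIntegral ℤ ω := by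
  refine ⟨Polynomial.X ^ 2 - Polynomial.C p * Polynomial.X + 1, ?_, ?_⟩
  · monicity!
  · simp only [Polynomial.eval₂_add, Polynomial.eval₂_sub, Polynomial.eval₂_mul,
      Polynomial.eval₂_pow, Polynomial.eval₂_X, Polynomial.eval₂_C, Polynomial.eval₂_one]
    rw [hp]
    simp

theorem mem_integersIn_of_intLattice {k : IntermediateField ℚ ℂ} {ω z : ℂ} (hω : ω ∈ k) {n : ℕ}
    (hn : 0 < n) (hz : (n : ℂ) * z ∈ intLattice ω) (hi : IsIntegral ℤ z) : z ∈ integersIn k := by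
  obtain ⟨a, b, hab⟩ := hz
  have hn' : (n : ℂ) ≠ 0 := by exact_mod_cast hn.ne'
  have hz : z = (n : ℂ)⁻¹ * (a + b * ω) := by rw [← hab, inv_mul_cancel_left₀ hn']
  refine mem_integersIn ?_ hi
  rw [hz]
  exact mul_mem (inv_mem (natCast_mem _ _)) (add_mem (intCast_mem _ _)
    (mul_mem (intCast_mem _ _) hω))

theorem intLattice_subset {R : Subring ℂ} {ω z : ℂ} (hω : ω ∈ R) (hz : z ∈ intLattice ω) :
    z ∈ R := by
  obtain ⟨a, b, rfl⟩ := hz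
  exact add_mem (intCast_mem _ _) (mul_mem (intCast_mem _ _) hω)

theorem I_mem_gaussField : Complex.I ∈ gaussField :=
  IntermediateField.mem_adjoin_simple_self ℚ _

theorem zeta3_mem_eisensteinField : zeta3 ∈ eisensteinField :=
  IntermediateField.mem_adjoin_simple_self ℚ _

theorem conj_zeta3 : conj zeta3 = -1 - zeta3 := by
  rw [zeta3]
  simp only [map_add, map_mul, map_div₀, map_neg, map_one, Complex.conj_ofReal, Complex.conj_I,
    Complex.conj_ofNat]
  ring

theorem zeta3_im_pos : 0 < zeta3.im := by
  rw [zeta3]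
  simp

/-! ### Lattices embed in the integral group -/

/-- The integral group contains the dilation of a centered lattice by a common denominator. -/
theorem IsCentered.exists_hom {Γ : Subgroup HeisIsom} {τ : ℝ} {ω : ℂ} (hΓ : IsCentered Γ τ ω)
    (hω : ω.im ≠ 0) {p : ℤ} (hp : ω ^ 2 = p * ω - 1) (hconj : conj ω = p - ω)
    {k : IntermediateField ℚ ℂ} (hk : ω ∈ k) :
    ∃ φ : Γ →* heisIntegralIota (integersIn k), Function.Injective φ := by
  have hωR : ω ∈ integersIn k := mem_integersIn hk (isIntegral_of_sq hp)
  obtain ⟨κ, hκ0, hκ⟩ := hΓ.exists_center_denominator hω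
  set M : ℕ := 48 * κ ^ 7 with hM
  have hM0 : ((M : ℕ) : ℂ) ≠ 0 := by
    have : 0 < M := by positivity
    exact_mod_cast this.ne'
  obtain ⟨f, hf, hfc⟩ := (isLinearChange_mul Γ hM0).exists_hom
  have hu : ∀ g : Γ, (f g).right.left = (g : HeisIsom).right.left := by
    intro g
    have h := (hfc g).2.2.2.1 1
    refine Circle.ext (mul_right_cancel₀ hM0 ?_)
    rcases Int.units_eq_one_or (g : HeisIsom).right.right with h1 | h1 <;>
      simp [h1] at h <;> simp [h.symm, mul_comm]
  have hzR : ∀ g ∈ Γ, (M : ℂ) * g.left.z ∈ integersIn k := by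
    intro g hg
    refine intLattice_subset hωR ?_
    have h := natCast_mul_mem_intLattice (hΓ.z_mem hω hκ hg) (24 * κ ^ 5)
    convert h using 1
    rw [hM]
    push_cast
    ring
  -- the rotations become integral
  have hrot : ∀ g : Γ, (g : HeisIsom).right.right = 1 →
      f g ∈ heisIntegralIota (integersIn k) := by
    intro g hgε
    refine Subgroup.subset_closure (Or.inl ⟨?_, ?_, ?_, (hfc g).2.2.1.trans hgε⟩)
    · rw [(hfc g).1]
      exact hzR g g.2
    · obtain ⟨n, hn⟩ := hΓ.rotation_t hω hp hκ0 hκ g.2 hgε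
      rw [← hM] at hn
      have h2 : ((2 * ω.im : ℝ) : ℂ) * Complex.I = ω - conj ω := by
        rw [Complex.sub_conj]
      have h1 : ((f g).left.t : ℂ) * Complex.I = (M : ℂ) * (n * (ω - conj ω)) := by
        rw [(hfc g).2.1, ← h2, ← mul_assoc (n : ℂ), ← Complex.ofReal_intCast,
          ← Complex.ofReal_mul, ← hn, Complex.normSq_natCast]
        push_cast
        ring
      rw [h1, hconj]
      exact mul_mem (natCast_mem _ _) (mul_mem (intCast_mem _ _)
        (sub_mem hωR (sub_mem (intCast_mem _ _) hωR)))
    · rw [hu]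
      exact mem_integersIn_of_intLattice hk hκ0 (hΓ.u_mem hω hκ g.2) (hΓ.isIntegral g.2 hgε)
  have hall : ∀ g : Γ, f g ∈ heisIntegralIota (integersIn k) := by
    intro g
    rcases hΓ.reflection with h | ⟨w, hw⟩
    · exact hrot g (h g g.2)
    · rcases Int.units_eq_one_or (g : HeisIsom).right.right with hgε | hgε
      · exact hrot g hgε
      · set r : Γ := ⟨heisRotIota w 0 1, hw⟩ with hr
        have h1 : f r = heisRot (M * w) 0 1 * iota := by
          refine HeisIsom.ext_coords ?_ ?_ ?_ ?_
          · rw [(hfc r).1, HeisIsom.mul_z]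
            simp [heisRot, iota, hr, heisRotIota]
          · rw [(hfc r).2.1, HeisIsom.mul_t]
            simp [heisRot, iota, hr, heisRotIota]
          · rw [hu, HeisIsom.mul_u]
            simp [heisRot, iota, hr, heisRotIota]
          · rw [(hfc r).2.2.1, HeisIsom.mul_ε]
            simp [heisRot, iota, hr, heisRotIota]
        have h2 : f r ∈ heisIntegralIota (integersIn k) := by
          rw [h1]
          refine mul_mem (Subgroup.subset_closure (Or.inl ⟨hzR _ hw, ?_, ?_, rfl⟩))
            (Subgroup.subset_closure (Or.inr rfl))
          · simp [heisRot, zero_mem]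
          · simp [heisRot]
        have h3 : ((g * r⁻¹ : Γ) : HeisIsom).right.right = 1 := by
          rw [Subgroup.coe_mul, HeisIsom.mul_ε, Subgroup.coe_inv, HeisIsom.inv_ε, hgε, hr]
          simp [heisRotIota]
        have h4 := mul_mem (hrot _ h3) h2
        rwa [← map_mul, inv_mul_cancel_right] at h4
  exact ⟨f.codRestrict _ hall, fun x y hxy => hf (congrArg Subtype.val hxy)⟩

theorem IsNilLattice.embedsInIntegral {Γ : Subgroup HeisIsom} {τ : ℝ} (hΓ : IsNilLattice Γ τ) :
    EmbedsInIntegral Γ := by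
  obtain ⟨ω, hω, φ, τ', hφ, hφn⟩ := hΓ.exists_isNormalized
  refine EmbedsInIntegral.of_range hφ ?_
  have hω0 : ω.im ≠ 0 := by
    rcases hω with rfl | rfl
    · simp
    · exact zeta3_im_pos.ne'
  obtain ⟨ψ, hψ, hψc⟩ := hφn.exists_isCentered hω0
  refine EmbedsInIntegral.of_range hψ ?_
  rcases hω with rfl | rfl
  · exact ⟨gaussField, Or.inl rfl, hψc.exists_hom (p := 0) hω0 (by simp) (by simp)
      I_mem_gaussField⟩
  · exact ⟨eisensteinField, Or.inr rfl, hψc.exists_hom (p := -1) hω0 (by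
      rw [zeta3_sq]; push_cast; ring) (by rw [conj_zeta3]; push_cast; ring)
      zeta3_mem_eisensteinField⟩

/-- The fundamental group of a closed nil 3-manifold has a faithful integral representation. -/
theorem exists_integral_representation (M : Type*) [TopologicalSpace M]
    (hM : IsClosedNilThreeManifold M) (x : M) :
    ∃ k : IntermediateField ℚ ℂ, (k = gaussField ∨ k = eisensteinField) ∧
      ∃ φ : FundamentalGroup M x →* heisIntegralIota (integersIn k), Function.Injective φ := by
  obtain ⟨hcomp, Γ, hΓ, hfree, ⟨f⟩⟩ := hM
  have : CompactSpace (MulAction.orbitRel.Quotient Γ Heis) := f.compactSpace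
  obtain ⟨R, hR⟩ := exists_bound_of_compact_quotient Γ
  obtain ⟨τ, hτ⟩ := exists_center_generator Γ
  obtain ⟨l, hl, m, hm, hl1, hm1, hlm⟩ := exists_independent_translations hR
  have hnil : IsNilLattice Γ τ := ⟨hτ, _, ⟨l, hl, hl1, rfl⟩, _, ⟨m, hm, hm1, rfl⟩, hlm⟩
  obtain ⟨k, hk, φ, hφ⟩ := hnil.embedsInIntegral
  obtain ⟨ψ, hψ⟩ := exists_injective_hom_of_quotient Γ hfree f x
  exact ⟨k, hk, φ.comp ψ, hφ.comp hψ⟩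

/-! ### Faithfulness criteria -/

theorem zpow_right (g : HeisIsom) (m : ℤ) : (g ^ m).right = g.right ^ m :=
  map_zpow (SemidirectProduct.rightHom (φ := heisAut)) g m

section Extension

variable {G : Type*} [Group G] (φ : G →* HeisIsom)

/-- In a group with `[b, a] = c ^ k` and `c` central, each element has a normal form. -/
theorem exists_normalForm {a b c : G} {k : ℕ} (hba : ⁅b, a⁆ = c ^ k) (hca : ⁅c, a⁆ = 1)
    (hcb : ⁅c, b⁆ = 1) {x : G} (hx : x ∈ Subgroup.closure {a, b, c}) :
    ∃ i j l : ℤ, x = c ^ l * (a ^ i * b ^ j) := by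
  have hca' : Commute c a := commutatorElement_eq_one_iff_commute.1 hca
  have hcb' : Commute c b := commutatorElement_eq_one_iff_commute.1 hcb
  have h1 : ∀ i : ℤ, b * a ^ i = c ^ (k * i) * a ^ i * b := by
    intro i
    have h : SemiconjBy b a (c ^ (k : ℤ) * a) := by
      rw [SemiconjBy, zpow_natCast, ← hba, commutatorElement_def]
      group
    have := (h.zpow_right i).eq
    rwa [(hca'.zpow_left k).mul_zpow, ← zpow_mul] at this
  have h2 : ∀ i : ℤ, b⁻¹ * a ^ i = c ^ (-k * i : ℤ) * a ^ i * b⁻¹ := by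
    intro i
    have h3 := h1 i
    have h4 := (hcb'.zpow_left (k * i : ℤ)).eq
    rw [inv_mul_eq_iff_eq_mul, ← mul_assoc, ← mul_assoc, ← (hcb'.zpow_left (-k * i : ℤ)).eq,
      mul_assoc (c ^ (-k * i : ℤ)), h3, ← mul_assoc, ← mul_assoc, ← zpow_add]
    simp
  induction hx using Subgroup.closure_induction_left with
  | one => exact ⟨0, 0, 0, by simp⟩
  | mul_left y hy z _ ih =>
    obtain ⟨i, j, l, rfl⟩ := ih
    rcases hy with rfl | rfl | rfl
    · exact ⟨i + 1, j, l, by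
        rw [← mul_assoc, ← (hca'.zpow_left l).eq, mul_assoc, ← mul_assoc y, add_comm, zpow_one_add]⟩
    · exact ⟨i, j + 1, l + k * i, by
        rw [← mul_assoc, ← (hcb'.zpow_left l).eq, mul_assoc, ← mul_assoc y, h1, add_comm j,
          zpow_one_add, zpow_add]
        group⟩
    · exact ⟨i, j, l + 1, by rw [← mul_assoc, add_comm, zpow_one_add]⟩
  | inv_mul_cancel y hy z _ ih =>
    obtain ⟨i, j, l, rfl⟩ := ih
    rcases hy with rfl | rfl | rfl
    · exact ⟨i - 1, j, l, by
        rw [← mul_assoc, ← (hca'.inv_right.zpow_left l).eq, mul_assoc, ← mul_assoc y⁻¹,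
          sub_eq_neg_add, zpow_add, zpow_neg_one]⟩
    · exact ⟨i, j - 1, l + (-k * i), by
        rw [← mul_assoc, ← (hcb'.inv_right.zpow_left l).eq, mul_assoc, ← mul_assoc y⁻¹, h2,
          sub_eq_neg_add, zpow_add y, zpow_neg_one, zpow_add c]
        group⟩
    · exact ⟨i, j, l - 1, by rw [← mul_assoc, sub_eq_neg_add, zpow_add, zpow_neg_one]⟩

/-- A representation of the nilpotent part of the families is faithful if `a`, `b` and `c` go to
two independent translations and a nontrivial central element. -/
theorem faithful_nilpotent {a b c : G} {k : ℕ} (hba : ⁅b, a⁆ = c ^ k) (hca : ⁅c, a⁆ = 1)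
    (hcb : ⁅c, b⁆ = 1) {z w : ℂ} {T : ℝ} (hzw : (z * conj w).im ≠ 0) (hT : T ≠ 0)
    (ha : φ a = heisRot z 0 1) (hb : φ b = heisRot w 0 1) (hc : φ c = heisRot 0 T 1) :
    ∀ x ∈ Subgroup.closure {a, b, c}, (φ x).right = 1 ∧ (φ x = 1 → x = 1) := by
  intro x hx
  obtain ⟨i, j, l, rfl⟩ := exists_normalForm hba hca hcb hx
  have h : φ (c ^ l * (a ^ i * b ^ j)) = heisRot (i * z + j * w)
      (l * T + 2 * (i * z * conj (j * w)).im) 1 := by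
    rw [map_mul, map_mul, map_zpow, map_zpow, map_zpow, ha, hb, hc, heisRot_zpow, heisRot_zpow,
      heisRot_zpow]
    refine SemidirectProduct.ext (Heis.ext ?_ ?_) (by
      simp only [SemidirectProduct.mul_right, heisRot_right, mul_one])
    · rw [HeisIsom.mul_z, HeisIsom.mul_z]
      simp [heisRot]
    · rw [HeisIsom.mul_t, HeisIsom.mul_t]
      simp [heisRot]
  rw [h]
  refine ⟨rfl, fun h1 => ?_⟩
  have hz : (i : ℂ) * z + j * w = 0 := congrArg (fun g : HeisIsom => g.left.z) h1
  have ht : l * T + 2 * (i * z * conj (j * w)).im = 0 :=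
    congrArg (fun g : HeisIsom => g.left.t) h1
  have hi : (i : ℝ) * (z * conj w).im = 0 := by
    have e : (i : ℂ) * (z * conj w) = -(j * (w * conj w)) := by linear_combination conj w * hz
    rw [Complex.mul_conj w] at e
    have := congrArg Complex.im e
    simpa using this
  have hj : (j : ℝ) * (z * conj w).im = 0 := by
    have e : (j : ℂ) * (w * conj z) = -(i * (z * conj z)) := by linear_combination conj z * hz
    rw [Complex.mul_conj z] at e
    have := congrArg Complex.im e
    rw [im_mul_conj_comm]
    simp only [Complex.neg_im, Complex.mul_im (i : ℂ), Complex.mul_im (j : ℂ), Complex.intCast_re,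
      Complex.intCast_im, zero_mul, add_zero, Complex.ofReal_im, mul_zero, neg_zero] at this
    rw [mul_neg, this, neg_zero]
  have hi0 : i = 0 := by exact_mod_cast (mul_eq_zero.1 hi).resolve_right hzw
  have hj0 : j = 0 := by exact_mod_cast (mul_eq_zero.1 hj).resolve_right hzw
  subst hi0 hj0
  have hl0 : l = 0 := by
    simp only [Int.cast_zero, zero_mul, Complex.zero_im, mul_zero, add_zero] at ht
    exact_mod_cast (mul_eq_zero.1 ht).resolve_right hT
  subst hl0
  simp

/-- A representation that is faithful on a subgroup `H` stays so on the extension of `H` by an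
element `α` that normalizes `H`, if a power of `α` can go to the image of `H` only if it lies
in `H`. -/
theorem faithful_extension {S : Set G} {α : G} {M : ℕ} (hM : 0 < M)
    (hS : ∀ s ∈ S, α * s * α⁻¹ ∈ Subgroup.closure S) (hα : α ^ M ∈ Subgroup.closure S)
    (hφ : ∀ x ∈ Subgroup.closure S, φ x = 1 → x = 1)
    (hm : ∀ x ∈ Subgroup.closure S, ∀ m : ℤ, φ (x * α ^ m) = 1 → (M : ℤ) ∣ m) :
    ∀ x ∈ Subgroup.closure (insert α S), φ x = 1 → x = 1 := by
  set H := Subgroup.closure S with hH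
  have hconj : ∀ h ∈ H, α * h * α⁻¹ ∈ H := by
    have : H ≤ H.comap (MulAut.conj α).toMonoidHom := (Subgroup.closure_le _).2 hS
    exact fun h hh => this hh
  have hpow : ∀ n : ℕ, ∀ h ∈ H, α ^ n * h * (α ^ n)⁻¹ ∈ H := by
    intro n
    induction n with
    | zero => intro h hh; simpa using hh
    | succ n ih =>
      intro h hh
      have := hconj _ (ih h hh)
      rw [pow_succ', mul_inv_rev]
      simpa only [mul_assoc] using this
  -- conjugation by `α⁻¹` is conjugation by `α ^ (M - 1)`, up to an inner automorphism of `H`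
  have hinv : ∀ h ∈ H, α⁻¹ * h * α ∈ H := by
    intro h hh
    have h1 := hpow (M - 1) _ (H.mul_mem (H.mul_mem (H.inv_mem hα) hh) hα)
    have h2 : α ^ M = α * α ^ (M - 1) := by
      rw [← pow_succ']
      congr 1
      omega
    have h3 : α ^ M = α ^ (M - 1) * α := by
      rw [← pow_succ]
      congr 1
      omega
    have h4 : α ^ (M - 1) * ((α ^ M)⁻¹ * h * α ^ M) * (α ^ (M - 1))⁻¹ = α⁻¹ * h * α := by
      nth_rewrite 1 [h2]
      rw [((Commute.refl α).pow_right (M - 1)).eq, mul_inv_rev, h3,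
        ((Commute.refl α).pow_right (M - 1)).eq.symm]
      group
    rwa [h4] at h1
  have hnorm : Subgroup.zpowers α ≤ Subgroup.normalizer (H : Set G) := by
    rw [Subgroup.zpowers_le, Subgroup.mem_normalizer_iff]
    refine fun h => ⟨hconj h, fun hh => ?_⟩
    have := hinv _ hh
    simpa [mul_assoc] using this
  intro x hx h1
  rw [Set.insert_eq, Subgroup.closure_union, sup_comm, ← hH, ← Subgroup.zpowers_eq_closure,
    ← SetLike.mem_coe, Subgroup.coe_mul_of_right_le_normalizer_left _ _ hnorm] at hx
  obtain ⟨h, hh, y, ⟨m, rfl⟩, rfl⟩ := hx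
  obtain ⟨n, hn⟩ := hm h hh m h1
  refine hφ _ (H.mul_mem hh ?_) h1
  simp only
  rw [hn, zpow_mul, zpow_natCast]
  exact H.zpow_mem hα n

/-- Faithfulness of a representation of an extension of the nilpotent group by one element `α` of
the holonomy of order `M`. -/
theorem faithful_of_holonomy {a b c α : G} {k M : ℕ} (hM : 0 < M) (hba : ⁅b, a⁆ = c ^ k)
    (hca : ⁅c, a⁆ = 1) (hcb : ⁅c, b⁆ = 1)
    (hαa : α * a * α⁻¹ ∈ Subgroup.closure {a, b, c})
    (hαb : α * b * α⁻¹ ∈ Subgroup.closure {a, b, c})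
    (hαc : α * c * α⁻¹ ∈ Subgroup.closure {a, b, c})
    (hαM : α ^ M ∈ Subgroup.closure {a, b, c}) {z w : ℂ} {T : ℝ} (hzw : (z * conj w).im ≠ 0)
    (hT : T ≠ 0) (ha : φ a = heisRot z 0 1) (hb : φ b = heisRot w 0 1) (hc : φ c = heisRot 0 T 1)
    (hm : ∀ m : ℤ, (φ α).right ^ m = 1 → (M : ℤ) ∣ m) :
    ∀ x ∈ Subgroup.closure {α, a, b, c}, φ x = 1 → x = 1 := by
  have h := faithful_nilpotent φ hba hca hcb hzw hT ha hb hc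
  refine faithful_extension φ hM ?_ hαM (fun x hx => (h x hx).2) fun x hx m h1 => hm m ?_
  · rintro s (rfl | rfl | rfl)
    exacts [hαa, hαb, hαc]
  · have h2 := congrArg (·.right) h1
    simp only [map_mul, map_zpow, SemidirectProduct.mul_right, (h x hx).1, one_mul,
      zpow_right] at h2
    exact h2

end Extension

theorem dvd_of_rotation_zpow {M : ℕ} (hM : 0 < M) {θ : ℝ} (hθ : M * θ = 2 * Real.pi) {m : ℤ}
    (h : (⟨Circle.exp θ, 1⟩ : UnitaryIota) ^ m = 1) : (M : ℤ) ∣ m := by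
  have h1 : (SemidirectProduct.inl (Circle.exp θ ^ m) : UnitaryIota) = 1 := by
    rw [map_zpow]
    exact h
  have h2 : Circle.exp θ ^ m = 1 := congrArg (·.left) h1
  rw [← Circle.exp_zsmul, Circle.exp_eq_one] at h2
  obtain ⟨n, hn⟩ := h2
  refine ⟨n, ?_⟩
  have hM' : (M : ℝ) ≠ 0 := by exact_mod_cast hM.ne'
  have h3 : (m : ℝ) * (2 * Real.pi) = (M * n : ℤ) * (2 * Real.pi) := by
    rw [zsmul_eq_mul] at hn
    push_cast
    rw [← hθ]
    linear_combination (M : ℝ) * hn + M * n * (-hθ)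
  exact_mod_cast mul_right_cancel₀ (by positivity) h3

theorem two_dvd_of_reflection_zpow {u : Circle} {m : ℤ}
    (h : (⟨u, -1⟩ : UnitaryIota) ^ m = 1) : (2 : ℤ) ∣ m := by
  have h1 := congrArg (SemidirectProduct.rightHom (φ := circleConj)) h
  rw [map_zpow, map_one] at h1
  have h2 : ((-1 : ℤˣ)) ^ m = 1 := h1
  rcases Int.even_or_odd m with hm | hm
  · exact hm.two_dvd
  · rw [hm.neg_one_zpow] at h2
    exact absurd h2 (by decide)

theorem givesFaithfulRep_of {n : ℕ} {rels : Set (FreeGroup (Fin n))} {k : IntermediateField ℚ ℂ}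
    {v : Fin n → HeisIsom} (hv : ∀ i, v i ∈ heisIntegralIota (integersIn k))
    (hrel : ∀ r ∈ rels, FreeGroup.lift v r = 1)
    (hinj : ∀ φ : PresentedGroup rels →* HeisIsom, (∀ i, φ (PresentedGroup.of i) = v i) →
      ∀ x ∈ Subgroup.closure (Set.range (PresentedGroup.of (rels := rels))), φ x = 1 → x = 1) :
    GivesFaithfulRep rels k v := by
  let φ : PresentedGroup rels →* HeisIsom := PresentedGroup.toGroup hrel
  have hφ : ∀ i, φ (PresentedGroup.of i) = v i := fun i => PresentedGroup.toGroup.of hrel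
  have hall : ∀ x, φ x ∈ heisIntegralIota (integersIn k) := by
    have : (⊤ : Subgroup (PresentedGroup rels)) ≤ (heisIntegralIota (integersIn k)).comap φ := by
      rw [← PresentedGroup.closure_range_of, Subgroup.closure_le]
      rintro _ ⟨i, rfl⟩
      rw [SetLike.mem_coe, Subgroup.mem_comap, hφ]
      exact hv i
    exact fun x => this (Subgroup.mem_top x)
  refine ⟨φ.codRestrict _ hall, (injective_iff_map_eq_one _).2 fun x hx => ?_, hφ⟩
  refine hinj φ hφ x ?_ (congrArg Subtype.val hx)
  rw [PresentedGroup.closure_range_of]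
  trivial

/-! ### Arithmetic in quadratic coordinates -/

/-- The element `g` is `(x + y s i, T s, p + q s i)`, composed with `ι` if `e = -1`. For
`s = 1` and `s = √3` products are polynomial in these coordinates. -/
structure HasCoords (s : ℝ) (g : HeisIsom) (x y T p q e : ℝ) : Prop where
  z : g.left.z = ⟨x, s * y⟩
  t : g.left.t = s * T
  u : (g.right.left : ℂ) = ⟨p, s * q⟩
  ε : ((g.right.right : ℤ) : ℝ) = e

namespace HasCoords

variable {s m : ℝ} {g h : HeisIsom} {x y T p q e x' y' T' p' q' e' : ℝ}

theorem conjIf_eq {ε : ℤˣ} (hε : ((ε : ℤ) : ℝ) = e) (a b : ℝ) :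
    conjIf ε ⟨a, b⟩ = ⟨a, e * b⟩ := by
  subst hε
  rcases Int.units_eq_one_or ε with rfl | rfl <;> exact Complex.ext (by simp) (by simp)

theorem mul (hs : s ^ 2 = m) (hg : HasCoords s g x y T p q e)
    (hh : HasCoords s h x' y' T' p' q' e') :
    HasCoords s (g * h) (x + (p * x' - m * (q * (e * y')))) (y + (p * (e * y') + q * x'))
      (T + e * T' + 2 * (y * (p * x' - m * (q * (e * y'))) - x * (p * (e * y') + q * x')))
      (p * p' - m * (q * (e * q'))) (p * (e * q') + q * p') (e * e') := by
  subst hs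
  have h1 : (g.right.left : ℂ) * conjIf g.right.right h.left.z =
      ⟨p * x' - s ^ 2 * (q * (e * y')), s * (p * (e * y') + q * x')⟩ := by
    rw [hg.u, hh.z, conjIf_eq hg.ε]
    exact Complex.ext (by simp; ring) (by simp; ring)
  refine ⟨?_, ?_, ?_, ?_⟩
  · rw [HeisIsom.mul_z, h1, hg.z]
    exact Complex.ext (by simp) (by simp; ring)
  · rw [HeisIsom.mul_t, h1, hg.z, hg.t, hg.ε, hh.t]
    simp
    ring
  · have h2 : ((h.right.left ^ (g.right.right : ℤ) : Circle) : ℂ) = ⟨p', s * (e * q')⟩ := by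
      have h3 : ((h.right.left ^ (g.right.right : ℤ) : Circle) : ℂ) =
          conjIf g.right.right h.right.left := by
        rcases Int.units_eq_one_or g.right.right with h | h <;> simp [h, conj_circle]
      rw [h3, hh.u, conjIf_eq hg.ε]
      exact Complex.ext rfl (by simp; ring)
    rw [HeisIsom.mul_u, Circle.coe_mul, h2, hg.u]
    exact Complex.ext (by simp; ring) (by simp; ring)
  · rw [HeisIsom.mul_ε, Units.val_mul, Int.cast_mul, hg.ε, hh.ε]

theorem unique (hg : HasCoords s g x y T p q e) (hh : HasCoords s h x' y' T' p' q' e')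
    (hx : x = x') (hy : y = y') (hT : T = T') (hp : p = p') (hq : q = q') (he : e = e') :
    g = h := by
  subst hx hy hT hp hq he
  refine HeisIsom.ext_coords (hg.z.trans hh.z.symm) (hg.t.trans hh.t.symm)
    (hg.u.trans hh.u.symm) (Units.ext ?_)
  exact_mod_cast hg.ε.trans hh.ε.symm

theorem translation {z : ℂ} {t : ℝ} (hz : z = ⟨x, s * y⟩) (ht : t = s * T) :
    HasCoords s (heisRot z t 1) x y T 1 0 1 :=
  ⟨hz, ht, Complex.ext (by simp [heisRot]) (by simp [heisRot]), by simp [heisRot]⟩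

theorem translation_inv {z : ℂ} {t : ℝ} (hz : z = ⟨x, s * y⟩) (ht : t = s * T) :
    HasCoords s (heisRot z t 1)⁻¹ (-x) (-y) (-T) 1 0 1 := by
  have h := heisRot_zpow z t (-1)
  rw [zpow_neg_one] at h
  rw [h]
  refine translation ?_ ?_
  · rw [hz]
    exact Complex.ext (by simp) (by simp)
  · rw [ht]
    simp

theorem central_pow {t : ℝ} (ht : t = s * T) (n : ℕ) :
    HasCoords s (heisRot 0 t 1 ^ n) 0 0 (n * T) 1 0 1 := by
  have h := heisRot_zpow 0 t n
  rw [zpow_natCast] at h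
  rw [h]
  refine translation ?_ ?_
  · exact Complex.ext (by simp) (by simp)
  · rw [ht]
    simp
    ring

theorem central_pow_inv {t : ℝ} (ht : t = s * T) (n : ℕ) :
    HasCoords s (heisRot 0 t 1 ^ n)⁻¹ 0 0 (-(n * T)) 1 0 1 := by
  have h := heisRot_zpow 0 t (-n)
  rw [zpow_neg, zpow_natCast] at h
  rw [h]
  refine translation ?_ ?_
  · exact Complex.ext (by simp) (by simp)
  · rw [ht]
    simp
    ring

end HasCoords

/-! ### The relations of the seven families -/


theorem nilRels1_iff {G : Type*} [Group G] {k : ℕ} {f : FreeGroup (Fin 3) →* G}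
    {a b c : G} (ha : f (FreeGroup.of 0) = a) (hb : f (FreeGroup.of 1) = b)
    (hc : f (FreeGroup.of 2) = c) :
    (∀ r ∈ nilRels1 k, f r = 1) ↔
      ⁅b, a⁆ = c ^ k ∧ ⁅c, a⁆ = 1 ∧ ⁅c, b⁆ = 1 := by
  simp only [nilRels1, Set.mem_insert_iff, Set.mem_singleton_iff, forall_eq_or_imp, forall_eq,
    map_mul, map_inv, map_pow, map_commutatorElement, ha, hb, hc, mul_inv_eq_one]

theorem nilRels2_iff {G : Type*} [Group G] {k : ℕ} {f : FreeGroup (Fin 4) →* G}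
    {a b c α : G} (ha : f (FreeGroup.of 0) = a) (hb : f (FreeGroup.of 1) = b)
    (hc : f (FreeGroup.of 2) = c) (hd : f (FreeGroup.of 3) = α) :
    (∀ r ∈ nilRels2 k, f r = 1) ↔
      ⁅b, a⁆ = c ^ k ∧ ⁅c, a⁆ = 1 ∧ ⁅c, b⁆ = 1 ∧ ⁅α, c⁆ = 1 ∧ α * a = a⁻¹ * α ∧ α * b = b⁻¹ * α ∧
      α ^ 2 = c := by
  simp only [nilRels2, Set.mem_insert_iff, Set.mem_singleton_iff, forall_eq_or_imp, forall_eq,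
    map_mul, map_inv, map_pow, map_commutatorElement, ha, hb, hc, hd, mul_inv_eq_one]

theorem nilRels3_iff {G : Type*} [Group G] {k : ℕ} {f : FreeGroup (Fin 4) →* G}
    {a b c α : G} (ha : f (FreeGroup.of 0) = a) (hb : f (FreeGroup.of 1) = b)
    (hc : f (FreeGroup.of 2) = c) (hd : f (FreeGroup.of 3) = α) :
    (∀ r ∈ nilRels3 k, f r = 1) ↔
      ⁅b, a⁆ = c ^ (2 * k) ∧ ⁅c, a⁆ = 1 ∧ ⁅c, b⁆ = 1 ∧ ⁅a, α⁆ = 1 ∧ α * c = c⁻¹ * α ∧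
      α * b = b⁻¹ * α * (c ^ k)⁻¹ ∧ α ^ 2 = a := by
  simp only [nilRels3, Set.mem_insert_iff, Set.mem_singleton_iff, forall_eq_or_imp, forall_eq,
    map_mul, map_inv, map_pow, map_commutatorElement, ha, hb, hc, hd, mul_inv_eq_one]

theorem nilRels4_iff {G : Type*} [Group G] {k : ℕ} {f : FreeGroup (Fin 5) →* G}
    {a b c α β : G} (ha : f (FreeGroup.of 0) = a) (hb : f (FreeGroup.of 1) = b)
    (hc : f (FreeGroup.of 2) = c) (hd : f (FreeGroup.of 3) = α) (hf : f (FreeGroup.of 4) = β) :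
    (∀ r ∈ nilRels4 k, f r = 1) ↔
      ⁅b, a⁆ = c ^ (2 * k) ∧ ⁅c, a⁆ = 1 ∧ ⁅c, b⁆ = 1 ∧ ⁅c, α⁆ = 1 ∧ ⁅a, β⁆ = 1 ∧
      β * c = c⁻¹ * β ∧ α * a = a⁻¹ * α * c ^ k ∧ α * b = b⁻¹ * α * (c ^ k)⁻¹ ∧ α ^ 2 = c ∧
      β ^ 2 = a ∧ β * b = b⁻¹ * β * (c ^ k)⁻¹ ∧ α * β = a⁻¹ * b⁻¹ * β * α * (c ^ (k + 1))⁻¹ := by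
  simp only [nilRels4, Set.mem_insert_iff, Set.mem_singleton_iff, forall_eq_or_imp, forall_eq,
    map_mul, map_inv, map_pow, map_commutatorElement, ha, hb, hc, hd, hf, mul_inv_eq_one]

theorem nilRels5_iff {G : Type*} [Group G] {k p : ℕ} {f : FreeGroup (Fin 4) →* G}
    {a b c α : G} (ha : f (FreeGroup.of 0) = a) (hb : f (FreeGroup.of 1) = b)
    (hc : f (FreeGroup.of 2) = c) (hd : f (FreeGroup.of 3) = α) :
    (∀ r ∈ nilRels5 k p, f r = 1) ↔
      ⁅b, a⁆ = c ^ k ∧ ⁅c, a⁆ = 1 ∧ ⁅c, b⁆ = 1 ∧ ⁅c, α⁆ = 1 ∧ α * a = b * α ∧ α * b = a⁻¹ * α ∧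
      α ^ 4 = c ^ p := by
  simp only [nilRels5, Set.mem_insert_iff, Set.mem_singleton_iff, forall_eq_or_imp, forall_eq,
    map_mul, map_inv, map_pow, map_commutatorElement, ha, hb, hc, hd, mul_inv_eq_one]

theorem nilRels6_iff {G : Type*} [Group G] {k k₁ k₂ : ℕ} {f : FreeGroup (Fin 4) →* G}
    {a b c α : G} (ha : f (FreeGroup.of 0) = a) (hb : f (FreeGroup.of 1) = b)
    (hc : f (FreeGroup.of 2) = c) (hd : f (FreeGroup.of 3) = α) :
    (∀ r ∈ nilRels6 k k₁ k₂, f r = 1) ↔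
      ⁅b, a⁆ = c ^ k ∧ ⁅c, a⁆ = 1 ∧ ⁅c, b⁆ = 1 ∧ ⁅c, α⁆ = 1 ∧ α * a = b * α * c ^ k₁ ∧
      α * b = a⁻¹ * b⁻¹ * α ∧ α ^ 3 = c ^ k₂ := by
  simp only [nilRels6, Set.mem_insert_iff, Set.mem_singleton_iff, forall_eq_or_imp, forall_eq,
    map_mul, map_inv, map_pow, map_commutatorElement, ha, hb, hc, hd, mul_inv_eq_one]

theorem nilRels7_iff {G : Type*} [Group G] {k k₁ : ℕ} {f : FreeGroup (Fin 4) →* G}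
    {a b c α : G} (ha : f (FreeGroup.of 0) = a) (hb : f (FreeGroup.of 1) = b)
    (hc : f (FreeGroup.of 2) = c) (hd : f (FreeGroup.of 3) = α) :
    (∀ r ∈ nilRels7 k k₁, f r = 1) ↔
      ⁅b, a⁆ = c ^ k ∧ ⁅c, a⁆ = 1 ∧ ⁅c, b⁆ = 1 ∧ ⁅c, α⁆ = 1 ∧ α * a = a * b * α ∧
      α * b = a⁻¹ * α ∧ α ^ 6 = c ^ k₁ := by
  simp only [nilRels7, Set.mem_insert_iff, Set.mem_singleton_iff, forall_eq_or_imp, forall_eq,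
    map_mul, map_inv, map_pow, map_commutatorElement, ha, hb, hc, hd, mul_inv_eq_one]

theorem commutator_eq_of_mul {G : Type*} [Group G] {x y z : G} (h : x * y = z * (y * x)) :
    ⁅x, y⁆ = z := by
  rw [commutatorElement_def, h]
  group

theorem commutator_eq_one_of_mul {G : Type*} [Group G] {x y : G} (h : x * y = y * x) :
    ⁅x, y⁆ = 1 := commutator_eq_of_mul (by rw [h, one_mul])

theorem conj_mem_of_mul {G : Type*} [Group G] {H : Subgroup G} {α b x y : G}
    (h : α * b = x * α * y) (hx : x ∈ H) (hy : α * y * α⁻¹ ∈ H) : α * b * α⁻¹ ∈ H := by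
  have : α * b * α⁻¹ = x * (α * y * α⁻¹) := by
    rw [h]
    group
  rw [this]
  exact H.mul_mem hx hy

theorem conj_mem_of_mul' {G : Type*} [Group G] {H : Subgroup G} {α b x : G}
    (h : α * b = x * α) (hx : x ∈ H) : α * b * α⁻¹ ∈ H := by
  rwa [h, mul_inv_cancel_right]

theorem conj_pow_mem {G : Type*} [Group G] {H : Subgroup G} {α c : G} (h : α * c * α⁻¹ ∈ H)
    (n : ℕ) : α * c ^ n * α⁻¹ ∈ H := by
  rw [← conj_pow]
  exact H.pow_mem h n

theorem conj_pow_inv_mem {G : Type*} [Group G] {H : Subgroup G} {α c : G} (h : α * c * α⁻¹ ∈ H)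
    (n : ℕ) : α * (c ^ n)⁻¹ * α⁻¹ ∈ H := by
  have : α * (c ^ n)⁻¹ * α⁻¹ = (α * c ^ n * α⁻¹)⁻¹ := by group
  rw [this]
  exact H.inv_mem (conj_pow_mem h n)

theorem range_fin_three {G : Type*} (f : Fin 3 → G) : Set.range f = {f 0, f 1, f 2} := by
  ext x
  simp only [Set.mem_range, Set.mem_insert_iff, Set.mem_singleton_iff, Fin.exists_fin_succ,
    IsEmpty.exists_iff, or_false, eq_comm (a := x)]
  rfl

theorem range_fin_four {G : Type*} (f : Fin 4 → G) : Set.range f = {f 3, f 0, f 1, f 2} := by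
  ext x
  constructor
  · rintro ⟨i, rfl⟩
    fin_cases i <;> simp
  · rintro (rfl | rfl | rfl | rfl) <;> exact ⟨_, rfl⟩

theorem range_fin_five {G : Type*} (f : Fin 5 → G) :
    Set.range f = {f 4, f 3, f 0, f 1, f 2} := by
  ext x
  constructor
  · rintro ⟨i, rfl⟩
    fin_cases i <;> simp
  · rintro (rfl | rfl | rfl | rfl | rfl) <;> exact ⟨_, rfl⟩

theorem mem_closure_triple {G : Type*} [Group G] (a b c : G) :
    a ∈ Subgroup.closure {a, b, c} ∧ b ∈ Subgroup.closure {a, b, c} ∧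
      c ∈ Subgroup.closure {a, b, c} :=
  ⟨Subgroup.subset_closure (by simp), Subgroup.subset_closure (by simp),
    Subgroup.subset_closure (by simp)⟩

/-! ### Integral elements -/

theorem heisRot_mem {k : IntermediateField ℚ ℂ} {ω z : ℂ} {t : ℝ} {u : Circle}
    (hω : ω ∈ integersIn k) (hz : z ∈ intLattice ω) (ht : (t : ℂ) * Complex.I ∈ intLattice ω)
    (hu : (u : ℂ) ∈ intLattice ω) : heisRot z t u ∈ heisIntegralIota (integersIn k) :=
  Subgroup.subset_closure (Or.inl ⟨intLattice_subset hω hz, intLattice_subset hω ht,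
    intLattice_subset hω hu, rfl⟩)

theorem heisRotIota_mem {k : IntermediateField ℚ ℂ} {ω z : ℂ} {t : ℝ} (hω : ω ∈ integersIn k)
    (hz : z ∈ intLattice ω) (ht : (t : ℂ) * Complex.I ∈ intLattice ω) :
    heisRotIota z t 1 ∈ heisIntegralIota (integersIn k) := by
  have h : heisRotIota z t 1 = heisRot z t 1 * iota := by
    refine HeisIsom.ext_coords ?_ ?_ ?_ ?_
    · rw [HeisIsom.mul_z]
      simp [heisRot, iota, heisRotIota]
    · rw [HeisIsom.mul_t]
      simp [heisRot, iota, heisRotIota]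
    · rw [HeisIsom.mul_u]
      simp [heisRot, iota, heisRotIota]
    · rw [HeisIsom.mul_ε]
      simp [heisRot, iota, heisRotIota]
  rw [h]
  exact mul_mem (heisRot_mem hω hz ht ⟨1, 0, by simp⟩) (Subgroup.subset_closure (Or.inr rfl))

theorem I_mem_integersIn : Complex.I ∈ integersIn gaussField :=
  mem_integersIn I_mem_gaussField (isIntegral_of_sq (p := 0) (by simp))

theorem zeta3_mem_integersIn : zeta3 ∈ integersIn eisensteinField :=
  mem_integersIn zeta3_mem_eisensteinField
    (isIntegral_of_sq (p := -1) (by rw [zeta3_sq]; push_cast; ring))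

theorem circle_exp_eq (θ : ℝ) : (Circle.exp θ : ℂ) = ⟨Real.cos θ, Real.sin θ⟩ := by
  rw [Circle.coe_exp, Complex.exp_mul_I]
  exact Complex.ext (by simp [Complex.cos_ofReal_re]) (by simp [Complex.sin_ofReal_re])

theorem circle_exp_pi : (Circle.exp Real.pi : ℂ) = -1 := by
  rw [circle_exp_eq, Real.cos_pi, Real.sin_pi]
  exact Complex.ext (by simp) (by simp)

theorem circle_exp_pi_div_two : (Circle.exp (Real.pi / 2) : ℂ) = Complex.I := by
  rw [circle_exp_eq, Real.cos_pi_div_two, Real.sin_pi_div_two]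
  rfl

theorem circle_exp_pi_div_three :
    (Circle.exp (Real.pi / 3) : ℂ) = ⟨1 / 2, Real.sqrt 3 * (1 / 2)⟩ := by
  rw [circle_exp_eq, Real.cos_pi_div_three, Real.sin_pi_div_three, div_eq_mul_one_div (√3)]

theorem circle_exp_two_pi_div_three :
    (Circle.exp (2 * Real.pi / 3) : ℂ) = ⟨-1 / 2, Real.sqrt 3 * (1 / 2)⟩ := by
  have h : 2 * Real.pi / 3 = Real.pi - Real.pi / 3 := by ring
  rw [circle_exp_eq, h, Real.cos_pi_sub, Real.sin_pi_sub, Real.cos_pi_div_three,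
    Real.sin_pi_div_three, div_eq_mul_one_div (√3), neg_div]

theorem zeta3_eq : zeta3 = ⟨-1 / 2, Real.sqrt 3 * (1 / 2)⟩ := by
  rw [zeta3]
  exact Complex.ext (by simp) (by simp [div_eq_mul_inv])

theorem sqrt_three_mul_I : ((Real.sqrt 3 : ℝ) : ℂ) * Complex.I = 1 + 2 * zeta3 := by
  rw [zeta3]
  push_cast
  ring

theorem HasCoords.rotation {s x y T p q : ℝ} {z : ℂ} {t : ℝ} {u : Circle} (hz : z = ⟨x, s * y⟩)
    (ht : t = s * T) (hu : (u : ℂ) = ⟨p, s * q⟩) : HasCoords s (heisRot z t u) x y T p q 1 :=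
  ⟨hz, ht, hu, by simp [heisRot]⟩

theorem HasCoords.reflection {s x y T : ℝ} {z : ℂ} {t : ℝ} (hz : z = ⟨x, s * y⟩)
    (ht : t = s * T) : HasCoords s (heisRotIota z t 1) x y T 1 0 (-1) :=
  ⟨hz, ht, Complex.ext (by simp [heisRotIota]) (by simp [heisRotIota]), by simp [heisRotIota]⟩

/-! ### The representations of the seven families -/

theorem givesFaithfulRep_one {k : ℕ} (hk : 0 < k) : GivesFaithfulRep (nilRels1 k) gaussField
    ![heisRot (2 * k) 0 1, heisRot (2 * k * Complex.I) 0 1, heisRot 0 (16 * k) 1] := by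
  have hk' : (k : ℝ) ≠ 0 := by exact_mod_cast hk.ne'
  have hs : (1 : ℝ) ^ 2 = 1 := one_pow 2
  have A : HasCoords 1 (heisRot (2 * k) 0 1) (2 * k) 0 0 1 0 1 :=
    .translation (Complex.ext (by simp) (by simp)) (by simp)
  have B : HasCoords 1 (heisRot (2 * k * Complex.I) 0 1) 0 (2 * k) 0 1 0 1 :=
    .translation (Complex.ext (by simp) (by simp)) (by simp)
  have hct : (16 * k : ℝ) = 1 * (16 * k) := by simp
  have C := HasCoords.translation (z := 0) (x := 0) (y := 0) (Complex.ext (by simp) (by simp)) hct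
  refine givesFaithfulRep_of ?_ ?_ ?_
  · have hc : (((16 * k : ℝ) : ℂ)) * Complex.I ∈ intLattice Complex.I :=
      ⟨0, 16 * k, by push_cast; ring⟩
    have h0 : ((0 : ℝ) : ℂ) * Complex.I ∈ intLattice Complex.I := ⟨0, 0, by simp⟩
    have h1 : ((1 : Circle) : ℂ) ∈ intLattice Complex.I := ⟨1, 0, by simp⟩
    intro i
    fin_cases i
    · exact heisRot_mem I_mem_integersIn ⟨2 * k, 0, by push_cast; ring⟩ h0 h1
    · exact heisRot_mem I_mem_integersIn ⟨0, 2 * k, by push_cast; ring⟩ h0 h1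
    · exact heisRot_mem I_mem_integersIn ⟨0, 0, by simp⟩ hc h1
  · rw [nilRels1_iff FreeGroup.lift_apply_of FreeGroup.lift_apply_of FreeGroup.lift_apply_of]
    refine ⟨commutator_eq_of_mul ?_, commutator_eq_one_of_mul ?_, commutator_eq_one_of_mul ?_⟩
    · refine (B.mul hs A).unique ((HasCoords.central_pow hct k).mul hs (A.mul hs B)) ?_ ?_ ?_ ?_ ?_
        ?_ <;> ring
    · refine (C.mul hs A).unique (A.mul hs C) ?_ ?_ ?_ ?_ ?_ ?_ <;> ring
    · refine (C.mul hs B).unique (B.mul hs C) ?_ ?_ ?_ ?_ ?_ ?_ <;> ring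
  · intro φ hφ
    obtain ⟨h1, h2, h3⟩ := (nilRels1_iff (f := PresentedGroup.mk (nilRels1 k)) rfl rfl rfl).1
      fun r hr => PresentedGroup.one_of_mem hr
    rw [range_fin_three]
    refine fun x hx => (faithful_nilpotent φ h1 h2 h3 ?_ ?_ (hφ 0) (hφ 1) (hφ 2) x hx).2
    · simp [hk']
    · positivity

theorem givesFaithfulRep_two {k : ℕ} (hk : 0 < k) : GivesFaithfulRep (nilRels2 k) gaussField
    ![heisRot (2 * k) 0 1, heisRot (2 * k * Complex.I) 0 1, heisRot 0 (16 * k) 1,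
      heisRot 0 (8 * k) (Circle.exp Real.pi)] := by
  have hk' : (k : ℝ) ≠ 0 := by exact_mod_cast hk.ne'
  have hs : (1 : ℝ) ^ 2 = 1 := one_pow 2
  have haz : (2 * k : ℂ) = ⟨2 * k, 1 * 0⟩ := Complex.ext (by simp) (by simp)
  have hbz : (2 * k * Complex.I : ℂ) = ⟨0, 1 * (2 * k)⟩ := Complex.ext (by simp) (by simp)
  have h0z : (0 : ℂ) = ⟨0, 1 * 0⟩ := Complex.ext (by simp) (by simp)
  have h0t : (0 : ℝ) = 1 * 0 := by simp
  have hct : (16 * k : ℝ) = 1 * (16 * k) := by simp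
  have A := HasCoords.translation haz h0t
  have B := HasCoords.translation hbz h0t
  have C := HasCoords.translation h0z hct
  have Al : HasCoords 1 (heisRot 0 (8 * k) (Circle.exp Real.pi)) 0 0 (8 * k) (-1) 0 1 :=
    .rotation h0z (by simp) (by rw [circle_exp_pi]; exact Complex.ext (by simp) (by simp))
  refine givesFaithfulRep_of ?_ ?_ ?_
  · have h0 : ((0 : ℝ) : ℂ) * Complex.I ∈ intLattice Complex.I := ⟨0, 0, by simp⟩
    have h1 : ((1 : Circle) : ℂ) ∈ intLattice Complex.I := ⟨1, 0, by simp⟩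
    intro i
    fin_cases i
    · exact heisRot_mem I_mem_integersIn ⟨2 * k, 0, by push_cast; ring⟩ h0 h1
    · exact heisRot_mem I_mem_integersIn ⟨0, 2 * k, by push_cast; ring⟩ h0 h1
    · exact heisRot_mem I_mem_integersIn ⟨0, 0, by simp⟩ ⟨0, 16 * k, by push_cast; ring⟩ h1
    · exact heisRot_mem I_mem_integersIn ⟨0, 0, by simp⟩ ⟨0, 8 * k, by push_cast; ring⟩
        ⟨-1, 0, by rw [circle_exp_pi]; simp⟩
  · rw [nilRels2_iff FreeGroup.lift_apply_of FreeGroup.lift_apply_of FreeGroup.lift_apply_of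
      FreeGroup.lift_apply_of]
    refine ⟨commutator_eq_of_mul ?_, commutator_eq_one_of_mul ?_, commutator_eq_one_of_mul ?_,
      commutator_eq_one_of_mul ?_, ?_, ?_, ?_⟩
    · refine (B.mul hs A).unique ((HasCoords.central_pow hct k).mul hs (A.mul hs B)) ?_ ?_ ?_ ?_ ?_
        ?_ <;> ring
    · refine (C.mul hs A).unique (A.mul hs C) ?_ ?_ ?_ ?_ ?_ ?_ <;> ring
    · refine (C.mul hs B).unique (B.mul hs C) ?_ ?_ ?_ ?_ ?_ ?_ <;> ring
    · refine (Al.mul hs C).unique (C.mul hs Al) ?_ ?_ ?_ ?_ ?_ ?_ <;> ring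
    · refine (Al.mul hs A).unique ((HasCoords.translation_inv haz h0t).mul hs Al)
        ?_ ?_ ?_ ?_ ?_ ?_ <;> ring
    · refine (Al.mul hs B).unique ((HasCoords.translation_inv hbz h0t).mul hs Al)
        ?_ ?_ ?_ ?_ ?_ ?_ <;> ring
    · rw [pow_two]
      refine (Al.mul hs Al).unique C ?_ ?_ ?_ ?_ ?_ ?_ <;> ring
  · intro φ hφ
    obtain ⟨h1, h2, h3, h4, h5, h6, h7⟩ :=
      (nilRels2_iff (f := PresentedGroup.mk (nilRels2 k)) rfl rfl rfl rfl).1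
        fun r hr => PresentedGroup.one_of_mem hr
    obtain ⟨ha, hb, hc⟩ := mem_closure_triple (PresentedGroup.of (rels := nilRels2 k) 0)
      (PresentedGroup.of 1) (PresentedGroup.of 2)
    rw [range_fin_four]
    refine faithful_of_holonomy φ (M := 2) two_pos h1 h2 h3
      (conj_mem_of_mul' h5 (inv_mem ha)) (conj_mem_of_mul' h6 (inv_mem hb))
      (conj_mem_of_mul' (commutatorElement_eq_one_iff_mul_comm.1 h4) hc)
      (Set.mem_of_eq_of_mem h7 hc) ?_ ?_ (hφ 0) (hφ 1) (hφ 2) fun m hm => ?_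
    · simp [hk']
    · positivity
    · rw [hφ] at hm
      exact dvd_of_rotation_zpow two_pos (by push_cast; ring) hm

theorem givesFaithfulRep_three {k : ℕ} (hk : 0 < k) : GivesFaithfulRep (nilRels3 k) gaussField
    ![heisRot (4 * k) 0 1, heisRot (4 * k * Complex.I) 0 1, heisRot 0 (32 * k) 1,
      heisRotIota (2 * k) 0 1] := by
  have hk' : (k : ℝ) ≠ 0 := by exact_mod_cast hk.ne'
  have hs : (1 : ℝ) ^ 2 = 1 := one_pow 2
  have haz : (4 * k : ℂ) = ⟨4 * k, 1 * 0⟩ := Complex.ext (by simp) (by simp)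
  have hbz : (4 * k * Complex.I : ℂ) = ⟨0, 1 * (4 * k)⟩ := Complex.ext (by simp) (by simp)
  have h0z : (0 : ℂ) = ⟨0, 1 * 0⟩ := Complex.ext (by simp) (by simp)
  have h0t : (0 : ℝ) = 1 * 0 := by simp
  have hct : (32 * k : ℝ) = 1 * (32 * k) := by simp
  have A := HasCoords.translation haz h0t
  have B := HasCoords.translation hbz h0t
  have C := HasCoords.translation h0z hct
  have Al : HasCoords 1 (heisRotIota (2 * k) 0 1) (2 * k) 0 0 1 0 (-1) :=
    .reflection (Complex.ext (by simp) (by simp)) h0t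
  refine givesFaithfulRep_of ?_ ?_ ?_
  · have h0 : ((0 : ℝ) : ℂ) * Complex.I ∈ intLattice Complex.I := ⟨0, 0, by simp⟩
    have h1 : ((1 : Circle) : ℂ) ∈ intLattice Complex.I := ⟨1, 0, by simp⟩
    intro i
    fin_cases i
    · exact heisRot_mem I_mem_integersIn ⟨4 * k, 0, by push_cast; ring⟩ h0 h1
    · exact heisRot_mem I_mem_integersIn ⟨0, 4 * k, by push_cast; ring⟩ h0 h1
    · exact heisRot_mem I_mem_integersIn ⟨0, 0, by simp⟩ ⟨0, 32 * k, by push_cast; ring⟩ h1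
    · exact heisRotIota_mem I_mem_integersIn ⟨2 * k, 0, by push_cast; ring⟩ h0
  · rw [nilRels3_iff FreeGroup.lift_apply_of FreeGroup.lift_apply_of FreeGroup.lift_apply_of
      FreeGroup.lift_apply_of]
    refine ⟨commutator_eq_of_mul ?_, commutator_eq_one_of_mul ?_, commutator_eq_one_of_mul ?_,
      commutator_eq_one_of_mul ?_, ?_, ?_, ?_⟩
    · refine (B.mul hs A).unique ((HasCoords.central_pow hct (2 * k)).mul hs (A.mul hs B))
        ?_ ?_ ?_ ?_ ?_ ?_ <;> push_cast <;> ring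
    · refine (C.mul hs A).unique (A.mul hs C) ?_ ?_ ?_ ?_ ?_ ?_ <;> ring
    · refine (C.mul hs B).unique (B.mul hs C) ?_ ?_ ?_ ?_ ?_ ?_ <;> ring
    · refine (A.mul hs Al).unique (Al.mul hs A) ?_ ?_ ?_ ?_ ?_ ?_ <;> ring
    · refine (Al.mul hs C).unique ((HasCoords.translation_inv h0z hct).mul hs Al)
        ?_ ?_ ?_ ?_ ?_ ?_ <;> ring
    · refine (Al.mul hs B).unique (((HasCoords.translation_inv hbz h0t).mul hs Al).mul hs
        (HasCoords.central_pow_inv hct k)) ?_ ?_ ?_ ?_ ?_ ?_ <;> ring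
    · rw [pow_two]
      refine (Al.mul hs Al).unique A ?_ ?_ ?_ ?_ ?_ ?_ <;> ring
  · intro φ hφ
    obtain ⟨h1, h2, h3, h4, h5, h6, h7⟩ :=
      (nilRels3_iff (f := PresentedGroup.mk (nilRels3 k)) rfl rfl rfl rfl).1
        fun r hr => PresentedGroup.one_of_mem hr
    obtain ⟨ha, hb, hc⟩ := mem_closure_triple (PresentedGroup.of (rels := nilRels3 k) 0)
      (PresentedGroup.of 1) (PresentedGroup.of 2)
    have hαc := conj_mem_of_mul' h5 (inv_mem hc)
    rw [range_fin_four]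
    refine faithful_of_holonomy φ (M := 2) two_pos h1 h2 h3
      (conj_mem_of_mul' (commutatorElement_eq_one_iff_mul_comm.1 h4).symm ha)
      (conj_mem_of_mul h6 (inv_mem hb) (conj_pow_inv_mem hαc k)) hαc
      (Set.mem_of_eq_of_mem h7 ha) ?_ ?_ (hφ 0) (hφ 1) (hφ 2) fun m hm => ?_
    · simp [hk']
    · positivity
    · rw [hφ] at hm
      exact two_dvd_of_reflection_zpow hm

theorem givesFaithfulRep_four {k : ℕ} (hk : 0 < k) : GivesFaithfulRep (nilRels4 k) gaussField
    ![heisRot (4 * k) 0 1, heisRot (4 * k * Complex.I) 0 1, heisRot 0 (32 * k) 1,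
      heisRot (-(2 * k) - 2 * k * Complex.I) (16 * k) (Circle.exp Real.pi),
      heisRotIota (2 * k) 0 1] := by
  have hk' : (k : ℝ) ≠ 0 := by exact_mod_cast hk.ne'
  have hs : (1 : ℝ) ^ 2 = 1 := one_pow 2
  have haz : (4 * k : ℂ) = ⟨4 * k, 1 * 0⟩ := Complex.ext (by simp) (by simp)
  have hbz : (4 * k * Complex.I : ℂ) = ⟨0, 1 * (4 * k)⟩ := Complex.ext (by simp) (by simp)
  have h0z : (0 : ℂ) = ⟨0, 1 * 0⟩ := Complex.ext (by simp) (by simp)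
  have h0t : (0 : ℝ) = 1 * 0 := by simp
  have hct : (32 * k : ℝ) = 1 * (32 * k) := by simp
  have A := HasCoords.translation haz h0t
  have B := HasCoords.translation hbz h0t
  have C := HasCoords.translation h0z hct
  have A' := HasCoords.translation_inv haz h0t
  have B' := HasCoords.translation_inv hbz h0t
  have Al : HasCoords 1 (heisRot (-(2 * k) - 2 * k * Complex.I) (16 * k) (Circle.exp Real.pi))
      (-(2 * k)) (-(2 * k)) (16 * k) (-1) 0 1 :=
    .rotation (Complex.ext (by simp) (by simp)) (by simp)
      (by rw [circle_exp_pi]; exact Complex.ext (by simp) (by simp))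
  have Be : HasCoords 1 (heisRotIota (2 * k) 0 1) (2 * k) 0 0 1 0 (-1) :=
    .reflection (Complex.ext (by simp) (by simp)) h0t
  refine givesFaithfulRep_of ?_ ?_ ?_
  · have h0 : ((0 : ℝ) : ℂ) * Complex.I ∈ intLattice Complex.I := ⟨0, 0, by simp⟩
    have h1 : ((1 : Circle) : ℂ) ∈ intLattice Complex.I := ⟨1, 0, by simp⟩
    intro i
    fin_cases i
    · exact heisRot_mem I_mem_integersIn ⟨4 * k, 0, by push_cast; ring⟩ h0 h1
    · exact heisRot_mem I_mem_integersIn ⟨0, 4 * k, by push_cast; ring⟩ h0 h1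
    · exact heisRot_mem I_mem_integersIn ⟨0, 0, by simp⟩ ⟨0, 32 * k, by push_cast; ring⟩ h1
    · exact heisRot_mem I_mem_integersIn ⟨-(2 * k), -(2 * k), by push_cast; ring⟩
        ⟨0, 16 * k, by push_cast; ring⟩ ⟨-1, 0, by rw [circle_exp_pi]; simp⟩
    · exact heisRotIota_mem I_mem_integersIn ⟨2 * k, 0, by push_cast; ring⟩ h0
  · rw [nilRels4_iff FreeGroup.lift_apply_of FreeGroup.lift_apply_of FreeGroup.lift_apply_of
      FreeGroup.lift_apply_of FreeGroup.lift_apply_of]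
    refine ⟨commutator_eq_of_mul ?_, commutator_eq_one_of_mul ?_, commutator_eq_one_of_mul ?_,
      commutator_eq_one_of_mul ?_, commutator_eq_one_of_mul ?_, ?_, ?_, ?_, ?_, ?_, ?_, ?_⟩
    · refine (B.mul hs A).unique ((HasCoords.central_pow hct (2 * k)).mul hs (A.mul hs B))
        ?_ ?_ ?_ ?_ ?_ ?_ <;> push_cast <;> ring
    · refine (C.mul hs A).unique (A.mul hs C) ?_ ?_ ?_ ?_ ?_ ?_ <;> ring
    · refine (C.mul hs B).unique (B.mul hs C) ?_ ?_ ?_ ?_ ?_ ?_ <;> ring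
    · refine (C.mul hs Al).unique (Al.mul hs C) ?_ ?_ ?_ ?_ ?_ ?_ <;> ring
    · refine (A.mul hs Be).unique (Be.mul hs A) ?_ ?_ ?_ ?_ ?_ ?_ <;> ring
    · refine (Be.mul hs C).unique ((HasCoords.translation_inv h0z hct).mul hs Be)
        ?_ ?_ ?_ ?_ ?_ ?_ <;> ring
    · refine (Al.mul hs A).unique ((A'.mul hs Al).mul hs (HasCoords.central_pow hct k))
        ?_ ?_ ?_ ?_ ?_ ?_ <;> ring
    · refine (Al.mul hs B).unique ((B'.mul hs Al).mul hs (HasCoords.central_pow_inv hct k))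
        ?_ ?_ ?_ ?_ ?_ ?_ <;> ring
    · rw [pow_two]
      refine (Al.mul hs Al).unique C ?_ ?_ ?_ ?_ ?_ ?_ <;> ring
    · rw [pow_two]
      refine (Be.mul hs Be).unique A ?_ ?_ ?_ ?_ ?_ ?_ <;> ring
    · refine (Be.mul hs B).unique ((B'.mul hs Be).mul hs (HasCoords.central_pow_inv hct k))
        ?_ ?_ ?_ ?_ ?_ ?_ <;> ring
    · refine (Al.mul hs Be).unique ((((A'.mul hs B').mul hs Be).mul hs Al).mul hs
        (HasCoords.central_pow_inv hct (k + 1))) ?_ ?_ ?_ ?_ ?_ ?_ <;> push_cast <;> ring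
  · intro φ hφ
    obtain ⟨h1, h2, h3, h4, h5, h6, h7, h8, h9, h10, h11, h12⟩ :=
      (nilRels4_iff (f := PresentedGroup.mk (nilRels4 k)) (a := PresentedGroup.of 0)
        (b := PresentedGroup.of 1) (c := PresentedGroup.of 2) (α := PresentedGroup.of 3)
        (β := PresentedGroup.of 4) rfl rfl rfl rfl rfl).1
        fun r hr => PresentedGroup.one_of_mem hr
    set a : PresentedGroup (nilRels4 k) := PresentedGroup.of 0
    set b : PresentedGroup (nilRels4 k) := PresentedGroup.of 1
    set c : PresentedGroup (nilRels4 k) := PresentedGroup.of 2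
    set α : PresentedGroup (nilRels4 k) := PresentedGroup.of 3
    set β : PresentedGroup (nilRels4 k) := PresentedGroup.of 4
    obtain ⟨ha, hb, hc⟩ := mem_closure_triple a b c
    have hαc := conj_mem_of_mul' (commutatorElement_eq_one_iff_mul_comm.1 h4).symm hc
    have hH := faithful_of_holonomy φ (M := 2) two_pos h1 h2 h3
      (conj_mem_of_mul h7 (inv_mem ha) (conj_pow_mem hαc k))
      (conj_mem_of_mul h8 (inv_mem hb) (conj_pow_inv_mem hαc k)) hαc
      (Set.mem_of_eq_of_mem h9 hc) (by simp [hk']) (by positivity) (hφ 0) (hφ 1) (hφ 2)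
      fun m hm => dvd_of_rotation_zpow two_pos (by push_cast; ring) (by rw [hφ] at hm; exact hm)
    have hle : Subgroup.closure {a, b, c} ≤ Subgroup.closure {α, a, b, c} :=
      Subgroup.closure_mono (Set.subset_insert _ _)
    have hα : α ∈ Subgroup.closure {α, a, b, c} := Subgroup.subset_closure (by simp)
    have hβc := conj_mem_of_mul' h6 (inv_mem (hle hc))
    have hβα : β * α = b * a * α * β * c ^ (k + 1) := by
      have h : α * β * c ^ (k + 1) = a⁻¹ * b⁻¹ * β * α := by
        rw [h12, inv_mul_cancel_right]
      calc β * α = b * a * (a⁻¹ * b⁻¹ * β * α) := by group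
        _ = _ := by
          rw [← h]
          group
    rw [range_fin_five]
    refine faithful_extension φ (M := 2) two_pos ?_ (Set.mem_of_eq_of_mem h10 (hle ha)) hH ?_
    · rintro s (rfl | rfl | rfl | rfl)
      · exact conj_mem_of_mul hβα (mul_mem (mul_mem (hle hb) (hle ha)) hα)
          (conj_pow_mem hβc (k + 1))
      · exact conj_mem_of_mul' (commutatorElement_eq_one_iff_mul_comm.1 h5).symm (hle ha)
      · exact conj_mem_of_mul h11 (inv_mem (hle hb)) (conj_pow_inv_mem hβc k)
      · exact hβc
    · intro x hx m hm
      -- only `β` reverses the orientation of the base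
      let ψ : PresentedGroup (nilRels4 k) →* ℤˣ := SemidirectProduct.rightHom.comp
        ((SemidirectProduct.rightHom (φ := heisAut)).comp φ)
      have hψ : ∀ g, ψ g = (φ g).right.right := fun g => rfl
      have hker : Subgroup.closure {α, a, b, c} ≤ ψ.ker := by
        rw [Subgroup.closure_le]
        rintro s (rfl | rfl | rfl | rfl) <;>
          (rw [SetLike.mem_coe, MonoidHom.mem_ker, hψ, hφ]; rfl)
      have hβ : ψ β = -1 := by
        rw [hψ, hφ]
        rfl
      have h : ψ (x * β ^ m) = 1 := by
        rw [hψ, hm]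
        rfl
      rw [map_mul, hker hx, one_mul, map_zpow, hβ] at h
      rcases Int.even_or_odd m with hm | hm
      · exact hm.two_dvd
      · rw [hm.neg_one_zpow] at h
        exact absurd h (by decide)

theorem givesFaithfulRep_five {k p : ℕ} (hk : 0 < k) : GivesFaithfulRep (nilRels5 k p) gaussField
    ![heisRot (2 * k) 0 1, heisRot (2 * k * Complex.I) 0 1, heisRot 0 (16 * k) 1,
      heisRot 0 (4 * p * k) (Circle.exp (Real.pi / 2))] := by
  have hk' : (k : ℝ) ≠ 0 := by exact_mod_cast hk.ne'
  have hs : (1 : ℝ) ^ 2 = 1 := one_pow 2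
  have haz : (2 * k : ℂ) = ⟨2 * k, 1 * 0⟩ := Complex.ext (by simp) (by simp)
  have hbz : (2 * k * Complex.I : ℂ) = ⟨0, 1 * (2 * k)⟩ := Complex.ext (by simp) (by simp)
  have h0z : (0 : ℂ) = ⟨0, 1 * 0⟩ := Complex.ext (by simp) (by simp)
  have h0t : (0 : ℝ) = 1 * 0 := by simp
  have hct : (16 * k : ℝ) = 1 * (16 * k) := by simp
  have A := HasCoords.translation haz h0t
  have B := HasCoords.translation hbz h0t
  have C := HasCoords.translation h0z hct
  have Al : HasCoords 1 (heisRot 0 (4 * p * k) (Circle.exp (Real.pi / 2))) 0 0 (4 * p * k) 0 1 1 :=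
    .rotation h0z (by simp) (by rw [circle_exp_pi_div_two]; exact Complex.ext (by simp) (by simp))
  refine givesFaithfulRep_of ?_ ?_ ?_
  · have h0 : ((0 : ℝ) : ℂ) * Complex.I ∈ intLattice Complex.I := ⟨0, 0, by simp⟩
    have h1 : ((1 : Circle) : ℂ) ∈ intLattice Complex.I := ⟨1, 0, by simp⟩
    intro i
    fin_cases i
    · exact heisRot_mem I_mem_integersIn ⟨2 * k, 0, by push_cast; ring⟩ h0 h1
    · exact heisRot_mem I_mem_integersIn ⟨0, 2 * k, by push_cast; ring⟩ h0 h1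
    · exact heisRot_mem I_mem_integersIn ⟨0, 0, by simp⟩ ⟨0, 16 * k, by push_cast; ring⟩ h1
    · exact heisRot_mem I_mem_integersIn ⟨0, 0, by simp⟩ ⟨0, 4 * p * k, by push_cast; ring⟩
        ⟨0, 1, by rw [circle_exp_pi_div_two]; simp⟩
  · rw [nilRels5_iff FreeGroup.lift_apply_of FreeGroup.lift_apply_of FreeGroup.lift_apply_of
      FreeGroup.lift_apply_of]
    refine ⟨commutator_eq_of_mul ?_, commutator_eq_one_of_mul ?_, commutator_eq_one_of_mul ?_,
      commutator_eq_one_of_mul ?_, ?_, ?_, ?_⟩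
    · refine (B.mul hs A).unique ((HasCoords.central_pow hct k).mul hs (A.mul hs B)) ?_ ?_ ?_ ?_ ?_
        ?_ <;> ring
    · refine (C.mul hs A).unique (A.mul hs C) ?_ ?_ ?_ ?_ ?_ ?_ <;> ring
    · refine (C.mul hs B).unique (B.mul hs C) ?_ ?_ ?_ ?_ ?_ ?_ <;> ring
    · refine (C.mul hs Al).unique (Al.mul hs C) ?_ ?_ ?_ ?_ ?_ ?_ <;> ring
    · refine (Al.mul hs A).unique (B.mul hs Al) ?_ ?_ ?_ ?_ ?_ ?_ <;> ring
    · refine (Al.mul hs B).unique ((HasCoords.translation_inv haz h0t).mul hs Al)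
        ?_ ?_ ?_ ?_ ?_ ?_ <;> ring
    · rw [pow_succ, pow_three']
      refine (((Al.mul hs Al).mul hs Al).mul hs Al).unique (HasCoords.central_pow hct p)
        ?_ ?_ ?_ ?_ ?_ ?_ <;> ring
  · intro φ hφ
    obtain ⟨h1, h2, h3, h4, h5, h6, h7⟩ :=
      (nilRels5_iff (f := PresentedGroup.mk (nilRels5 k p)) rfl rfl rfl rfl).1
        fun r hr => PresentedGroup.one_of_mem hr
    obtain ⟨ha, hb, hc⟩ := mem_closure_triple (PresentedGroup.of (rels := nilRels5 k p) 0)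
      (PresentedGroup.of 1) (PresentedGroup.of 2)
    rw [range_fin_four]
    refine faithful_of_holonomy φ (M := 4) four_pos h1 h2 h3
      (conj_mem_of_mul' h5 hb) (conj_mem_of_mul' h6 (inv_mem ha))
      (conj_mem_of_mul' (commutatorElement_eq_one_iff_mul_comm.1 h4).symm hc)
      (Set.mem_of_eq_of_mem h7 (pow_mem hc p)) ?_ ?_ (hφ 0) (hφ 1) (hφ 2) fun m hm => ?_
    · simp [hk']
    · positivity
    · rw [hφ] at hm
      exact dvd_of_rotation_zpow four_pos (by push_cast; ring) hm

theorem givesFaithfulRep_six {k k₁ k₂ : ℕ} (hk : 0 < k) :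
    GivesFaithfulRep (nilRels6 k k₁ k₂) eisensteinField
      ![heisRot (24 * k) 0 1, heisRot (24 * k * zeta3) 0 1,
        heisRot 0 (1152 * k * Real.sqrt 3) 1,
        heisRot
          (-(6 * (k + 2 * k₁)) + 6 * (k - 2 * k₁) * (Real.sqrt 3 : ℝ) * Complex.I)
          (48 * (k ^ 2 - 2 * k * k₁ + 4 * k₁ ^ 2 + 8 * k * k₂) * Real.sqrt 3)
          (Circle.exp (2 * Real.pi / 3))] := by
  have hk' : (k : ℝ) ≠ 0 := by exact_mod_cast hk.ne'
  have hs : (√3) ^ 2 = 3 := Real.sq_sqrt (by norm_num)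
  have haz : (24 * k : ℂ) = ⟨24 * k, √3 * 0⟩ := Complex.ext (by simp) (by simp)
  have hbz : (24 * k * zeta3 : ℂ) = ⟨-(12 * k), √3 * (12 * k)⟩ := by
    rw [zeta3_eq]
    exact Complex.ext (by simp; ring) (by simp; ring)
  have h0z : (0 : ℂ) = ⟨0, √3 * 0⟩ := Complex.ext (by simp) (by simp)
  have h0t : (0 : ℝ) = √3 * 0 := by simp
  have hct : (1152 * k * √3 : ℝ) = √3 * (1152 * k) := by ring
  have A := HasCoords.translation haz h0t
  have B := HasCoords.translation hbz h0t
  have C := HasCoords.translation h0z hct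
  have Al : HasCoords (√3) (heisRot
      (-(6 * (k + 2 * k₁)) + 6 * (k - 2 * k₁) * (√3 : ℝ) * Complex.I)
      (48 * (k ^ 2 - 2 * k * k₁ + 4 * k₁ ^ 2 + 8 * k * k₂) * √3) (Circle.exp (2 * Real.pi / 3)))
      (-(6 * (k + 2 * k₁))) (6 * (k - 2 * k₁))
      (48 * (k ^ 2 - 2 * k * k₁ + 4 * k₁ ^ 2 + 8 * k * k₂)) (-1 / 2) (1 / 2) 1 :=
    .rotation (Complex.ext (by simp) (by simp; ring)) (by ring) circle_exp_two_pi_div_three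
  refine givesFaithfulRep_of ?_ ?_ ?_
  · have h0 : ((0 : ℝ) : ℂ) * Complex.I ∈ intLattice zeta3 := ⟨0, 0, by simp⟩
    have h1 : ((1 : Circle) : ℂ) ∈ intLattice zeta3 := ⟨1, 0, by simp⟩
    have hI := sqrt_three_mul_I
    intro i
    fin_cases i
    · exact heisRot_mem zeta3_mem_integersIn ⟨24 * k, 0, by push_cast; ring⟩ h0 h1
    · exact heisRot_mem zeta3_mem_integersIn ⟨0, 24 * k, by push_cast; ring⟩ h0 h1
    · exact heisRot_mem zeta3_mem_integersIn ⟨0, 0, by simp⟩ ⟨1152 * k, 2304 * k, by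
        push_cast
        linear_combination (1152 * k : ℂ) * hI⟩ h1
    · refine heisRot_mem zeta3_mem_integersIn
        ⟨-(6 * (k + 2 * k₁)) + 6 * (k - 2 * k₁), 12 * (k - 2 * k₁), ?_⟩
        ⟨48 * (k ^ 2 - 2 * k * k₁ + 4 * k₁ ^ 2 + 8 * k * k₂),
          96 * (k ^ 2 - 2 * k * k₁ + 4 * k₁ ^ 2 + 8 * k * k₂), ?_⟩ ⟨0, 1, ?_⟩
      · push_cast
        linear_combination (6 * (k - 2 * k₁) : ℂ) * hI
      · push_cast
        linear_combination (48 * (k ^ 2 - 2 * k * k₁ + 4 * k₁ ^ 2 + 8 * k * k₂) : ℂ) * hI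
      · rw [circle_exp_two_pi_div_three, zeta3_eq]
        simp
  · rw [nilRels6_iff FreeGroup.lift_apply_of FreeGroup.lift_apply_of FreeGroup.lift_apply_of
      FreeGroup.lift_apply_of]
    refine ⟨commutator_eq_of_mul ?_, commutator_eq_one_of_mul ?_, commutator_eq_one_of_mul ?_,
      commutator_eq_one_of_mul ?_, ?_, ?_, ?_⟩
    · refine (B.mul hs A).unique ((HasCoords.central_pow hct k).mul hs (A.mul hs B)) ?_ ?_ ?_ ?_ ?_
        ?_ <;> ring
    · refine (C.mul hs A).unique (A.mul hs C) ?_ ?_ ?_ ?_ ?_ ?_ <;> ring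
    · refine (C.mul hs B).unique (B.mul hs C) ?_ ?_ ?_ ?_ ?_ ?_ <;> ring
    · refine (C.mul hs Al).unique (Al.mul hs C) ?_ ?_ ?_ ?_ ?_ ?_ <;> ring
    · refine (Al.mul hs A).unique ((B.mul hs Al).mul hs (HasCoords.central_pow hct k₁))
        ?_ ?_ ?_ ?_ ?_ ?_ <;> ring
    · refine (Al.mul hs B).unique (((HasCoords.translation_inv haz h0t).mul hs
        (HasCoords.translation_inv hbz h0t)).mul hs Al) ?_ ?_ ?_ ?_ ?_ ?_ <;> ring
    · rw [pow_three']
      refine ((Al.mul hs Al).mul hs Al).unique (HasCoords.central_pow hct k₂)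
        ?_ ?_ ?_ ?_ ?_ ?_ <;> ring
  · intro φ hφ
    obtain ⟨h1, h2, h3, h4, h5, h6, h7⟩ :=
      (nilRels6_iff (f := PresentedGroup.mk (nilRels6 k k₁ k₂)) rfl rfl rfl rfl).1
        fun r hr => PresentedGroup.one_of_mem hr
    obtain ⟨ha, hb, hc⟩ := mem_closure_triple (PresentedGroup.of (rels := nilRels6 k k₁ k₂) 0)
      (PresentedGroup.of 1) (PresentedGroup.of 2)
    have hαc := conj_mem_of_mul' (commutatorElement_eq_one_iff_mul_comm.1 h4).symm hc
    rw [range_fin_four]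
    refine faithful_of_holonomy φ (M := 3) three_pos h1 h2 h3
      (conj_mem_of_mul h5 hb (conj_pow_mem hαc k₁))
      (conj_mem_of_mul' h6 (mul_mem (inv_mem ha) (inv_mem hb))) hαc
      (Set.mem_of_eq_of_mem h7 (pow_mem hc k₂)) ?_ ?_ (hφ 0) (hφ 1) (hφ 2) fun m hm => ?_
    · rw [hbz, haz]
      simp [hk']
    · positivity
    · rw [hφ] at hm
      exact dvd_of_rotation_zpow three_pos (by push_cast; ring) hm

theorem givesFaithfulRep_seven {k k₁ : ℕ} (hk : 0 < k) :
    GivesFaithfulRep (nilRels7 k k₁) eisensteinField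
      ![heisRot (12 * k) 0 1, heisRot (12 * k * zeta3) 0 1,
        heisRot 0 (288 * k * Real.sqrt 3) 1,
        heisRot (6 * k) (12 * k * (4 * k₁ + 3 * k) * Real.sqrt 3)
          (Circle.exp (Real.pi / 3))] := by
  have hk' : (k : ℝ) ≠ 0 := by exact_mod_cast hk.ne'
  have hs : (√3) ^ 2 = 3 := Real.sq_sqrt (by norm_num)
  have haz : (12 * k : ℂ) = ⟨12 * k, √3 * 0⟩ := Complex.ext (by simp) (by simp)
  have hbz : (12 * k * zeta3 : ℂ) = ⟨-(6 * k), √3 * (6 * k)⟩ := by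
    rw [zeta3_eq]
    exact Complex.ext (by simp; ring) (by simp; ring)
  have h0z : (0 : ℂ) = ⟨0, √3 * 0⟩ := Complex.ext (by simp) (by simp)
  have h0t : (0 : ℝ) = √3 * 0 := by simp
  have hct : (288 * k * √3 : ℝ) = √3 * (288 * k) := by ring
  have A := HasCoords.translation haz h0t
  have B := HasCoords.translation hbz h0t
  have C := HasCoords.translation h0z hct
  have Al : HasCoords (√3) (heisRot (6 * k) (12 * k * (4 * k₁ + 3 * k) * √3)
      (Circle.exp (Real.pi / 3))) (6 * k) 0 (12 * k * (4 * k₁ + 3 * k)) (1 / 2) (1 / 2) 1 :=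
    .rotation (Complex.ext (by simp) (by simp)) (by ring) circle_exp_pi_div_three
  refine givesFaithfulRep_of ?_ ?_ ?_
  · have h0 : ((0 : ℝ) : ℂ) * Complex.I ∈ intLattice zeta3 := ⟨0, 0, by simp⟩
    have h1 : ((1 : Circle) : ℂ) ∈ intLattice zeta3 := ⟨1, 0, by simp⟩
    have hI := sqrt_three_mul_I
    intro i
    fin_cases i
    · exact heisRot_mem zeta3_mem_integersIn ⟨12 * k, 0, by push_cast; ring⟩ h0 h1
    · exact heisRot_mem zeta3_mem_integersIn ⟨0, 12 * k, by push_cast; ring⟩ h0 h1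
    · exact heisRot_mem zeta3_mem_integersIn ⟨0, 0, by simp⟩ ⟨288 * k, 576 * k, by
        push_cast
        linear_combination (288 * k : ℂ) * hI⟩ h1
    · refine heisRot_mem zeta3_mem_integersIn ⟨6 * k, 0, by push_cast; ring⟩
        ⟨12 * k * (4 * k₁ + 3 * k), 24 * k * (4 * k₁ + 3 * k), ?_⟩ ⟨1, 1, ?_⟩
      · push_cast
        linear_combination (12 * k * (4 * k₁ + 3 * k) : ℂ) * hI
      · rw [circle_exp_pi_div_three, zeta3_eq]
        exact Complex.ext (by simp; norm_num) (by simp)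
  · rw [nilRels7_iff FreeGroup.lift_apply_of FreeGroup.lift_apply_of FreeGroup.lift_apply_of
      FreeGroup.lift_apply_of]
    refine ⟨commutator_eq_of_mul ?_, commutator_eq_one_of_mul ?_, commutator_eq_one_of_mul ?_,
      commutator_eq_one_of_mul ?_, ?_, ?_, ?_⟩
    · refine (B.mul hs A).unique ((HasCoords.central_pow hct k).mul hs (A.mul hs B)) ?_ ?_ ?_ ?_ ?_
        ?_ <;> ring
    · refine (C.mul hs A).unique (A.mul hs C) ?_ ?_ ?_ ?_ ?_ ?_ <;> ring
    · refine (C.mul hs B).unique (B.mul hs C) ?_ ?_ ?_ ?_ ?_ ?_ <;> ring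
    · refine (C.mul hs Al).unique (Al.mul hs C) ?_ ?_ ?_ ?_ ?_ ?_ <;> ring
    · refine (Al.mul hs A).unique ((A.mul hs B).mul hs Al) ?_ ?_ ?_ ?_ ?_ ?_ <;> ring
    · refine (Al.mul hs B).unique ((HasCoords.translation_inv haz h0t).mul hs Al)
        ?_ ?_ ?_ ?_ ?_ ?_ <;> ring
    · rw [show (6 : ℕ) = 3 * 2 from rfl, pow_mul, pow_two, pow_three']
      have A3 := (Al.mul hs Al).mul hs Al
      refine (A3.mul hs A3).unique (HasCoords.central_pow hct k₁) ?_ ?_ ?_ ?_ ?_ ?_ <;> ring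
  · intro φ hφ
    obtain ⟨h1, h2, h3, h4, h5, h6, h7⟩ :=
      (nilRels7_iff (f := PresentedGroup.mk (nilRels7 k k₁)) rfl rfl rfl rfl).1
        fun r hr => PresentedGroup.one_of_mem hr
    obtain ⟨ha, hb, hc⟩ := mem_closure_triple (PresentedGroup.of (rels := nilRels7 k k₁) 0)
      (PresentedGroup.of 1) (PresentedGroup.of 2)
    rw [range_fin_four]
    refine faithful_of_holonomy φ (M := 6) (by norm_num) h1 h2 h3
      (conj_mem_of_mul' h5 (mul_mem ha hb)) (conj_mem_of_mul' h6 (inv_mem ha))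
      (conj_mem_of_mul' (commutatorElement_eq_one_iff_mul_comm.1 h4).symm hc)
      (Set.mem_of_eq_of_mem h7 (pow_mem hc k₁)) ?_ ?_ (hφ 0) (hφ 1) (hφ 2) fun m hm => ?_
    · rw [hbz, haz]
      simp [hk']
    · positivity
    · rw [hφ] at hm
      exact dvd_of_rotation_zpow (by norm_num) (by push_cast; ring) hm

theorem theorem7 :
    -- every closed nil 3-manifold group has a faithful integral representation
    (∀ (M : Type*) [TopologicalSpace M], IsClosedNilThreeManifold M → ∀ x : M,
      ∃ k : IntermediateField ℚ ℂ, (k = gaussField ∨ k = eisensteinField) ∧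
        ∃ φ : FundamentalGroup M x →* heisIntegralIota (integersIn k),
          Function.Injective φ) ∧
    -- the explicit representations of the seven families
    (∀ k : ℕ, 0 < k → GivesFaithfulRep (nilRels1 k) gaussField
      ![heisRot (2 * k) 0 1, heisRot (2 * k * Complex.I) 0 1, heisRot 0 (16 * k) 1]) ∧
    (∀ k : ℕ, 0 < k → Even k → GivesFaithfulRep (nilRels2 k) gaussField
      ![heisRot (2 * k) 0 1, heisRot (2 * k * Complex.I) 0 1, heisRot 0 (16 * k) 1,
        heisRot 0 (8 * k) (Circle.exp Real.pi)]) ∧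
    (∀ k : ℕ, 0 < k → GivesFaithfulRep (nilRels3 k) gaussField
      ![heisRot (4 * k) 0 1, heisRot (4 * k * Complex.I) 0 1, heisRot 0 (32 * k) 1,
        heisRotIota (2 * k) 0 1]) ∧
    (∀ k : ℕ, 0 < k → Even k → GivesFaithfulRep (nilRels4 k) gaussField
      ![heisRot (4 * k) 0 1, heisRot (4 * k * Complex.I) 0 1, heisRot 0 (32 * k) 1,
        heisRot (-(2 * k) - 2 * k * Complex.I) (16 * k) (Circle.exp Real.pi),
        heisRotIota (2 * k) 0 1]) ∧
    (∀ k p : ℕ, 0 < k → (2 ∣ k ∧ p = 1 ∨ 4 ∣ k ∧ p = 3) →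
      GivesFaithfulRep (nilRels5 k p) gaussField
        ![heisRot (2 * k) 0 1, heisRot (2 * k * Complex.I) 0 1, heisRot 0 (16 * k) 1,
          heisRot 0 (4 * p * k) (Circle.exp (Real.pi / 2))]) ∧
    (∀ k k₁ k₂ : ℕ, 0 < k →
      (k % 3 = 0 ∧ k₁ = 0 ∧ k₂ = 1 ∨ k % 3 = 0 ∧ k₁ = 0 ∧ k₂ = 2 ∨
        (k % 3 = 1 ∨ k % 3 = 2) ∧ k₁ = 1 ∧ k₂ = 1) →
      GivesFaithfulRep (nilRels6 k k₁ k₂) eisensteinField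
        ![heisRot (24 * k) 0 1, heisRot (24 * k * zeta3) 0 1,
          heisRot 0 (1152 * k * Real.sqrt 3) 1,
          heisRot
            (-(6 * (k + 2 * k₁)) + 6 * (k - 2 * k₁) * (Real.sqrt 3 : ℝ) * Complex.I)
            (48 * (k ^ 2 - 2 * k * k₁ + 4 * k₁ ^ 2 + 8 * k * k₂) * Real.sqrt 3)
            (Circle.exp (2 * Real.pi / 3))]) ∧
    (∀ k k₁ : ℕ, 0 < k →
      (k % 6 = 0 ∧ k₁ = 1 ∨ k % 6 = 4 ∧ k₁ = 1 ∨ k % 6 = 0 ∧ k₁ = 5 ∨ k % 6 = 2 ∧ k₁ = 5) →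
      GivesFaithfulRep (nilRels7 k k₁) eisensteinField
        ![heisRot (12 * k) 0 1, heisRot (12 * k * zeta3) 0 1,
          heisRot 0 (288 * k * Real.sqrt 3) 1,
          heisRot (6 * k) (12 * k * (4 * k₁ + 3 * k) * Real.sqrt 3)
            (Circle.exp (Real.pi / 3))]) :=
  ⟨fun M _ hM x => exists_integral_representation M hM x,
    fun _ hk => givesFaithfulRep_one hk,
    fun _ hk _ => givesFaithfulRep_two hk,
    fun _ hk => givesFaithfulRep_three hk,
    fun _ hk _ => givesFaithfulRep_four hk,
    fun _ _ hk _ => givesFaithfulRep_five hk,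
    fun _ _ _ hk _ => givesFaithfulRep_six hk,
    fun _ _ hk _ => givesFaithfulRep_seven hk⟩
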